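/- Let $S^3$ be the sphere of unit quaternions and let $p\colon S^3\to S^2$, $p(q)=q\,i\,\bar q$, be the Hopf projection onto the unit sphere of imaginary quaternions; its fibers are the great circles $\{qe^{it}\}$. A tangent vector of $S^3$ is *horizontal* if it is orthogonal to the Hopf fiber through its base point, and $\mathrm{Exp}$ is the Riemannian exponential map of $S^3$. For a horizontal vector field $V$ along a Hopf fiber $F$ let $$E(V\text{ on }F)=\frac1{2\pi}\int_F\tfrac12\|V\|^2,\qquad \overline V=\frac1{2\pi}\int_F p_*V\in T_{p(F)}S^2,$$ with integration by arc length along $F$; $V$ is *balanced on* $F$ if $\overline V=0$. For $u\in S^2$ write $F_u=p^{-1}(u)$ and $B_r(u)=\{x\in S^2: |x-u|<r\}$. **Theorem.** There is $r_0>0$ such that for every $0<r\le r_0$ there is $\varepsilon>0$ with the following property. Let $f\colon S^3\to S^3$ be a $C^\infty$ diffeomorphism that is $\varepsilon$-close to the identity in the $C^1$ sense (that is, $|f(q)-q|<\varepsilon$ for all $q\in S^3$, and $|df_q(\xi)-\xi|\le\varepsilon|\xi|$ for all $\xi\in T_qS^3$, where tangent vectors are viewed in the space of quaternions). 1. For every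 source fiber $F_u$ and every $q\in S^3$ with $p(q)\in B_r(u)$ there is a unique horizontal vector $V_u(q)$ at $q$ with $\|V_u(q)\|<\pi/2$ and $\mathrm{Exp}_q V_u(q)\in f(F_u)$. This shooting field $V_u(q)$ is $C^\infty$ in $(u,q)$, and $E_u(x)=E(V_u\text{ on }F_x)$ is $C^\infty$ in $(u,x)$ on $\{x\in B_r(u)\}$. 2. For every $u\in S^2$ the Riemannian Hessian of $E_u$ is positive definite at every point of $B_r(u)$. 3. For every $u\in S^2$ the function $E_u$ has a unique minimum point $m(u)$ on the open set $B_r(u)$, and $m\colon S^2\to S^2$ is $C^\infty$. 4. For every $u\in S^2$ there is a unique point $b(u)\in B_r(u)$ such that the shooting field $V_u$ is balanced on the fiber $F_{b(u)}$, and $b\colon S^2\to S^2$ is $C^\infty$. -/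

import Mathlib

open scoped Quaternion Manifold ContDiff

namespace HopfHunt

noncomputable section

/-- The unit three-sphere, as the sphere of unit quaternions. -/
abbrev S3 : Type := Metric.sphere (0 : ℍ[ℝ]) 1

/-- Euclidean three-space. -/
abbrev E3 : Type := EuclideanSpace ℝ (Fin 3)

/-- The unit two-sphere in Euclidean three-space. -/
abbrev S2 : Type := Metric.sphere (0 : E3) 1

instance finrankQuaternion : Fact (Module.finrank ℝ ℍ[ℝ] = 3 + 1) :=
  ⟨Quaternion.finrank_eq_four⟩

/-- The quaternion `a + b i + c j + d k`. -/
def quat (a b c d : ℝ) : ℍ[ℝ] := ⟨a, b, c, d⟩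

@[simp] theorem quat_re (a b c d : ℝ) : (quat a b c d).re = a := rfl
@[simp] theorem quat_imI (a b c d : ℝ) : (quat a b c d).imI = b := rfl
@[simp] theorem quat_imJ (a b c d : ℝ) : (quat a b c d).imJ = c := rfl
@[simp] theorem quat_imK (a b c d : ℝ) : (quat a b c d).imK = d := rfl

/-- The quaternion unit `i`. -/
def quatI : ℍ[ℝ] := quat 0 1 0 0

/-! ### The Hopf fibration -/

/-- The map `q ↦ q i q̄` from the quaternions to the imaginary quaternions, the latter identified
with Euclidean three-space by means of the basis `i, j, k`. -/
def hopfAmbient (q : ℍ[ℝ]) : E3 :=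
  !₂[(q * quatI * star q).imI, (q * quatI * star q).imJ, (q * quatI * star q).imK]

theorem mem_S3_iff (q : ℍ[ℝ]) :
    q ∈ Metric.sphere (0 : ℍ[ℝ]) 1 ↔ q.re ^ 2 + q.imI ^ 2 + q.imJ ^ 2 + q.imK ^ 2 = 1 := by
  rw [mem_sphere_zero_iff_norm, ← Quaternion.normSq_def', Quaternion.normSq_eq_norm_mul_self,
    ← pow_two, pow_eq_one_iff_of_nonneg (norm_nonneg _) two_ne_zero]

theorem mem_S2_iff (x : E3) :
    x ∈ Metric.sphere (0 : E3) 1 ↔ x 0 ^ 2 + x 1 ^ 2 + x 2 ^ 2 = 1 := by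
  rw [mem_sphere_zero_iff_norm, EuclideanSpace.norm_eq, Real.sqrt_eq_one]
  simp [Fin.sum_univ_three]

theorem hopfAmbient_eq (q : ℍ[ℝ]) :
    hopfAmbient q = !₂[q.re ^ 2 + q.imI ^ 2 - q.imJ ^ 2 - q.imK ^ 2,
      2 * (q.imI * q.imJ + q.re * q.imK), 2 * (q.imI * q.imK - q.re * q.imJ)] := by
  ext i
  fin_cases i <;> simp [hopfAmbient, quatI] <;> ring

theorem hopfAmbient_mem (q : S3) : hopfAmbient (q : ℍ[ℝ]) ∈ Metric.sphere (0 : E3) 1 := by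
  have h := (mem_S3_iff q).1 q.2
  rw [mem_S2_iff, hopfAmbient_eq]
  simp
  linear_combination ((q : ℍ[ℝ]).re ^ 2 + (q : ℍ[ℝ]).imI ^ 2 + (q : ℍ[ℝ]).imJ ^ 2
    + (q : ℍ[ℝ]).imK ^ 2 + 1) * h

/-- The Hopf projection `p : S³ → S²`, `p q = q i q̄`. -/
def hopf (q : S3) : S2 := ⟨hopfAmbient q, hopfAmbient_mem q⟩

/-- The Hopf fiber over a point of `S²`. -/
def fiber (x : S2) : Set S3 := hopf ⁻¹' {x}

theorem mul_quat_mem (q : S3) (t : ℝ) :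
    (q : ℍ[ℝ]) * quat (Real.cos t) (Real.sin t) 0 0 ∈ Metric.sphere (0 : ℍ[ℝ]) 1 := by
  have h := (mem_S3_iff q).1 q.2
  have h2 := Real.sin_sq_add_cos_sq t
  rw [mem_S3_iff]
  simp
  linear_combination (Real.sin t ^ 2 + Real.cos t ^ 2) * h + h2

/-- The unit-speed flow `q ↦ q e^{it}` along the Hopf fibers. -/
def rot (q : S3) (t : ℝ) : S3 :=
  ⟨(q : ℍ[ℝ]) * quat (Real.cos t) (Real.sin t) 0 0, mul_quat_mem q t⟩

theorem rot_rot (q : S3) (s t : ℝ) : rot (rot q s) t = rot q (s + t) := by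
  apply Subtype.ext
  ext <;> simp [rot, Real.cos_add, Real.sin_add] <;> ring

theorem rot_add_two_pi (q : S3) (t : ℝ) : rot q (t + 2 * Real.pi) = rot q t := by
  apply Subtype.ext
  simp [rot]

theorem hopf_rot (q : S3) (t : ℝ) : hopf (rot q t) = hopf q := by
  have h2 := Real.sin_sq_add_cos_sq t
  apply Subtype.ext
  simp only [hopf, hopfAmbient_eq, rot]
  ext i
  fin_cases i
  · simp
    linear_combination ((q : ℍ[ℝ]).re ^ 2 + (q : ℍ[ℝ]).imI ^ 2 - (q : ℍ[ℝ]).imJ ^ 2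
      - (q : ℍ[ℝ]).imK ^ 2) * h2
  · simp
    linear_combination ((q : ℍ[ℝ]).imI * (q : ℍ[ℝ]).imJ + (q : ℍ[ℝ]).re * (q : ℍ[ℝ]).imK) * h2
  · simp
    linear_combination ((q : ℍ[ℝ]).imI * (q : ℍ[ℝ]).imK - (q : ℍ[ℝ]).re * (q : ℍ[ℝ]).imJ) * h2

theorem hopf_surjective : Function.Surjective hopf := by
  rintro ⟨x, hx⟩
  have h := (mem_S2_iff x).1 hx
  by_cases h1 : x 0 = -1
  · have h2 : x 1 = 0 := by nlinarith [sq_nonneg (x 1), sq_nonneg (x 2)]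
    have h3 : x 2 = 0 := by nlinarith [sq_nonneg (x 1), sq_nonneg (x 2)]
    refine ⟨⟨quat 0 0 1 0, by rw [mem_S3_iff]; simp⟩, Subtype.ext ?_⟩
    simp only [hopf, hopfAmbient_eq]
    ext i
    fin_cases i <;> simp [h1, h2, h3]
  · have hp : 0 < (1 + x 0) / 2 := by
      have : -1 ≤ x 0 := by nlinarith [sq_nonneg (x 1), sq_nonneg (x 2)]
      have : -1 < x 0 := lt_of_le_of_ne this (Ne.symm h1)
      linarith
    obtain ⟨a, ha, hsq⟩ : ∃ a : ℝ, 0 < a ∧ a ^ 2 = (1 + x 0) / 2 :=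
      ⟨Real.sqrt ((1 + x 0) / 2), Real.sqrt_pos.2 hp, Real.sq_sqrt hp.le⟩
    have ha' := ha.ne'
    have hcd : (-x 2 / (2 * a)) ^ 2 + (x 1 / (2 * a)) ^ 2 = 1 - a ^ 2 := by
      field_simp
      nlinarith
    refine ⟨⟨quat a 0 (-x 2 / (2 * a)) (x 1 / (2 * a)), ?_⟩, Subtype.ext ?_⟩
    · rw [mem_S3_iff]
      simp only [quat_re, quat_imI, quat_imJ, quat_imK]
      linarith
    · simp only [hopf, hopfAmbient_eq, quat_re, quat_imI, quat_imJ, quat_imK]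
      ext i
      fin_cases i
      · simp only [Fin.zero_eta, Matrix.cons_val_zero]
        linarith
      · simp
        field_simp
      · simp
        field_simp

/-- The Hopf fibers are exactly the orbits of the flow `q ↦ q e^{it}`. -/
theorem hopf_eq_iff (q q' : S3) : hopf q' = hopf q ↔ ∃ t : ℝ, q' = rot q t := by
  constructor
  · intro h
    have h0 : ∀ p : S3, ((p : ℍ[ℝ]) * quatI * star (p : ℍ[ℝ])).re = 0 := by
      intro p
      simp [quatI]
      ring
    have hm : ∀ p : S3, star (p : ℍ[ℝ]) * (p : ℍ[ℝ]) = 1 := by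
      intro p
      rw [Quaternion.star_mul_self, Quaternion.normSq_def', (mem_S3_iff p).1 p.2]
      simp
    have hm' : (q : ℍ[ℝ]) * star (q : ℍ[ℝ]) = 1 := by
      rw [Quaternion.self_mul_star, Quaternion.normSq_def', (mem_S3_iff q).1 q.2]
      simp
    have hE : hopfAmbient q' = hopfAmbient q := congrArg Subtype.val h
    have hq : (q' : ℍ[ℝ]) * quatI * star (q' : ℍ[ℝ]) = (q : ℍ[ℝ]) * quatI * star (q : ℍ[ℝ]) := by
      have e0 := congrArg (fun v : E3 => v 0) hE
      have e1 := congrArg (fun v : E3 => v 1) hE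
      have e2 := congrArg (fun v : E3 => v 2) hE
      simp only [hopfAmbient, PiLp.toLp_apply] at e0 e1 e2
      refine Quaternion.ext _ _ ?_ ?_ ?_ ?_
      · rw [h0, h0]
      · exact e0
      · exact e1
      · exact e2
    obtain ⟨w, hw⟩ : ∃ w : ℍ[ℝ], w = star (q : ℍ[ℝ]) * q' := ⟨_, rfl⟩
    have hqw : (q' : ℍ[ℝ]) = q * w := by rw [hw, ← mul_assoc, hm', one_mul]
    have hcomm : w * quatI = quatI * w := by
      calc w * quatI = star (q : ℍ[ℝ]) * (q' * quatI * star (q' : ℍ[ℝ])) * q' := by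
            rw [hw]; simp only [mul_assoc, hm, mul_one]
        _ = (star (q : ℍ[ℝ]) * q) * quatI * (star (q : ℍ[ℝ]) * q') := by
            rw [hq]; simp only [mul_assoc]
        _ = quatI * w := by rw [hm, one_mul, hw]
    have hj : w.imJ = 0 := by
      have := congrArg (fun z : ℍ[ℝ] => z.imK) hcomm
      simp [quatI] at this
      linarith
    have hk : w.imK = 0 := by
      have := congrArg (fun z : ℍ[ℝ] => z.imJ) hcomm
      simp [quatI] at this
      linarith
    have hn : w.re ^ 2 + w.imI ^ 2 = 1 := by
      have h1 : ‖w‖ = 1 := by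
        rw [hw, norm_mul, norm_star, norm_eq_of_mem_sphere q, norm_eq_of_mem_sphere q', one_mul]
      have := (mem_S3_iff w).1 (mem_sphere_zero_iff_norm.2 h1)
      rw [hj, hk] at this
      linarith
    have hz : ‖(⟨w.re, w.imI⟩ : ℂ)‖ = 1 := by
      rw [← pow_eq_one_iff_of_nonneg (norm_nonneg _) two_ne_zero, ← Complex.normSq_eq_norm_sq,
        Complex.normSq_mk]
      linarith
    have hz0 : (⟨w.re, w.imI⟩ : ℂ) ≠ 0 := by
      rw [← norm_ne_zero_iff, hz]; exact one_ne_zero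
    refine ⟨Complex.arg ⟨w.re, w.imI⟩, Subtype.ext ?_⟩
    rw [hqw]
    simp only [rot, Complex.cos_arg hz0, Complex.sin_arg, hz, div_one]
    congr 1
    exact Quaternion.ext _ _ rfl rfl hj hk
  · rintro ⟨t, rfl⟩
    exact hopf_rot q t

/-- The integral of a function along the Hopf fiber over `x`, with respect to arc length. -/
def fiberIntegral {G : Type*} [NormedAddCommGroup G] [NormedSpace ℝ G]
    (g : S3 → G) (x : S2) : G :=
  ∫ t in (0 : ℝ)..(2 * Real.pi), g (rot (Function.surjInv hopf_surjective x) t)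

/-- The integral along a fiber may be computed from any point of the fiber. -/
theorem fiberIntegral_hopf {G : Type*} [NormedAddCommGroup G] [NormedSpace ℝ G]
    (g : S3 → G) (q : S3) :
    fiberIntegral g (hopf q) = ∫ t in (0 : ℝ)..(2 * Real.pi), g (rot q t) := by
  obtain ⟨s, hs⟩ := (hopf_eq_iff q (Function.surjInv hopf_surjective (hopf q))).1
    (Function.surjInv_eq hopf_surjective (hopf q))
  have hper : Function.Periodic (fun t => g (rot q t)) (2 * Real.pi) := fun t => by
    simp only [rot_add_two_pi]
  unfold fiberIntegral
  rw [hs]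
  simp only [rot_rot]
  rw [intervalIntegral.integral_comp_add_left (fun t => g (rot q t)) s]
  have := hper.intervalIntegral_add_eq s 0
  simpa using this

/-! ### Horizontal vectors and shooting -/

/-- `v` is a tangent vector of `S³` at `q` that is orthogonal to the Hopf fiber through `q`
(whose unit tangent vector at `q` is `q i`). -/
def IsHorizontal (q : S3) (v : ℍ[ℝ]) : Prop :=
  inner ℝ (q : ℍ[ℝ]) v = 0 ∧ inner ℝ ((q : ℍ[ℝ]) * quatI) v = 0

/-- The Riemannian exponential map of `S³`:
`Exp_q v = cos ‖v‖ q + (sin ‖v‖ / ‖v‖) v` for `v` tangent to `S³` at `q`. -/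
def expS3 (q : S3) (v : ℍ[ℝ]) : ℍ[ℝ] :=
  Real.cos ‖v‖ • (q : ℍ[ℝ]) + Real.sinc ‖v‖ • v

/-- `v` is a horizontal tangent vector at `q`, of length less than `π / 2`, whose exponential
image lies on the target `T`. -/
def IsShootingVector (T : Set S3) (q : S3) (v : ℍ[ℝ]) : Prop :=
  IsHorizontal q v ∧ ‖v‖ < Real.pi / 2 ∧ ∃ y ∈ T, expS3 q v = (y : ℍ[ℝ])

/-- The energy `(1 / 2π) ∫_F ½ ‖V‖²` of a vector field `V` on the Hopf fiber `F` over `x`. -/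
def energy (V : S3 → ℍ[ℝ]) (x : S2) : ℝ :=
  1 / (2 * Real.pi) * fiberIntegral (fun q => 1 / 2 * ‖V q‖ ^ 2) x

/-- The average value `(1 / 2π) ∫_F V` of a horizontal vector field `V` on the Hopf fiber `F`
over `x`: the vectors are projected to the tangent plane of `S²` at `x` by the differential of the
Hopf projection, and integrated there with respect to arc length along `F`. -/
def average (V : S3 → ℍ[ℝ]) (x : S2) : E3 :=
  (1 / (2 * Real.pi)) • fiberIntegral (fun q => fderiv ℝ hopfAmbient (q : ℍ[ℝ]) (V q)) x

/-- The vector field `V` is balanced on the Hopf fiber over `x`. -/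
def IsBalancedOn (V : S3 → ℍ[ℝ]) (x : S2) : Prop := average V x = 0

/-! ### The Riemannian Hessian on the two-sphere -/

/-- The extension of a function on `S²` to `ℝ³ ∖ {0}` that is constant on rays. -/
def radialExt {G : Type*} [Zero G] (g : S2 → G) (y : E3) : G :=
  open Classical in
  if h : y ≠ 0 then
    g ⟨‖y‖⁻¹ • y, by
      rw [mem_sphere_zero_iff_norm, norm_smul, norm_inv, norm_norm,
        inv_mul_cancel₀ (norm_ne_zero_iff.2 h)]⟩
  else 0

/-- The gradient of a function on `S²`. It is the Euclidean gradient of the extension that is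
constant on rays; this is tangent to `S²`. -/
def sphereGrad (φ : S2 → ℝ) (x : S2) : E3 := gradient (radialExt φ) (x : E3)

/-- The Levi-Civita covariant derivative `∇_U X` on `S²` of a vector field `X` at `x`: the
orthogonal projection to the tangent plane at `x` of the Euclidean derivative of `X` in the
tangent direction `U`. -/
def covDeriv (X : S2 → E3) (x : S2) (U : E3) : E3 :=
  fderiv ℝ (radialExt X) (x : E3) U
    - inner ℝ (x : E3) (fderiv ℝ (radialExt X) (x : E3) U) • (x : E3)

/-- The Riemannian Hessian `(Hess φ)(U, W) = ⟨∇_U (∇ φ), W⟩` on `S²`, for `U` and `W` tangent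
to `S²` at `x`. -/
def sphereHess (φ : S2 → ℝ) (x : S2) (U W : E3) : ℝ :=
  inner ℝ (covDeriv (sphereGrad φ) x U) W

/-- The Hessian of `φ` at `x` is a positive definite symmetric bilinear form on the tangent plane
of `S²` at `x`. -/
def HessPosDef (φ : S2 → ℝ) (x : S2) : Prop :=
  (∀ U W : E3, inner ℝ (x : E3) U = 0 → inner ℝ (x : E3) W = 0 →
    sphereHess φ x U W = sphereHess φ x W U) ∧
  ∀ U : E3, inner ℝ (x : E3) U = 0 → U ≠ 0 → 0 < sphereHess φ x U U

/-! ### Closeness to the identity -/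

/-- `f : S³ → S³` is `ε`-close to the identity in the `C¹` sense: both `f - id` and its
differential, measured in the ambient space of quaternions, are smaller than `ε`. -/
def C1NearId (f : S3 → S3) (ε : ℝ) : Prop :=
  (∀ q : S3, ‖(f q : ℍ[ℝ]) - (q : ℍ[ℝ])‖ < ε) ∧
  ∀ (q : S3) (ξ : TangentSpace (𝓡 3) q),
    ‖mvfderiv (𝓡 3) (fun y : S3 => (f y : ℍ[ℝ]) - (y : ℍ[ℝ])) q ξ‖
      ≤ ε * ‖mvfderiv (𝓡 3) (fun y : S3 => (y : ℍ[ℝ])) q ξ‖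

end

end HopfHunt

open HopfHunt

namespace HopfHunt

open Filter Topology MeasureTheory

/-! ### Integrals depending smoothly on a parameter -/

section ParametricIntegral

/-! There are two obstacles: the shooting field is defined only implicitly, and `C¹` closeness of
`f` looks too weak to control second derivatives of `E_u`. Both disappear when integrals over the
fiber `F_x` are pulled back to the source fiber. If `p(y)` is not antipodal to `x`, the point of
`F_x` closest to `y` is the normalized orthogonal projection of `y` to the plane of `F_x`, and the
minimizing geodesic from this foot point to `y` is horizontal. So at the foot point of `f(s)` the
shooting vector is explicit in `f(s)` (`C1NearId.shootField_footPoint`). It has length `θ` with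
`cos² θ = (1 + ⟨p(f(s)), x⟩)/2`. As `s` runs through the source fiber, the foot points run once
around `F_x`, with a speed `J` that is explicit in `x`, in `f(s)` and in the derivative of `f` along
the fiber (`C1NearId.footPoint_eq_rot`, `C1NearId.arcLift_two_pi`).

Hence energy and average are means over `F_u` of fixed smooth functions of a first order jet of `f`
and of `x` (`C1NearId.energy_shootField`, `C1NearId.average_shootField`). Differentiation in `x`
never falls on `f`, so `C¹` closeness does control the Hessian.

Charts on `S²` are avoided by passing to vector fields on `ℝ³` that depend on the jet: four times
the gradient of the ray-constant energy density, respectively a negative multiple of the tangential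
part of `p(f(s))`, each plus the radial term `((‖y‖² - 1)/2) y`. For `f = id` both vanish at `u`
with derivative the identity; the energy is then one eighth of the squared spherical distance to
`u`. The inner product with `y` is always `(‖y‖² - 1)‖y‖²/2`, which forces zeros onto the sphere.

Compactness of `S²` gives a uniform ball around `u` on which these fields, for all nearby jets,
differ from the identity by a `1/2`-Lipschitz map, and this property passes to means over the fiber
(`IsHopfField.exists_hasGoodMean`). Such a map has exactly one zero if its value at the center is
small, and an invertible derivative. The implicit function theorem then makes the zero smooth in
`u`. For the energy, the lower bound on the derivative is the positivity of the Hessian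
(`C1NearId.hessPosDef_energy`), and integration along segments gives the strict minimum
(`C1NearId.energy_lt`). -/

theorem eventually_forall_norm_le_of_continuousAt {X B : Type*} [TopologicalSpace X]
    [NormedAddCommGroup B] {G : X × ℝ → B} {K : Set ℝ} (hK : IsCompact K) {x₀ : X}
    (h : ∀ t ∈ K, ContinuousAt G (x₀, t)) :
    ∃ C : ℝ, ∀ᶠ x in 𝓝 x₀, ∀ t ∈ K, ‖G (x, t)‖ ≤ C := by
  have hc : ContinuousOn (fun t => G (x₀, t)) K := fun t ht =>
    (ContinuousAt.comp (f := fun t : ℝ => (x₀, t)) (h t ht) (by fun_prop)).continuousWithinAt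
  obtain ⟨C, hC⟩ := hK.exists_bound_of_continuousOn hc
  refine ⟨C + 1, hK.eventually_forall_of_forall_eventually fun t ht => ?_⟩
  have := (h t ht).norm.eventually (gt_mem_nhds (lt_of_le_of_lt (hC t ht) (lt_add_one C)))
  filter_upwards [this] with z hz using hz.le

variable {A B : Type} [NormedAddCommGroup A] [NormedSpace ℝ A]
  [NormedAddCommGroup B] [NormedSpace ℝ B]

/-- Differentiation under the integral sign. Compactness of the interval gives one neighbourhood of
`x₀` on which the derivative is bounded by a constant, which serves as the dominating function. -/
theorem hasFDerivAt_intervalIntegral {Ξ : A → ℝ → B} {x₀ : A} {a b : ℝ}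
    (h : ∀ t ∈ Set.uIcc a b, ContDiffAt ℝ 1 (Function.uncurry Ξ) (x₀, t)) :
    HasFDerivAt (fun x => ∫ t in a..b, Ξ x t) (∫ t in a..b, fderiv ℝ (fun x => Ξ x t) x₀) x₀ := by
  have hev : ∀ᶠ x in 𝓝 x₀, ∀ t ∈ Set.uIcc a b, ContDiffAt ℝ 1 (Function.uncurry Ξ) (x, t) :=
    isCompact_uIcc.eventually_forall_of_forall_eventually fun t ht =>
      (h t ht).eventually (by simp)
  have hsl : ∀ x t, ContDiffAt ℝ 1 (Function.uncurry Ξ) (x, t) →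
      HasFDerivAt (fun x => Ξ x t)
        ((fderiv ℝ (Function.uncurry Ξ) (x, t)).comp (.inl ℝ A ℝ)) x := fun x t hx =>
    (hx.differentiableAt one_ne_zero).hasFDerivAt.comp (f := fun x : A => (x, t)) x
      (hasFDerivAt_prodMk_left x t)
  have hD : ∀ t ∈ Set.uIcc a b, ContinuousAt (fun z : A × ℝ =>
      (fderiv ℝ (Function.uncurry Ξ) z).comp (.inl ℝ A ℝ)) (x₀, t) := fun t ht =>
    (((h t ht).fderiv_right (m := 0) (by simp)).continuousAt).clm_comp continuousAt_const
  obtain ⟨C, hC⟩ := eventually_forall_norm_le_of_continuousAt isCompact_uIcc hD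
  have hcont : ∀ x, (∀ t ∈ Set.uIcc a b, ContDiffAt ℝ 1 (Function.uncurry Ξ) (x, t)) →
      ContinuousOn (Ξ x) (Set.uIcc a b) := fun x hx t ht =>
    (ContinuousAt.comp (f := fun t : ℝ => (x, t)) (hx t ht).continuousAt
      (by fun_prop)).continuousWithinAt
  have hcontD : ContinuousOn (fun t => fderiv ℝ (fun x => Ξ x t) x₀) (Set.uIcc a b) := by
    have : ContinuousOn (fun t => (fderiv ℝ (Function.uncurry Ξ) (x₀, t)).comp (.inl ℝ A ℝ))
        (Set.uIcc a b) := fun t ht =>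
      (ContinuousAt.comp (f := fun t : ℝ => (x₀, t)) (hD t ht) (by fun_prop)).continuousWithinAt
    exact this.congr fun t ht => (hsl x₀ t (h t ht)).fderiv
  refine intervalIntegral.hasFDerivAt_integral_of_dominated_of_fderiv_le (μ := volume)
    (F := Ξ) (F' := fun x t => fderiv ℝ (fun x => Ξ x t) x) (bound := fun _ => C)
    (Filter.inter_mem hev hC) ?_ ?_ ?_ ?_ ?_ ?_
  · filter_upwards [hev] with x hx
    exact ((hcont x hx).mono Set.uIoc_subset_uIcc).aestronglyMeasurable measurableSet_uIoc
  · exact (hcont x₀ h).intervalIntegrable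
  · exact (hcontD.mono Set.uIoc_subset_uIcc).aestronglyMeasurable measurableSet_uIoc
  · refine ae_of_all _ fun t ht x hx => ?_
    have ht' := Set.uIoc_subset_uIcc ht
    rw [(hsl x t (hx.1 t ht')).fderiv]
    exact hx.2 t ht'
  · exact intervalIntegrable_const
  · refine ae_of_all _ fun t ht x hx => ?_
    have := hsl x t (hx.1 t (Set.uIoc_subset_uIcc ht))
    rwa [this.fderiv]

/-- Induction for all target spaces at once: the derivative is again a parametric integral, now of a
map into `A →L[ℝ] B` with one order of smoothness less. -/
theorem contDiffOn_intervalIntegral_nat (n : ℕ) {Ξ : A → ℝ → B} {O : Set A} (hO : IsOpen O)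
    {a b : ℝ} (h : ∀ x ∈ O, ∀ t ∈ Set.uIcc a b, ContDiffAt ℝ n (Function.uncurry Ξ) (x, t)) :
    ContDiffOn ℝ n (fun x => ∫ t in a..b, Ξ x t) O := by
  induction n generalizing B with
  | zero =>
    simp only [Nat.cast_zero, contDiffOn_zero]
    intro x₀ hx₀
    apply ContinuousAt.continuousWithinAt
    obtain ⟨C, hC⟩ := eventually_forall_norm_le_of_continuousAt (G := Function.uncurry Ξ)
      isCompact_uIcc fun t ht => (h x₀ hx₀ t ht).continuousAt
    refine intervalIntegral.continuousAt_of_dominated_interval (bound := fun _ => C) ?_ ?_ ?_ ?_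
    · filter_upwards [hO.mem_nhds hx₀] with x hx
      have : ContinuousOn (Ξ x) (Set.uIcc a b) := fun t ht =>
        (ContinuousAt.comp (f := fun t : ℝ => (x, t)) (h x hx t ht).continuousAt
          (by fun_prop)).continuousWithinAt
      exact (this.mono Set.uIoc_subset_uIcc).aestronglyMeasurable measurableSet_uIoc
    · filter_upwards [hC] with x hx
      exact ae_of_all _ fun t ht => hx t (Set.uIoc_subset_uIcc ht)
    · exact intervalIntegrable_const
    · exact ae_of_all _ fun t ht =>
        ContinuousAt.comp (f := fun x : A => (x, t))
          (h x₀ hx₀ t (Set.uIoc_subset_uIcc ht)).continuousAt (by fun_prop)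
  | succ n ih =>
    have h1 : ∀ x ∈ O, ∀ t ∈ Set.uIcc a b, ContDiffAt ℝ 1 (Function.uncurry Ξ) (x, t) :=
      fun x hx t ht => (h x hx t ht).of_le (by simp)
    have hd : ∀ x ∈ O, HasFDerivAt (fun x => ∫ t in a..b, Ξ x t)
        (∫ t in a..b, fderiv ℝ (fun x => Ξ x t) x) x := fun x hx =>
      hasFDerivAt_intervalIntegral (h1 x hx)
    rw [Nat.cast_succ, contDiffOn_succ_iff_fderiv_of_isOpen hO]
    refine ⟨fun x hx => (hd x hx).differentiableAt.differentiableWithinAt, by simp, ?_⟩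
    have := ih (Ξ := fun x t => (fderiv ℝ (Function.uncurry Ξ) (x, t)).comp (.inl ℝ A ℝ))
      fun x hx t ht => ((h x hx t ht).fderiv_right (m := n) (by simp)).clm_comp contDiffAt_const
    refine this.congr fun x hx => ?_
    rw [(hd x hx).fderiv]
    refine intervalIntegral.integral_congr fun t ht => ?_
    exact (((h1 x hx t ht).differentiableAt one_ne_zero).hasFDerivAt.comp
      (f := fun x : A => (x, t)) x (hasFDerivAt_prodMk_left x t)).fderiv

/-- An integral over a compact interval depends smoothly on a parameter when the integrand is
jointly smooth. -/
theorem contDiffAt_intervalIntegral {Ξ : A → ℝ → B} {x₀ : A} {a b : ℝ}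
    (h : ∀ t ∈ Set.uIcc a b, ContDiffAt ℝ ∞ (Function.uncurry Ξ) (x₀, t)) :
    ContDiffAt ℝ ∞ (fun x => ∫ t in a..b, Ξ x t) x₀ := by
  rw [contDiffAt_infty]
  intro n
  have hev : ∀ᶠ x in 𝓝 x₀, ∀ t ∈ Set.uIcc a b, ContDiffAt ℝ n (Function.uncurry Ξ) (x, t) :=
    isCompact_uIcc.eventually_forall_of_forall_eventually fun t ht =>
      ((h t ht).of_le (by exact_mod_cast le_top)).eventually (by simp)
  obtain ⟨O, hOs, hO, hx⟩ := mem_nhds_iff.1 hev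
  exact (contDiffOn_intervalIntegral_nat n hO hOs).contDiffAt (hO.mem_nhds hx)

end ParametricIntegral

/-! ### Uniformity over a compact family -/

section NearIdentity

variable {D E X : Type} [NormedAddCommGroup D]
  [NormedAddCommGroup E] [TopologicalSpace X] [CompactSpace X]

/-- A compact set inside an open set has a thickening inside it. Applied to `S²`, this makes radii
and tolerances independent of the source fiber. -/
theorem exists_dist_lt_of_eventually {k : X → D} (hk : Continuous k) {P : D → Prop}
    (h : ∀ x, ∀ᶠ z in 𝓝 (k x), P z) : ∃ δ : ℝ, 0 < δ ∧ ∀ x z, dist z (k x) < δ → P z := by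
  have hK : IsCompact (Set.range k) := isCompact_range hk
  have hsub : Set.range k ⊆ interior {z | P z} := by
    rintro _ ⟨x, rfl⟩
    exact mem_interior_iff_mem_nhds.2 (h x)
  obtain ⟨δ, hδ, hs⟩ := hK.exists_thickening_subset_open isOpen_interior hsub
  refine ⟨δ, hδ, fun x z hz => interior_subset (hs ?_)⟩
  exact Metric.mem_thickening_iff.2 ⟨k x, ⟨x, rfl⟩, hz⟩

variable [NormedSpace ℝ D] [NormedSpace ℝ E]

/-- The partial derivative in `y` is the identity at `(k x, e x)`, so by continuity and compactness
it is within `1/2` of the identity on a uniform neighbourhood. The mean value inequality on the ball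
turns this into a Lipschitz bound. -/
theorem exists_uniform_near_identity {Θ : D × E → E} {k : X → D} {e : X → E}
    (hk : Continuous k) (he : Continuous e) (hs : ∀ x, ContDiffAt ℝ ∞ Θ (k x, e x))
    (hd : ∀ x, HasFDerivAt (fun y => Θ (k x, y)) (ContinuousLinearMap.id ℝ E) (e x)) :
    ∃ δ : ℝ, 0 < δ ∧ ∀ x p, dist p (k x) < δ → ∀ y ∈ Metric.ball (e x) δ,
      ∀ y' ∈ Metric.ball (e x) δ, ‖Θ (p, y) - Θ (p, y') - (y - y')‖ ≤ 1 / 2 * ‖y - y'‖ := by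
  obtain ⟨δ, hδ, h⟩ := exists_dist_lt_of_eventually (k := fun x => (k x, e x))
    (P := fun z => DifferentiableAt ℝ Θ z ∧
      ‖(fderiv ℝ Θ z).comp (.inr ℝ D E) - ContinuousLinearMap.id ℝ E‖ < 1 / 2)
    (by fun_prop) fun x => by
      have h1 : ContDiffAt ℝ 1 Θ (k x, e x) := (hs x).of_le (by exact_mod_cast le_top)
      have hd' : (fderiv ℝ Θ (k x, e x)).comp (.inr ℝ D E) = ContinuousLinearMap.id ℝ E :=
        ((h1.differentiableAt one_ne_zero).hasFDerivAt.comp (f := fun y : E => (k x, y)) (e x)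
          (hasFDerivAt_prodMk_right (k x) (e x))).unique (hd x)
      have hc : ContinuousAt (fun z => ‖(fderiv ℝ Θ z).comp (.inr ℝ D E)
          - ContinuousLinearMap.id ℝ E‖) (k x, e x) :=
        ((((h1.fderiv_right (m := 0) (by simp)).continuousAt).clm_comp
          continuousAt_const).sub continuousAt_const).norm
      refine ((h1.eventually (by simp)).mono fun z hz => hz.differentiableAt one_ne_zero).and
        (hc.eventually (gt_mem_nhds ?_))
      simp [hd']
  refine ⟨δ, hδ, fun x p hp y hy y' hy' => ?_⟩
  have hmem : ∀ v ∈ Metric.ball (e x) δ, dist (p, v) (k x, e x) < δ := fun v hv =>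
    max_lt hp hv
  have hder : ∀ v ∈ Metric.ball (e x) δ, HasFDerivWithinAt (fun y => Θ (p, y))
      ((fderiv ℝ Θ (p, v)).comp (.inr ℝ D E)) (Metric.ball (e x) δ) v := fun v hv =>
    ((h x _ (hmem v hv)).1.hasFDerivAt.comp (f := fun y : E => (p, y)) v
      (hasFDerivAt_prodMk_right p v)).hasFDerivWithinAt
  exact (convex_ball (e x) δ).norm_image_sub_le_of_norm_hasFDerivWithin_le' hder
    (fun v hv => (h x _ (hmem v hv)).2.le) hy' hy

end NearIdentity

/-! ### Maps close to the identity: zeros, derivatives, primitives, means -/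

section ZeroOfNearIdentity

variable {E : Type} [NormedAddCommGroup E] [InnerProductSpace ℝ E]

/-- `H` differs from the identity by a `1/2`-Lipschitz map on `s`. -/
def NearIdentityOn (H : E → E) (s : Set E) : Prop :=
  ∀ y ∈ s, ∀ y' ∈ s, ‖H y - H y' - (y - y')‖ ≤ 1 / 2 * ‖y - y'‖

/-- Strong monotonicity: Cauchy–Schwarz applied to the deviation from the identity. Injectivity and
strict minimality both rest on it. -/
theorem NearIdentityOn.half_le_inner {H : E → E} {s : Set E} (h : NearIdentityOn H s) {y y' : E}
    (hy : y ∈ s) (hy' : y' ∈ s) : 1 / 2 * ‖y - y'‖ ^ 2 ≤ inner ℝ (H y - H y') (y - y') := by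
  have h1 := h y hy y' hy'
  have h2 : inner ℝ (H y - H y') (y - y') =
      inner ℝ (H y - H y' - (y - y')) (y - y') + ‖y - y'‖ ^ 2 := by
    rw [inner_sub_left (H y - H y'), real_inner_self_eq_norm_sq]; ring
  have h3 := abs_le.1 (abs_real_inner_le_norm (H y - H y' - (y - y')) (y - y'))
  have h4 := mul_le_mul_of_nonneg_right h1 (norm_nonneg (y - y'))
  nlinarith [h3.1]

theorem NearIdentityOn.injOn {H : E → E} {s : Set E} (h : NearIdentityOn H s) :
    Set.InjOn H s := by
  intro y hy y' hy' he
  have := h.half_le_inner hy hy'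
  rw [he, sub_self, inner_zero_left] at this
  have : ‖y - y'‖ = 0 := by nlinarith [norm_nonneg (y - y')]
  exact sub_eq_zero.1 (norm_eq_zero.1 this)

/-- Quantitative inverse function theorem: the image of the closed ball of radius `r/2` contains the
ball around `H u` of radius `(1 - 1/2) · r/2 = r/4`. -/
theorem NearIdentityOn.exists_zero [CompleteSpace E] {H : E → E} {u : E} {r : ℝ} (hr : 0 < r)
    (h : NearIdentityOn H (Metric.ball u r)) (hu : ‖H u‖ ≤ r / 4) :
    ∃ y ∈ Metric.ball u r, H y = 0 := by
  have happ : ApproximatesLinearOn H ((ContinuousLinearEquiv.refl ℝ E : E ≃L[ℝ] E) : E →L[ℝ] E)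
      (Metric.ball u r) (1 / 2) := by
    intro y hy y' hy'
    simpa using h y hy y' hy'
  -- In the trivial space the identity has norm `0`, while the radius of the covered ball involves
  -- the inverse of this norm.
  by_cases hE : Subsingleton E
  · exact ⟨u, Metric.mem_ball_self hr, Subsingleton.elim _ _⟩
  have hsub : Metric.closedBall u (r / 2) ⊆ Metric.ball u r :=
    Metric.closedBall_subset_ball (by linarith)
  have key := happ.surjOn_closedBall_of_nonlinearRightInverse
    ((ContinuousLinearEquiv.refl ℝ E).toNonlinearRightInverse) (ε := r / 2) (b := u)
    (by positivity) hsub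
  have hnn : (((ContinuousLinearEquiv.refl ℝ E).toNonlinearRightInverse.nnnorm : ℝ)) ≤ 1 := by
    change ‖((ContinuousLinearEquiv.refl ℝ E).symm : E →L[ℝ] E)‖ ≤ 1
    exact ContinuousLinearMap.norm_id_le
  have hpos : 0 < (((ContinuousLinearEquiv.refl ℝ E).toNonlinearRightInverse.nnnorm : ℝ)) := by
    change 0 < ‖((ContinuousLinearEquiv.refl ℝ E).symm : E →L[ℝ] E)‖
    have : Nontrivial E := not_subsingleton_iff_nontrivial.1 hE
    change 0 < ‖ContinuousLinearMap.id ℝ E‖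
    rw [ContinuousLinearMap.norm_id]; exact one_pos
  have h0 : (0 : E) ∈ Metric.closedBall (H u)
      (((((ContinuousLinearEquiv.refl ℝ E).toNonlinearRightInverse.nnnorm : ℝ))⁻¹
        - ((1 / 2 : NNReal) : ℝ)) * (r / 2)) := by
    rw [mem_closedBall_iff_norm, zero_sub, norm_neg]
    refine hu.trans ?_
    have := (one_le_inv₀ hpos).2 hnn
    push_cast
    nlinarith
  obtain ⟨y, hy, hy0⟩ := key h0
  exact ⟨y, hsub hy, hy0⟩

theorem NearIdentityOn.norm_fderiv_sub_id_le {H : E → E} {s : Set E} (h : NearIdentityOn H s)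
    {y : E} (hs : s ∈ 𝓝 y) {H' : E →L[ℝ] E} (hH : HasFDerivAt H H' y) :
    ‖H' - ContinuousLinearMap.id ℝ E‖ ≤ 1 / 2 := by
  have h1 : HasFDerivAt (fun z => H z - z) (H' - ContinuousLinearMap.id ℝ E) y :=
    hH.sub (hasFDerivAt_id y)
  refine h1.le_of_lip' (by norm_num) ?_
  filter_upwards [hs] with z hz
  have := h z hz y (mem_of_mem_nhds hs)
  rwa [show H z - z - (H y - y) = H z - H y - (z - y) by abel]

theorem NearIdentityOn.isInvertible [CompleteSpace E] {H : E → E} {s : Set E}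
    (h : NearIdentityOn H s) {y : E} (hs : s ∈ 𝓝 y) {H' : E →L[ℝ] E} (hH : HasFDerivAt H H' y) :
    H'.IsInvertible := by
  have h1 : ‖ContinuousLinearMap.id ℝ E - H'‖ < 1 := by
    rw [norm_sub_rev]
    exact lt_of_le_of_lt (h.norm_fderiv_sub_id_le hs hH) (by norm_num)
  have h2 := isUnit_one_sub_of_norm_lt_one h1
  have h3 : (1 : E →L[ℝ] E) - (ContinuousLinearMap.id ℝ E - H') = H' := by
    change ContinuousLinearMap.id ℝ E - (ContinuousLinearMap.id ℝ E - H') = H'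
    abel
  rw [h3] at h2
  obtain ⟨U, hU⟩ := h2
  exact ⟨ContinuousLinearEquiv.unitsEquiv ℝ E U, hU⟩

theorem NearIdentityOn.half_le_inner_fderiv {H : E → E} {s : Set E}
    (h : NearIdentityOn H s) {y : E} (hs : s ∈ 𝓝 y) {H' : E →L[ℝ] E} (hH : HasFDerivAt H H' y)
    (U : E) : 1 / 2 * ‖U‖ ^ 2 ≤ inner ℝ (H' U) U := by
  have h1 := h.norm_fderiv_sub_id_le hs hH
  have h2 : inner ℝ (H' U) U =
      inner ℝ ((H' - ContinuousLinearMap.id ℝ E) U) U + ‖U‖ ^ 2 := by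
    simp [inner_sub_left]
  have h3 := abs_le.1 (abs_real_inner_le_norm ((H' - ContinuousLinearMap.id ℝ E) U) U)
  have h4 := (H' - ContinuousLinearMap.id ℝ E).le_of_opNorm_le h1 U
  nlinarith [h3.1, norm_nonneg U]

/-- A primitive of a map close to the identity is strictly minimal at the zero of the map. -/
theorem NearIdentityOn.lt_of_hasFDerivAt {H : E → E} {s : Set E} (h : NearIdentityOn H s)
    (hs : Convex ℝ s) {ψ : E → ℝ} (hψ : ∀ y ∈ s, HasFDerivAt ψ (innerSL ℝ (H y)) y)
    {y₀ y : E} (hy₀ : y₀ ∈ s) (hy : y ∈ s) (h0 : H y₀ = 0) (hne : y ≠ y₀) : ψ y₀ < ψ y := by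
  have hmem : ∀ t ∈ Set.Icc (0 : ℝ) 1, y₀ + t • (y - y₀) ∈ s := fun t ht =>
    hs.add_smul_sub_mem hy₀ hy ht
  have hd : ∀ t ∈ Set.Icc (0 : ℝ) 1, HasDerivAt (fun t : ℝ => ψ (y₀ + t • (y - y₀)))
      (inner ℝ (H (y₀ + t • (y - y₀))) (y - y₀)) t := fun t ht => by
    have h1 : HasDerivAt (fun t : ℝ => y₀ + t • (y - y₀)) (y - y₀) t := by
      simpa using ((hasDerivAt_id t).smul_const (y - y₀)).const_add y₀
    exact (hψ _ (hmem t ht)).comp_hasDerivAt t h1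
  have hm : StrictMonoOn (fun t : ℝ => ψ (y₀ + t • (y - y₀))) (Set.Icc 0 1) := by
    refine strictMonoOn_of_deriv_pos (convex_Icc 0 1)
      (fun t ht => (hd t ht).continuousAt.continuousWithinAt) fun t ht => ?_
    rw [interior_Icc] at ht
    rw [(hd t (Set.Ioo_subset_Icc_self ht)).deriv]
    -- As `H y₀ = 0`, strong monotonicity bounds `t` times the derivative from below by `t² ‖y -
    -- y₀‖² / 2`.
    have := h.half_le_inner (hmem t (Set.Ioo_subset_Icc_self ht)) hy₀
    rw [h0, sub_zero, add_sub_cancel_left, inner_smul_right, norm_smul, mul_pow] at this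
    have hn : 0 < ‖y - y₀‖ := norm_pos_iff.2 (sub_ne_zero.2 hne)
    have ht0 : 0 < ‖t‖ ^ 2 := by have := norm_pos_iff.2 ht.1.ne'; positivity
    by_contra hcon
    have := mul_nonpos_of_nonneg_of_nonpos ht.1.le (not_lt.1 hcon)
    have : 0 < ‖t‖ ^ 2 * ‖y - y₀‖ ^ 2 := by positivity
    linarith
  have := hm (Set.left_mem_Icc.2 zero_le_one) (Set.right_mem_Icc.2 zero_le_one) one_pos
  simpa using this

/-- The difference `y - y'` is its own mean, so the deviation of the mean is the mean of the
deviations. -/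
theorem NearIdentityOn.average {H : ℝ → E → E} {s : Set E} [CompleteSpace E]
    (h : ∀ t, NearIdentityOn (H t) s)
    (hc : ∀ y ∈ s, Continuous fun t => H t y) :
    NearIdentityOn (fun y => (1 / (2 * Real.pi)) • ∫ t in (0 : ℝ)..(2 * Real.pi), H t y) s := by
  intro y hy y' hy'
  have hpi := Real.two_pi_pos
  have e : (1 / (2 * Real.pi)) • (∫ t in (0 : ℝ)..(2 * Real.pi), H t y)
      - (1 / (2 * Real.pi)) • (∫ t in (0 : ℝ)..(2 * Real.pi), H t y') - (y - y')
      = (1 / (2 * Real.pi)) • ∫ t in (0 : ℝ)..(2 * Real.pi), (H t y - H t y' - (y - y')) := by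
    rw [intervalIntegral.integral_sub (f := fun t => H t y - H t y') (g := fun _ => y - y')
      (((hc y hy).sub (hc y' hy')).intervalIntegrable _ _) (continuous_const.intervalIntegrable _ _), intervalIntegral.integral_sub
      ((hc y hy).intervalIntegrable _ _) ((hc y' hy').intervalIntegrable _ _),
      intervalIntegral.integral_const, smul_sub, smul_sub, sub_zero, smul_smul,
      one_div_mul_cancel hpi.ne', one_smul]
  rw [e, norm_smul]
  have := intervalIntegral.norm_integral_le_of_norm_le_const (a := (0 : ℝ)) (b := 2 * Real.pi)
    (f := fun t => H t y - H t y' - (y - y')) (C := 1 / 2 * ‖y - y'‖)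
    fun t _ => h t y hy y' hy'
  rw [sub_zero, abs_of_pos hpi] at this
  rw [Real.norm_of_nonneg (by positivity)]
  calc 1 / (2 * Real.pi) * _ ≤ 1 / (2 * Real.pi) * (1 / 2 * ‖y - y'‖ * (2 * Real.pi)) := by gcongr
    _ = 1 / 2 * ‖y - y'‖ := by field_simp

theorem norm_average_le {g : ℝ → E} {η : ℝ} (h : ∀ t, ‖g t‖ ≤ η) :
    ‖(1 / (2 * Real.pi)) • ∫ t in (0 : ℝ)..(2 * Real.pi), g t‖ ≤ η := by
  have hpi := Real.two_pi_pos
  have := intervalIntegral.norm_integral_le_of_norm_le_const (a := (0 : ℝ)) (b := 2 * Real.pi)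
    (f := g) (C := η) fun t _ => h t
  rw [sub_zero, abs_of_pos hpi] at this
  rw [norm_smul, Real.norm_of_nonneg (by positivity)]
  calc 1 / (2 * Real.pi) * _ ≤ 1 / (2 * Real.pi) * (η * (2 * Real.pi)) := by gcongr
    _ = η := by field_simp

end ZeroOfNearIdentity

/-! ### The angle as a smooth function of the squared cosine -/

section ArcFactor

/-- The smooth function of `m > 0` whose value at `cos² θ` is `θ / (sin θ cos θ)`. -/
noncomputable def arcFactor (m : ℝ) : ℝ := ∫ s in (0 : ℝ)..1, 1 / (m + (1 - m) * s ^ 2)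

theorem arcFactor_denom_pos {m s : ℝ} (hm : 0 < m) (hs : s ∈ Set.Icc (0 : ℝ) 1) :
    0 < m + (1 - m) * s ^ 2 := by
  obtain ⟨h0, h1⟩ := hs
  have h2 : s ^ 2 ≤ 1 := by nlinarith
  rcases h2.lt_or_eq with h | h
  · nlinarith [sq_nonneg s, mul_pos hm (sub_pos.2 h)]
  · rw [h]; linarith

theorem arcFactor_one : arcFactor 1 = 1 := by simp [arcFactor]

theorem contDiffAt_arcFactor {m : ℝ} (hm : 0 < m) : ContDiffAt ℝ ∞ arcFactor m := by
  refine contDiffAt_intervalIntegral (Ξ := fun m s => 1 / (m + (1 - m) * s ^ 2)) fun s hs => ?_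
  rw [Set.uIcc_of_le zero_le_one] at hs
  refine ContDiffAt.div (f := fun z : ℝ × ℝ => 1)
    (g := fun z : ℝ × ℝ => z.1 + (1 - z.1) * z.2 ^ 2) contDiffAt_const (by fun_prop) ?_
  exact (arcFactor_denom_pos hm hs).ne'

/-- Times `sin θ cos θ`, the integrand is the derivative of `arctan (s tan θ)`, which runs from `0`
to `θ`. The integral form shows smoothness across `θ = 0`, where `arccos` is singular. -/
theorem arcFactor_cos_sq {θ : ℝ} (h : θ ∈ Set.Ioo (-(Real.pi / 2)) (Real.pi / 2)) :
    arcFactor (Real.cos θ ^ 2) * (Real.sin θ * Real.cos θ) = θ := by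
  have hc := Real.cos_pos_of_mem_Ioo h
  have hd : ∀ s ∈ Set.uIcc (0 : ℝ) 1, HasDerivAt (fun s => Real.arctan (s * Real.tan θ))
      (1 / (Real.cos θ ^ 2 + (1 - Real.cos θ ^ 2) * s ^ 2) * (Real.sin θ * Real.cos θ)) s := by
    intro s hs
    rw [Set.uIcc_of_le zero_le_one] at hs
    have hp := arcFactor_denom_pos (pow_pos hc 2) hs
    have h1 : HasDerivAt (fun s => s * Real.tan θ) (Real.tan θ) s := by
      simpa using (hasDerivAt_id s).mul_const (Real.tan θ)
    refine h1.arctan.congr_deriv ?_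
    have hs2 := Real.sin_sq_add_cos_sq θ
    have hp' : Real.cos θ ^ 2 + s ^ 2 * Real.sin θ ^ 2 ≠ 0 := by
      rw [show Real.sin θ ^ 2 = 1 - Real.cos θ ^ 2 by linarith]
      convert hp.ne' using 1; ring
    rw [Real.tan_eq_sin_div_cos,
      show 1 - Real.cos θ ^ 2 = Real.sin θ ^ 2 by linarith,
      show Real.cos θ ^ 2 + Real.sin θ ^ 2 * s ^ 2 = Real.cos θ ^ 2 + s ^ 2 * Real.sin θ ^ 2 by ring]
    field_simp
  have hi : IntervalIntegrable (fun s => 1 / (Real.cos θ ^ 2 + (1 - Real.cos θ ^ 2) * s ^ 2)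
      * (Real.sin θ * Real.cos θ)) volume 0 1 := by
    refine ContinuousOn.intervalIntegrable fun s hs => ?_
    rw [Set.uIcc_of_le zero_le_one] at hs
    have hp := (arcFactor_denom_pos (pow_pos hc 2) hs).ne'
    have hden : ContinuousAt (fun s : ℝ => Real.cos θ ^ 2 + (1 - Real.cos θ ^ 2) * s ^ 2) s := by
      fun_prop
    exact ((continuousAt_const.div hden hp).mul continuousAt_const).continuousWithinAt
  have key := intervalIntegral.integral_eq_sub_of_hasDerivAt hd hi
  rw [intervalIntegral.integral_mul_const] at key
  rw [arcFactor, key]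
  simp [Real.arctan_tan h.1 h.2]

end ArcFactor

/-! ### Radial normalization and gradients -/

section Gradient

variable {D E : Type} [NormedAddCommGroup D] [NormedSpace ℝ D]
  [NormedAddCommGroup E] [InnerProductSpace ℝ E]

theorem hasFDerivAt_normalize {x : E} (hx : ‖x‖ = 1) :
    HasFDerivAt (fun y : E => ‖y‖⁻¹ • y)
      (ContinuousLinearMap.id ℝ E - (innerSL ℝ x).smulRight x) x := by
  have hx0 : x ≠ 0 := by rw [← norm_ne_zero_iff, hx]; exact one_ne_zero
  have h1 : HasFDerivAt (fun y : E => (‖y‖ ^ 2) ^ (-(1 / 2) : ℝ))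
      ((-(1 / 2) * (‖x‖ ^ 2) ^ (-(1 / 2) - 1 : ℝ)) • ((2 : ℕ) • innerSL ℝ x)) x := by
    refine HasFDerivAt.rpow_const ?_ (Or.inl (by simp [hx]))
    simpa using (hasStrictFDerivAt_norm_sq x).hasFDerivAt
  have h2 := h1.smul (hasFDerivAt_id x)
  have e : (fun y : E => ‖y‖⁻¹ • y) = fun y => ((‖y‖ ^ 2) ^ (-(1 / 2) : ℝ)) • y := by
    ext1 y
    rw [← Real.rpow_natCast, ← Real.rpow_mul (norm_nonneg _)]
    norm_num [Real.rpow_neg_one]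
  rw [e]
  refine h2.congr_fderiv ?_
  ext w
  simp [hx, sub_eq_add_neg]

theorem contDiffAt_normalize {x : E} (hx : x ≠ 0) :
    ContDiffAt ℝ ∞ (fun y : E => ‖y‖⁻¹ • y) x :=
  ((contDiffAt_norm ℝ hx).inv (norm_ne_zero_iff.2 hx)).smul contDiffAt_id

theorem normalize_eq_self {x : E} (hx : ‖x‖ = 1) : ‖x‖⁻¹ • x = x := by simp [hx]

variable [CompleteSpace E]

/-- The vector representing a continuous linear functional. -/
noncomputable def riesz (E : Type) [NormedAddCommGroup E] [InnerProductSpace ℝ E]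
    [CompleteSpace E] : (E →L[ℝ] ℝ) →L[ℝ] E :=
  LinearMap.mkContinuous
    { toFun := fun L => (InnerProductSpace.toDual ℝ E).symm L
      map_add' := fun L L' => map_add _ L L'
      map_smul' := fun c L => by simp } 1 fun L => by simp

theorem inner_riesz (L : E →L[ℝ] ℝ) (w : E) : inner ℝ (riesz E L) w = L w :=
  InnerProductSpace.toDual_symm_apply

theorem gradient_eq_riesz (g : E → ℝ) (y : E) : gradient g y = riesz E (fderiv ℝ g y) := rfl

theorem inner_gradient (g : E → ℝ) (y w : E) : inner ℝ (gradient g y) w = fderiv ℝ g y w :=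
  inner_riesz _ w

theorem contDiffAt_gradient_snd {F : D × E → ℝ} {z : D × E} (h : ContDiffAt ℝ ∞ F z) :
    ContDiffAt ℝ ∞ (fun z : D × E => gradient (fun y => F (z.1, y)) z.2) z := by
  have h1 : ContDiffAt ℝ 1 F z := h.of_le (by exact_mod_cast le_top)
  have h2 : ContDiffAt ℝ ∞ (fun z => riesz E ((fderiv ℝ F z).comp (.inr ℝ D E))) z :=
    (riesz E).contDiff.contDiffAt.comp z
      ((h.fderiv_right (m := ∞) le_rfl).clm_comp contDiffAt_const)
  refine h2.congr_of_eventuallyEq ?_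
  filter_upwards [h1.eventually (by simp)] with w hw
  rw [gradient_eq_riesz]
  congr 1
  exact ((hw.differentiableAt one_ne_zero).hasFDerivAt.comp (f := fun y : E => (w.1, y)) w.2
    (hasFDerivAt_prodMk_right w.1 w.2)).fderiv

theorem contDiffAt_gradient {G : E → ℝ} {y : E} (h : ContDiffAt ℝ ∞ G y) :
    ContDiffAt ℝ ∞ (gradient G) y :=
  (riesz E).contDiff.contDiffAt.comp y (h.fderiv_right (m := ∞) le_rfl)

end Gradient

/-! ### Energy and average densities, and the vector fields that encode them -/

section Densities

/-- Position, and two first order invariants, of a curve in `S³` relative to the Hopf fibration. -/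
abbrev JetData : Type := E3 × ℝ × E3

/-- The jet data of the Hopf fiber over `u`. -/
noncomputable def fiberJet (u : S2) : JetData := (u, 1, u)

theorem continuous_fiberJet : Continuous fiberJet := by unfold fiberJet; fun_prop

/-- For unit vectors, the square of the cosine of half the angle. -/
noncomputable def cosHalfSq (z y : E3) : ℝ := (1 + inner ℝ z y) / 2

/-- The arc length density of the projection to the fiber over `y`. -/
noncomputable def arcDensity (p : JetData) (y : E3) : ℝ :=
  (p.2.1 + inner ℝ p.2.2 y) / (2 * cosHalfSq p.1 y)

/-- The integrand of the energy. -/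
noncomputable def energyDensity (p : JetData) (y : E3) : ℝ :=
  1 / 4 * (1 - cosHalfSq p.1 y) * arcFactor (cosHalfSq p.1 y) ^ 2 * (p.2.1 + inner ℝ p.2.2 y)

/-- The integrand of the average. -/
noncomputable def averageDensity (p : JetData) (y : E3) : E3 :=
  (arcFactor (cosHalfSq p.1 y) * arcDensity p y) • (p.1 - inner ℝ p.1 y • y)

/-- A vector field in space whose zeros are the critical points of the energy density on the
sphere. -/
noncomputable def energyField (w : JetData × E3) : E3 :=
  (4 : ℝ) • gradient (fun y : E3 => energyDensity w.1 (‖y‖⁻¹ • y)) w.2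
    + ((‖w.2‖ ^ 2 - 1) / 2) • w.2

/-- A vector field in space whose zeros are the zeros of the average density on the sphere. -/
noncomputable def averageField (w : JetData × E3) : E3 :=
  (-(arcFactor (cosHalfSq w.1.1 w.2) * arcDensity w.1 w.2))
      • (‖w.2‖ ^ 2 • w.1.1 - inner ℝ w.1.1 w.2 • w.2)
    + ((‖w.2‖ ^ 2 - 1) / 2) • w.2

theorem contDiff_cosHalfSq : ContDiff ℝ ∞ fun w : E3 × E3 => cosHalfSq w.1 w.2 := by
  unfold cosHalfSq
  exact (contDiff_const.add (contDiff_fst.inner ℝ contDiff_snd)).div_const 2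

theorem contDiff_cosHalfSq_jet : ContDiff ℝ ∞ fun w : JetData × E3 => cosHalfSq w.1.1 w.2 :=
  contDiff_cosHalfSq.comp (f := fun w : JetData × E3 => (w.1.1, w.2)) (by fun_prop)

theorem contDiffAt_energyDensity {p : JetData} {y : E3} (h : 0 < cosHalfSq p.1 y) :
    ContDiffAt ℝ ∞ (fun w : JetData × E3 => energyDensity w.1 w.2) (p, y) := by
  unfold energyDensity
  have hN : ContDiffAt ℝ ∞ (fun w : JetData × E3 => arcFactor (cosHalfSq w.1.1 w.2)) (p, y) :=
    ContDiffAt.comp (p, y) (contDiffAt_arcFactor h) contDiff_cosHalfSq_jet.contDiffAt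
  have hm := contDiff_cosHalfSq_jet.contDiffAt (x := (p, y))
  have hi : ContDiffAt ℝ ∞ (fun w : JetData × E3 => w.1.2.1 + inner ℝ w.1.2.2 w.2) (p, y) :=
    ContDiffAt.add (by fun_prop) (ContDiffAt.inner ℝ (by fun_prop) (by fun_prop))
  exact ((contDiffAt_const.mul (contDiffAt_const.sub hm)).mul (hN.pow 2)).mul hi

theorem contDiffAt_arcDensity {p : JetData} {y : E3} (h : 0 < cosHalfSq p.1 y) :
    ContDiffAt ℝ ∞ (fun w : JetData × E3 => arcDensity w.1 w.2) (p, y) := by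
  unfold arcDensity
  have hm := contDiff_cosHalfSq_jet.contDiffAt (x := (p, y))
  have hi : ContDiffAt ℝ ∞ (fun w : JetData × E3 => w.1.2.1 + inner ℝ w.1.2.2 w.2) (p, y) :=
    ContDiffAt.add (by fun_prop) (ContDiffAt.inner ℝ (by fun_prop) (by fun_prop))
  exact hi.div (contDiffAt_const.mul hm) (mul_pos two_pos h).ne'

theorem contDiffAt_normalized_energyDensity {p : JetData} {y : E3} (hy : y ≠ 0)
    (h : 0 < cosHalfSq p.1 (‖y‖⁻¹ • y)) :
    ContDiffAt ℝ ∞ (fun w : JetData × E3 => energyDensity w.1 (‖w.2‖⁻¹ • w.2)) (p, y) := by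
  have h2 : ContDiffAt ℝ ∞ (fun w : JetData × E3 => (w.1, ‖w.2‖⁻¹ • w.2)) (p, y) :=
    contDiffAt_fst.prodMk
      (ContDiffAt.comp (g := fun y : E3 => ‖y‖⁻¹ • y) (f := fun w : JetData × E3 => w.2) (p, y)
        (contDiffAt_normalize hy) contDiffAt_snd)
  exact ContDiffAt.comp (g := fun w : JetData × E3 => energyDensity w.1 w.2)
    (f := fun w : JetData × E3 => (w.1, ‖w.2‖⁻¹ • w.2)) (p, y)
    (contDiffAt_energyDensity (p := p) (y := ‖y‖⁻¹ • y) h) h2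

theorem contDiffAt_energyField {p : JetData} {y : E3} (hy : y ≠ 0)
    (h : 0 < cosHalfSq p.1 (‖y‖⁻¹ • y)) : ContDiffAt ℝ ∞ energyField (p, y) := by
  have h1 := contDiffAt_gradient_snd (contDiffAt_normalized_energyDensity hy h)
  have h2 : ContDiffAt ℝ ∞ (fun w : JetData × E3 => ((‖w.2‖ ^ 2 - 1) / 2) • w.2) (p, y) :=
    (((contDiffAt_snd.norm_sq ℝ).sub contDiffAt_const).div_const 2).smul contDiffAt_snd
  exact (h1.const_smul (4 : ℝ)).add h2

theorem contDiffAt_averageField {p : JetData} {y : E3} (h : 0 < cosHalfSq p.1 y) :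
    ContDiffAt ℝ ∞ averageField (p, y) := by
  have hN : ContDiffAt ℝ ∞ (fun w : JetData × E3 => arcFactor (cosHalfSq w.1.1 w.2)) (p, y) :=
    ContDiffAt.comp (p, y) (contDiffAt_arcFactor h) contDiff_cosHalfSq_jet.contDiffAt
  have hn : ContDiffAt ℝ ∞ (fun w : JetData × E3 => ‖w.2‖ ^ 2) (p, y) :=
    contDiffAt_snd.norm_sq ℝ
  have hz : ContDiffAt ℝ ∞ (fun w : JetData × E3 => w.1.1) (p, y) := by fun_prop
  have hi : ContDiffAt ℝ ∞ (fun w : JetData × E3 => inner ℝ w.1.1 w.2) (p, y) :=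
    hz.inner ℝ contDiffAt_snd
  have h2 : ContDiffAt ℝ ∞ (fun w : JetData × E3 => ((‖w.2‖ ^ 2 - 1) / 2) • w.2) (p, y) :=
    ((hn.sub contDiffAt_const).div_const 2).smul contDiffAt_snd
  exact (((hN.mul (contDiffAt_arcDensity h)).neg).smul
    ((hn.smul hz).sub (hi.smul contDiffAt_snd))).add h2

theorem norm_coe_S2 (u : S2) : ‖(u : E3)‖ = 1 := norm_eq_of_mem_sphere u

theorem coe_S2_ne_zero (u : S2) : (u : E3) ≠ 0 := by
  rw [← norm_ne_zero_iff, norm_coe_S2]; exact one_ne_zero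

theorem cosHalfSq_self (u : S2) : cosHalfSq (u : E3) u = 1 := by
  rw [cosHalfSq, real_inner_self_eq_norm_sq, norm_coe_S2]; norm_num

/-- The derivative of `a` multiplies a vector that vanishes at `u`, so only `a u = 1` matters. The
first term contributes `w - ⟨u, w⟩ u`, and the radial term supplies the missing `⟨u, w⟩ u`. -/
theorem hasFDerivAt_standardField (u : S2) {a : E3 → ℝ} (ha : DifferentiableAt ℝ a u)
    (ha1 : a u = 1) :
    HasFDerivAt (fun y : E3 => (-a y) • (‖y‖ ^ 2 • (u : E3) - inner ℝ (u : E3) y • y)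
      + ((‖y‖ ^ 2 - 1) / 2) • y) (ContinuousLinearMap.id ℝ E3) (u : E3) := by
  have hn : HasFDerivAt (fun y : E3 => ‖y‖ ^ 2) (2 • innerSL ℝ (u : E3)) (u : E3) :=
    (hasStrictFDerivAt_norm_sq (u : E3)).hasFDerivAt
  have hi : HasFDerivAt (fun y : E3 => inner ℝ (u : E3) y) (innerSL ℝ (u : E3)) (u : E3) :=
    (innerSL ℝ (u : E3)).hasFDerivAt
  have hv := (hn.smul_const (u : E3)).sub (hi.smul (hasFDerivAt_id (u : E3)))
  have h1 := (ha.hasFDerivAt.neg.smul hv).add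
    (((hn.sub_const 1).mul_const (2⁻¹)).smul (hasFDerivAt_id (u : E3)))
  refine (h1.congr_fderiv ?_)
  ext1 w
  have hu := norm_coe_S2 u
  simp [ha1, hu]
  module

theorem hasFDerivAt_averageField (u : S2) :
    HasFDerivAt (fun y => averageField (fiberJet u, y)) (ContinuousLinearMap.id ℝ E3) (u : E3) := by
  have hpos : 0 < cosHalfSq (fiberJet u).1 (u : E3) := by
    change 0 < cosHalfSq (u : E3) u
    rw [cosHalfSq_self]; exact one_pos
  refine hasFDerivAt_standardField u (a := fun y => arcFactor (cosHalfSq (u : E3) y)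
    * arcDensity (fiberJet u) y) ?_ ?_
  · have h1 : ContDiffAt ℝ ∞ (fun y : E3 => arcFactor (cosHalfSq (u : E3) y)) (u : E3) :=
      ContDiffAt.comp (u : E3) (contDiffAt_arcFactor hpos)
        (contDiff_cosHalfSq.comp (f := fun y : E3 => ((u : E3), y)) (by fun_prop)).contDiffAt
    have h2 : ContDiffAt ℝ ∞ (fun y : E3 => arcDensity (fiberJet u) y) (u : E3) :=
      ContDiffAt.comp (g := fun w : JetData × E3 => arcDensity w.1 w.2)
        (f := fun y => (fiberJet u, y)) (u : E3) (contDiffAt_arcDensity hpos) (by fun_prop)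
    exact (h1.mul h2).differentiableAt (by simp)
  · simp [arcDensity, fiberJet, cosHalfSq_self, arcFactor_one]

/-- The energy density along an unperturbed fiber, as a function of the cosine of the distance. -/
noncomputable def fiberEnergy (c : ℝ) : ℝ :=
  1 / 4 * (1 - (1 + c) / 2) * arcFactor ((1 + c) / 2) ^ 2 * (1 + c)

theorem contDiffAt_fiberEnergy : ContDiffAt ℝ ∞ fiberEnergy 1 := by
  have hN : ContDiffAt ℝ ∞ (fun c : ℝ => arcFactor ((1 + c) / 2)) 1 :=
    ContDiffAt.comp (1 : ℝ) (contDiffAt_arcFactor (by norm_num)) (by fun_prop)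
  unfold fiberEnergy
  fun_prop

/-- For `|θ| < π/2` one has `fiberEnergy (cos 2θ) = θ²/2`, while `cos 2θ = 1 - 2θ² + ⋯`. This slope
is the origin of the factor `4` in `energyField`. -/
theorem deriv_fiberEnergy_one : deriv fiberEnergy 1 = -(1 / 4) := by
  have hN : DifferentiableAt ℝ (fun c : ℝ => 1 / 8 * arcFactor ((1 + c) / 2) ^ 2 * (1 + c)) 1 := by
    have hN : ContDiffAt ℝ ∞ (fun c : ℝ => arcFactor ((1 + c) / 2)) 1 :=
      ContDiffAt.comp (1 : ℝ) (contDiffAt_arcFactor (by norm_num)) (by fun_prop)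
    have := hN.differentiableAt (by simp)
    fun_prop
  have h1 := ((hasDerivAt_id (1 : ℝ)).const_sub 1).mul hN.hasDerivAt
  have e : fiberEnergy = fun c => (1 - id c) * (1 / 8 * arcFactor ((1 + c) / 2) ^ 2 * (1 + c)) := by
    ext c; simp only [fiberEnergy, id]; ring
  rw [e]
  refine (HasDerivAt.deriv h1).trans ?_
  norm_num [arcFactor_one]

theorem energyDensity_fiberJet (u : S2) (y : E3) :
    energyDensity (fiberJet u) (‖y‖⁻¹ • y) = fiberEnergy (‖y‖⁻¹ * inner ℝ (u : E3) y) := by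
  simp [energyDensity, fiberJet, fiberEnergy, cosHalfSq, inner_smul_right]

/-- The cosine `⟨u, y⟩ / ‖y‖` has gradient `‖y‖⁻³ (‖y‖² u - ⟨u, y⟩ y)`. Thus on unperturbed fibers
the energy leads to the same standard field as the average, up to the scalar coefficient. -/
theorem gradient_energyDensity_fiberJet (u : S2) :
    ∀ᶠ y in 𝓝 (u : E3), gradient (fun y : E3 => energyDensity (fiberJet u) (‖y‖⁻¹ • y)) y
      = (deriv fiberEnergy (‖y‖⁻¹ * inner ℝ (u : E3) y) * (‖y‖⁻¹) ^ 3)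
        • (‖y‖ ^ 2 • (u : E3) - inner ℝ (u : E3) y • y) := by
  have hu := norm_coe_S2 u
  have hc : ContinuousAt (fun y : E3 => ‖y‖⁻¹ * inner ℝ (u : E3) y) (u : E3) := by
    refine ContinuousAt.mul (ContinuousAt.inv₀ (by fun_prop) (by simp [hu])) ?_
    exact (innerSL ℝ (u : E3)).continuous.continuousAt
  have h1 : ContDiffAt ℝ 1 fiberEnergy 1 := contDiffAt_fiberEnergy.of_le (by exact_mod_cast le_top)
  have hv : ‖(u : E3)‖⁻¹ * inner ℝ (u : E3) (u : E3) = 1 := by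
    rw [real_inner_self_eq_norm_sq, hu]; norm_num
  have h2 : ∀ᶠ y in 𝓝 (u : E3), ContDiffAt ℝ 1 fiberEnergy (‖y‖⁻¹ * inner ℝ (u : E3) y) := by
    have := h1.eventually (by simp)
    rw [← hv] at this
    exact hc.eventually this
  filter_upwards [h2, isOpen_ne.mem_nhds (coe_S2_ne_zero u)] with y hy hy0
  have hn0 : ‖y‖ ≠ 0 := norm_ne_zero_iff.2 hy0
  have hd1 : HasFDerivAt (fun y : E3 => ‖y‖⁻¹) (-(‖y‖⁻¹ ^ 3) • innerSL ℝ y) y := by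
    have hnorm : DifferentiableAt ℝ (fun y : E3 => ‖y‖) y :=
      (contDiffAt_norm ℝ hy0 (n := 1)).differentiableAt one_ne_zero
    have hsq : HasFDerivAt (fun y : E3 => ‖y‖ ^ 2) (2 • innerSL ℝ y) y :=
      (hasStrictFDerivAt_norm_sq y).hasFDerivAt
    have heq := (hnorm.hasFDerivAt.pow 2).unique hsq
    have := (hasDerivAt_inv hn0).comp_hasFDerivAt y hnorm.hasFDerivAt
    refine this.congr_fderiv ?_
    ext w
    have hw := congrArg (fun L : E3 →L[ℝ] ℝ => L w) heq
    simp at hw ⊢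
    have hw' : fderiv ℝ (fun y : E3 => ‖y‖) y w = ‖y‖⁻¹ * inner ℝ y w := by
      field_simp
      linarith
    rw [hw']
    field_simp
  have hd2 : HasFDerivAt (fun y : E3 => inner ℝ (u : E3) y) (innerSL ℝ (u : E3)) y :=
    (innerSL ℝ (u : E3)).hasFDerivAt
  have hd3 := (hy.differentiableAt one_ne_zero).hasDerivAt.comp_hasFDerivAt y (hd1.mul hd2)
  have hd4 : HasFDerivAt (fun y : E3 => energyDensity (fiberJet u) (‖y‖⁻¹ • y)) _ y :=
    hd3.congr_of_eventuallyEq (Eventually.of_forall fun y => energyDensity_fiberJet u y)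
  refine ext_inner_right ℝ fun w => ?_
  rw [inner_gradient, hd4.fderiv]
  simp [inner_smul_left, inner_sub_left]
  field_simp
  ring

theorem hasFDerivAt_energyField (u : S2) :
    HasFDerivAt (fun y => energyField (fiberJet u, y)) (ContinuousLinearMap.id ℝ E3) (u : E3) := by
  have hu := norm_coe_S2 u
  have hv : ‖(u : E3)‖⁻¹ * inner ℝ (u : E3) (u : E3) = 1 := by
    rw [real_inner_self_eq_norm_sq, hu]; norm_num
  refine (hasFDerivAt_standardField u
    (a := fun y => -(4 * (deriv fiberEnergy (‖y‖⁻¹ * inner ℝ (u : E3) y) * (‖y‖⁻¹) ^ 3)))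
    ?_ ?_).congr_of_eventuallyEq ?_
  · have h1 : DifferentiableAt ℝ (fun y : E3 => ‖y‖⁻¹) (u : E3) :=
      ((contDiffAt_norm ℝ (coe_S2_ne_zero u) (n := 1)).differentiableAt one_ne_zero).inv
        (by simp [hu])
    have h2 : DifferentiableAt ℝ (fun y : E3 => inner ℝ (u : E3) y) (u : E3) :=
      (innerSL ℝ (u : E3)).differentiableAt
    have h3 : DifferentiableAt ℝ (deriv fiberEnergy) 1 := by
      have : ContDiffAt ℝ 2 fiberEnergy 1 :=
        contDiffAt_fiberEnergy.of_le (WithTop.coe_le_coe.2 le_top)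
      have h4 : ContDiffAt ℝ 1 (deriv fiberEnergy) 1 := by
        have h5 : ContDiffAt ℝ 1 (fderiv ℝ fiberEnergy) 1 := this.fderiv_right (by norm_num)
        exact h5.clm_apply contDiffAt_const
      exact h4.differentiableAt one_ne_zero
    rw [← hv] at h3
    have h4 : DifferentiableAt ℝ
        (fun y : E3 => deriv fiberEnergy (‖y‖⁻¹ * inner ℝ (u : E3) y)) (u : E3) :=
      DifferentiableAt.comp (g := deriv fiberEnergy) (u : E3) h3 (h1.mul h2)
    exact ((h4.mul (h1.pow 3)).const_mul 4).neg
  · simp [hu, deriv_fiberEnergy_one]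
  · filter_upwards [gradient_energyDensity_fiberJet u] with y hy
    simp only [energyField, hy, smul_smul, neg_neg]

theorem averageField_fiberJet_self (u : S2) : averageField (fiberJet u, (u : E3)) = 0 := by
  simp [averageField, fiberJet]

theorem energyField_fiberJet_self (u : S2) : energyField (fiberJet u, (u : E3)) = 0 := by
  simp only [energyField, (gradient_energyDensity_fiberJet u).self_of_nhds]
  simp

end Densities

/-! ### Quaternion identities and projection to the plane of a Hopf fiber -/

section QuaternionAlgebra

theorem inner_quaternion (a b : ℍ[ℝ]) :
    inner ℝ a b = a.re * b.re + a.imI * b.imI + a.imJ * b.imJ + a.imK * b.imK := by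
  rw [Quaternion.inner_def]; simp

theorem inner_E3 (x y : E3) : inner ℝ x y = x 0 * y 0 + x 1 * y 1 + x 2 * y 2 := by
  rw [EuclideanSpace.inner_eq_star_dotProduct]
  simp [dotProduct, Fin.sum_univ_three]; ring

theorem norm_sq_quaternion (a : ℍ[ℝ]) :
    ‖a‖ ^ 2 = a.re ^ 2 + a.imI ^ 2 + a.imJ ^ 2 + a.imK ^ 2 := by
  rw [← real_inner_self_eq_norm_sq, inner_quaternion]; ring

theorem norm_coe_S3 (q : S3) : ‖(q : ℍ[ℝ])‖ = 1 := norm_eq_of_mem_sphere q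

theorem coe_S3_ne_zero (q : S3) : (q : ℍ[ℝ]) ≠ 0 := by
  rw [← norm_ne_zero_iff, norm_coe_S3]; exact one_ne_zero

theorem sq_sum_S2 (x : S2) : (x : E3) 0 ^ 2 + (x : E3) 1 ^ 2 + (x : E3) 2 ^ 2 = 1 :=
  (mem_S2_iff x).1 x.2

theorem norm_quatI : ‖quatI‖ = 1 :=
  mem_sphere_zero_iff_norm.1 ((mem_S3_iff _).2 (by simp [quatI]))

theorem norm_mul_quatI (q : ℍ[ℝ]) : ‖q * quatI‖ = ‖q‖ := by rw [norm_mul, norm_quatI, mul_one]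

theorem inner_mul_quatI_self (q : ℍ[ℝ]) : inner ℝ q (q * quatI) = 0 := by
  rw [inner_quaternion]; simp [quatI]; ring

/-- The imaginary quaternion with given coordinates. -/
noncomputable def imQ : E3 →L[ℝ] ℍ[ℝ] :=
  LinearMap.toContinuousLinearMap
    { toFun := fun x => quat 0 (x 0) (x 1) (x 2)
      map_add' := fun x y => by ext <;> simp
      map_smul' := fun c x => by ext <;> simp }

theorem imQ_apply (x : E3) : imQ x = quat 0 (x 0) (x 1) (x 2) := rfl

/-- The coordinates of the imaginary part of a quaternion. -/
noncomputable def vecPart : ℍ[ℝ] →L[ℝ] E3 :=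
  LinearMap.toContinuousLinearMap
    { toFun := fun q => !₂[q.imI, q.imJ, q.imK]
      map_add' := fun x y => by ext i; fin_cases i <;> simp
      map_smul' := fun c x => by ext i; fin_cases i <;> simp }

theorem vecPart_apply (q : ℍ[ℝ]) : vecPart q = !₂[q.imI, q.imJ, q.imK] := rfl

theorem hopfAmbient_eq_vecPart (q : ℍ[ℝ]) : hopfAmbient q = vecPart (q * quatI * star q) := rfl

theorem norm_vecPart_le (q : ℍ[ℝ]) : ‖vecPart q‖ ≤ ‖q‖ := by
  refine le_of_sq_le_sq ?_ (norm_nonneg _)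
  rw [norm_sq_quaternion, ← real_inner_self_eq_norm_sq, inner_E3, vecPart_apply]
  simp
  nlinarith [sq_nonneg q.re]

/-- Quaternion conjugation as a linear map. -/
noncomputable def conjQ : ℍ[ℝ] →L[ℝ] ℍ[ℝ] :=
  LinearMap.toContinuousLinearMap
    { toFun := fun q => star q
      map_add' := fun x y => star_add x y
      map_smul' := fun c x => by simp }

theorem conjQ_apply (q : ℍ[ℝ]) : conjQ q = star q := rfl

theorem contDiff_star_quaternion : ContDiff ℝ ∞ fun q : ℍ[ℝ] => star q := conjQ.contDiff

theorem contDiff_hopfAmbient : ContDiff ℝ ∞ hopfAmbient :=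
  vecPart.contDiff.comp ((contDiff_id.mul contDiff_const).mul contDiff_star_quaternion)

theorem fderiv_hopfAmbient_apply (q : ℍ[ℝ]) (w : ℍ[ℝ]) :
    fderiv ℝ hopfAmbient q w = vecPart (w * quatI * star q + q * quatI * star w) := by
  have h0 : HasFDerivAt (fun q : ℍ[ℝ] => q * quatI) _ q :=
    (hasFDerivAt_id (𝕜 := ℝ) q).mul_const' quatI
  have h1 := h0.mul' (conjQ.hasFDerivAt (x := q))
  have h2 : HasFDerivAt hopfAmbient _ q := vecPart.hasFDerivAt.comp q h1
  rw [h2.fderiv]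
  simp [conjQ_apply]
  abel

theorem imQ_mul_imQ (x : S2) : imQ x * imQ x = -1 := by
  have h := sq_sum_S2 x
  rw [imQ_apply]
  ext <;> simp
  · linarith
  all_goals ring

/-- The orthogonal projection to the plane spanned by the Hopf fiber over `x`. -/
noncomputable def fiberProj (x : E3) (y : ℍ[ℝ]) : ℍ[ℝ] := (1 / 2 : ℝ) • (y - imQ x * y * quatI)

theorem contDiff_fiberProj : ContDiff ℝ ∞ fun w : E3 × ℍ[ℝ] => fiberProj w.1 w.2 := by
  have : ContDiff ℝ ∞ fun w : E3 × ℍ[ℝ] => imQ w.1 := imQ.contDiff.comp contDiff_fst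
  unfold fiberProj
  exact (contDiff_snd.sub ((this.mul contDiff_snd).mul contDiff_const)).const_smul (1 / 2 : ℝ)

theorem inner_fiberProj_left (x : E3) (a b : ℍ[ℝ]) :
    inner ℝ (fiberProj x a) b = inner ℝ a (fiberProj x b) := by
  simp only [inner_quaternion, fiberProj, imQ_apply, quatI]
  simp
  ring

theorem fiberProj_mul_quatI (x : E3) (y : ℍ[ℝ]) :
    fiberProj x (y * quatI) = fiberProj x y * quatI := by
  simp only [fiberProj, smul_mul_assoc, sub_mul, mul_assoc]

theorem quatI_mul_quatI : quatI * quatI = -1 := by ext <;> simp [quatI]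

/-- Since `x² = i² = -1`, the map `y ↦ -x y i` is an involution, and `fiberProj` is its mean with
the identity. The fixed space `{x q = q i}` meets `S³` exactly in the fiber over `x`. -/
theorem imQ_mul_fiberProj (x : S2) (y : ℍ[ℝ]) :
    imQ x * fiberProj x y = fiberProj x y * quatI := by
  simp only [fiberProj, smul_mul_assoc, mul_smul_comm, mul_sub, sub_mul]
  congr 1
  rw [mul_assoc (imQ x * y) quatI, quatI_mul_quatI, ← mul_assoc, ← mul_assoc, imQ_mul_imQ]
  simp
  abel

theorem fiberProj_eq_self {x : S2} {q : ℍ[ℝ]} (h : imQ x * q = q * quatI) :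
    fiberProj x q = q := by
  rw [fiberProj, h, mul_assoc, quatI_mul_quatI]
  simp only [mul_neg, mul_one, sub_neg_eq_add, ← two_smul ℝ q, smul_smul]
  norm_num

theorem fiberProj_fiberProj (x : S2) (y : ℍ[ℝ]) :
    fiberProj x (fiberProj x y) = fiberProj x y :=
  fiberProj_eq_self (imQ_mul_fiberProj x y)

theorem inner_fiberProj_self (x : E3) (y : ℍ[ℝ]) :
    inner ℝ y (fiberProj x y) = (‖y‖ ^ 2 + inner ℝ (hopfAmbient y) x) / 2 := by
  rw [hopfAmbient_eq, norm_sq_quaternion, inner_quaternion, inner_E3, fiberProj, imQ_apply, quatI]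
  simp
  ring

/-- For a self-adjoint idempotent, `‖Πy‖² = ⟨y, Πy⟩`. This is the squared cosine of the distance
from `y` to the fiber. -/
theorem norm_fiberProj_sq (x : S2) (y : S3) :
    ‖fiberProj x y‖ ^ 2 = cosHalfSq (hopfAmbient y) x := by
  rw [← real_inner_self_eq_norm_sq, inner_fiberProj_left, fiberProj_fiberProj,
    inner_fiberProj_self, norm_coe_S3, cosHalfSq]
  norm_num

/-- `Πy · i` lies in the plane of the fiber and is orthogonal to `Πy`, hence to `y`. This is why the
geodesic from the foot point to `y` starts horizontally. -/
theorem inner_fiberProj_mul_quatI (x : S2) (y : ℍ[ℝ]) :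
    inner ℝ y (fiberProj x y * quatI) = 0 := by
  rw [← fiberProj_mul_quatI, ← fiberProj_fiberProj, ← inner_fiberProj_left, fiberProj_mul_quatI,
    inner_mul_quatI_self]

theorem imQ_eq_iff_hopf (x : S2) (q : S3) : imQ x * q = q * quatI ↔ hopf q = x := by
  have hm : star (q : ℍ[ℝ]) * (q : ℍ[ℝ]) = 1 := by
    rw [Quaternion.star_mul_self, Quaternion.normSq_def', (mem_S3_iff q).1 q.2]; simp
  have hm' : (q : ℍ[ℝ]) * star (q : ℍ[ℝ]) = 1 := by
    rw [Quaternion.self_mul_star, Quaternion.normSq_def', (mem_S3_iff q).1 q.2]; simp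
  have h0 : imQ (hopfAmbient q) = (q : ℍ[ℝ]) * quatI * star (q : ℍ[ℝ]) := by
    rw [imQ_apply]
    refine Quaternion.ext _ _ ?_ rfl rfl rfl
    simp [quatI]; ring
  constructor
  · intro h
    apply Subtype.ext
    change hopfAmbient q = x
    rw [hopfAmbient_eq_vecPart, ← h, mul_assoc, hm', mul_one, imQ_apply, vecPart_apply]
    ext i; fin_cases i <;> simp
  · intro h
    rw [← h]
    change imQ (hopfAmbient q) * q = q * quatI
    rw [h0, mul_assoc, hm, mul_one]

theorem star_imQ (x : E3) : star (imQ x) = -imQ x := by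
  rw [imQ_apply]; ext <;> simp

theorem star_quatI : star quatI = -quatI := by ext <;> simp [quatI]

/-- Two quaternions in the plane of a Hopf fiber. -/
theorem norm_sq_smul_eq {x : E3} {q w : ℍ[ℝ]} (hq : imQ x * q = q * quatI)
    (hw : imQ x * w = w * quatI) :
    ‖q‖ ^ 2 • w = inner ℝ w q • q + inner ℝ w (q * quatI) • (q * quatI) := by
  have h1 : star q * imQ x = quatI * star q := by
    have := congrArg star hq
    rw [star_mul, star_mul, star_imQ, star_quatI, mul_neg, neg_mul, neg_inj] at this
    exact this
  -- The product `q̄ w` commutes with `i`, so it is a complex number; its two coordinates are the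
  -- inner products of `w` with `q` and `q i`.
  obtain ⟨v, hv⟩ : ∃ v, v = star q * w := ⟨_, rfl⟩
  have hcomm : v * quatI = quatI * v := by
    rw [hv, mul_assoc, ← hw, ← mul_assoc, h1, mul_assoc]
  have hj : v.imJ = 0 := by
    have := congrArg (fun z : ℍ[ℝ] => z.imK) hcomm
    simp [quatI] at this
    linarith
  have hk : v.imK = 0 := by
    have := congrArg (fun z : ℍ[ℝ] => z.imJ) hcomm
    simp [quatI] at this
    linarith
  have e1 : v.re = inner ℝ w q := by rw [hv, inner_quaternion]; simp; ring
  have e2 : v.imI = inner ℝ w (q * quatI) := by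
    rw [hv, inner_quaternion, quatI]; simp; ring
  have e3 : v = inner ℝ w q • (1 : ℍ[ℝ]) + inner ℝ w (q * quatI) • quatI := by
    rw [← e1, ← e2]
    refine Quaternion.ext _ _ ?_ ?_ ?_ ?_ <;> simp [quatI, hj, hk]
  have e4 : q * v = ‖q‖ ^ 2 • w := by
    rw [hv, ← mul_assoc, Quaternion.self_mul_star, Quaternion.normSq_eq_norm_mul_self,
      Quaternion.coe_mul_eq_smul, pow_two]
  rw [← e4, e3, mul_add, mul_smul_comm, mul_smul_comm, mul_one]

end QuaternionAlgebra

/-! ### Extending maps of the three-sphere to the quaternions -/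

section Normalization

/-- The radial projection to the unit sphere of quaternions. -/
noncomputable def toS3 (q : ℍ[ℝ]) : S3 :=
  open Classical in
  if h : q ≠ 0 then
    ⟨‖q‖⁻¹ • q, by
      rw [mem_sphere_zero_iff_norm, norm_smul, norm_inv, norm_norm,
        inv_mul_cancel₀ (norm_ne_zero_iff.2 h)]⟩
  else ⟨1, by simp⟩

theorem coe_toS3 {q : ℍ[ℝ]} (h : q ≠ 0) : (toS3 q : ℍ[ℝ]) = ‖q‖⁻¹ • q := by
  rw [toS3, dif_pos h]

theorem toS3_coe (q : S3) : toS3 q = q := by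
  apply Subtype.ext
  rw [coe_toS3 (coe_S3_ne_zero q), norm_coe_S3, inv_one, one_smul]

theorem contDiffAt_coe_toS3 {q : ℍ[ℝ]} (h : q ≠ 0) :
    ContDiffAt ℝ ∞ (fun q => (toS3 q : ℍ[ℝ])) q := by
  refine (contDiffAt_normalize h).congr_of_eventuallyEq ?_
  filter_upwards [isOpen_ne.mem_nhds h] with z hz using coe_toS3 hz

theorem contMDiffAt_toS3 {q : ℍ[ℝ]} (h : q ≠ 0) :
    ContMDiffAt 𝓘(ℝ, ℍ[ℝ]) (𝓡 3) ∞ toS3 q := by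
  -- The normalization is smooth only away from the origin, so smoothness into the sphere is read on
  -- the open submanifold of nonzero quaternions.
  let U : TopologicalSpace.Opens ℍ[ℝ] := ⟨{z | z ≠ 0}, isOpen_ne⟩
  have h1 : ContMDiff 𝓘(ℝ, ℍ[ℝ]) 𝓘(ℝ, ℍ[ℝ]) ∞ (fun z : U => (toS3 z : ℍ[ℝ])) := fun z =>
    (contMDiffAt_subtype_iff (f := fun z : ℍ[ℝ] => (toS3 z : ℍ[ℝ]))).2
      (contDiffAt_coe_toS3 z.2).contMDiffAt
  have h2 := ContMDiff.codRestrict_sphere (n := 3) h1 (fun z => (toS3 z).2)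
  exact (contMDiffAt_subtype_iff (U := U) (f := toS3) (x := ⟨q, h⟩)).1 (h2 ⟨q, h⟩)

/-- The extension of a map of the three-sphere to the quaternions that is constant on rays. -/
noncomputable def ambientExt (f : S3 → S3) (q : ℍ[ℝ]) : ℍ[ℝ] := f (toS3 q)

theorem ambientExt_coe (f : S3 → S3) (q : S3) : ambientExt f q = f q := by
  rw [ambientExt, toS3_coe]

theorem contDiffAt_ambientExt {f : S3 → S3} (hf : ContMDiff (𝓡 3) (𝓡 3) ∞ f) {q : ℍ[ℝ]}
    (h : q ≠ 0) : ContDiffAt ℝ ∞ (ambientExt f) q := by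
  rw [← contMDiffAt_iff_contDiffAt]
  exact ((contMDiff_coe_sphere (n := 3)).comp hf).contMDiffAt.comp q (contMDiffAt_toS3 h)

end Normalization

/-! ### The flow along the fibers -/

section Rotation

/-- The unit complex number `e^{it}`, as a quaternion. -/
noncomputable def expI (t : ℝ) : ℍ[ℝ] := quat (Real.cos t) (Real.sin t) 0 0

theorem coe_rot (q : S3) (t : ℝ) : (rot q t : ℍ[ℝ]) = q * expI t := rfl

theorem expI_eq (t : ℝ) : expI t = Real.cos t • (1 : ℍ[ℝ]) + Real.sin t • quatI := by
  ext <;> simp [expI, quatI]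

theorem contDiff_expI : ContDiff ℝ ∞ expI := by
  rw [show expI = fun t => Real.cos t • (1 : ℍ[ℝ]) + Real.sin t • quatI from funext expI_eq]
  exact (Real.contDiff_cos.smul contDiff_const).add (Real.contDiff_sin.smul contDiff_const)

theorem hasDerivAt_expI (t : ℝ) : HasDerivAt expI (expI t * quatI) t := by
  rw [show expI = fun t => Real.cos t • (1 : ℍ[ℝ]) + Real.sin t • quatI from funext expI_eq]
  have := ((Real.hasDerivAt_cos t).smul_const (1 : ℍ[ℝ])).add
    ((Real.hasDerivAt_sin t).smul_const quatI)
  refine this.congr_deriv ?_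
  ext <;> simp [quatI]

theorem expI_mul_expI (s t : ℝ) : expI s * expI t = expI (s + t) := by
  ext <;> simp [expI, Real.cos_add, Real.sin_add]
  ring

theorem expI_zero : expI 0 = 1 := by ext <;> simp [expI]

theorem hasDerivAt_rot (q : S3) (t : ℝ) :
    HasDerivAt (fun t => (rot q t : ℍ[ℝ])) (rot q t * quatI) t := by
  simp only [coe_rot, mul_assoc]
  exact (hasDerivAt_expI t).const_mul (q : ℍ[ℝ])

theorem contDiff_coe_rot (q : S3) : ContDiff ℝ ∞ fun t => (rot q t : ℍ[ℝ]) :=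
  contDiff_const.mul contDiff_expI

theorem contMDiff_rot (q : S3) : ContMDiff 𝓘(ℝ, ℝ) (𝓡 3) ∞ (rot q) :=
  ContMDiff.codRestrict_sphere (n := 3) (contDiff_coe_rot q).contMDiff fun t => (rot q t).2

theorem continuous_rot (q : S3) : Continuous (rot q) := (contMDiff_rot q).continuous

end Rotation

/-! ### First order jets of the image fibers and their closeness to the unperturbed ones -/

section Nearness

theorem hasDerivAt_comp_rot {f : S3 → S3} (hf : ContMDiff (𝓡 3) (𝓡 3) ∞ f) (q : S3) (t : ℝ) :
    HasDerivAt (fun t => (f (rot q t) : ℍ[ℝ]))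
      (fderiv ℝ (ambientExt f) (rot q t : ℍ[ℝ]) (rot q t * quatI)) t := by
  have h1 := ((contDiffAt_ambientExt hf (coe_S3_ne_zero (rot q t))).differentiableAt
    (by simp)).hasFDerivAt.comp_hasDerivAt t (hasDerivAt_rot q t)
  refine h1.congr_of_eventuallyEq (Eventually.of_forall fun s => ?_)
  exact (ambientExt_coe f (rot q s)).symm

theorem rot_zero (q : S3) : rot q 0 = q := by
  apply Subtype.ext; rw [coe_rot, expI_zero, mul_one]

/-- The intrinsic bound on the differential is evaluated on the velocity of the flow line through
`q`, which has ambient length `1`. This derivative along the fiber is the one that enters the jets.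
-/
theorem C1NearId.norm_fderiv_sub_le {f : S3 → S3} {ε : ℝ} (h : C1NearId f ε)
    (hf : ContMDiff (𝓡 3) (𝓡 3) ∞ f) (q : S3) :
    ‖fderiv ℝ (ambientExt f) (q : ℍ[ℝ]) (q * quatI) - q * quatI‖ ≤ ε := by
  have hrot : MDifferentiableAt 𝓘(ℝ, ℝ) (𝓡 3) (rot q) 0 :=
    (contMDiff_rot q).mdifferentiableAt (by simp)
  have hcoe : MDifferentiableAt (𝓡 3) 𝓘(ℝ, ℍ[ℝ]) (fun y : S3 => (y : ℍ[ℝ])) (rot q 0) :=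
    (contMDiff_coe_sphere (n := 3) (m := ∞)).mdifferentiableAt (by simp)
  have hsub : MDifferentiableAt (𝓡 3) 𝓘(ℝ, ℍ[ℝ]) (fun y : S3 => (f y : ℍ[ℝ]) - (y : ℍ[ℝ]))
      (rot q 0) :=
    (((contMDiff_coe_sphere (n := 3) (m := ∞)).comp hf).sub
      (contMDiff_coe_sphere (n := 3) (m := ∞))).mdifferentiableAt (by simp)
  have key : ∀ (g : S3 → ℍ[ℝ]) (v : ℍ[ℝ]), MDifferentiableAt (𝓡 3) 𝓘(ℝ, ℍ[ℝ]) g (rot q 0) →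
      HasDerivAt (fun t => g (rot q t)) v 0 →
      mvfderiv (𝓡 3) g (rot q 0) (mfderiv 𝓘(ℝ, ℝ) (𝓡 3) (rot q) 0 (1 : ℝ)) = v := by
    intro g v hg hv
    obtain ⟨L, hL⟩ : ∃ L : ℝ →L[ℝ] ℍ[ℝ], L = (mfderiv (𝓡 3) 𝓘(ℝ, ℍ[ℝ]) g (rot q 0)).comp
      (mfderiv 𝓘(ℝ, ℝ) (𝓡 3) (rot q) 0) := ⟨_, rfl⟩
    have h1 : HasFDerivAt (fun t => g (rot q t)) L 0 := by
      rw [hL]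
      exact (hg.hasMFDerivAt.comp (0 : ℝ) hrot.hasMFDerivAt).hasFDerivAt
    have h2 : L 1 = v := by rw [h1.unique hv.hasFDerivAt]; simp
    rw [← h2, hL]
    rfl
  have h1 := key _ (rot q 0 * quatI) hcoe (hasDerivAt_rot q 0)
  have h2 := key _ _ hsub ((hasDerivAt_comp_rot hf q 0).sub (hasDerivAt_rot q 0))
  have h3 := h.2 (rot q 0) (mfderiv 𝓘(ℝ, ℝ) (𝓡 3) (rot q) 0 (1 : ℝ))
  rw [h1, h2] at h3
  simpa only [rot_zero, norm_mul_quatI, norm_coe_S3, mul_one] using h3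

/-- The jet data of a curve in `S³` with given position and velocity. -/
noncomputable def jetOf (a b : ℍ[ℝ]) : JetData :=
  (hopfAmbient a, inner ℝ b (a * quatI), vecPart (b * star a))

/-- The jet data of the image under `f` of the Hopf fiber through `q`. -/
noncomputable def jet (f : S3 → S3) (q : ℍ[ℝ]) : JetData :=
  jetOf (ambientExt f q) (fderiv ℝ (ambientExt f) q (q * quatI))

theorem contDiff_jetOf : ContDiff ℝ ∞ fun w : ℍ[ℝ] × ℍ[ℝ] => jetOf w.1 w.2 := by
  have hst : ContDiff ℝ ∞ fun w : ℍ[ℝ] × ℍ[ℝ] => star w.1 :=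
    contDiff_star_quaternion.comp contDiff_fst
  refine (contDiff_hopfAmbient.comp contDiff_fst).prodMk (ContDiff.prodMk ?_ ?_)
  · exact contDiff_snd.inner ℝ (contDiff_fst.mul contDiff_const)
  · exact vecPart.contDiff.comp (contDiff_snd.mul hst)

theorem contDiffAt_jet {f : S3 → S3} (hf : ContMDiff (𝓡 3) (𝓡 3) ∞ f) {q : ℍ[ℝ]} (h : q ≠ 0) :
    ContDiffAt ℝ ∞ (jet f) q := by
  have h1 := contDiffAt_ambientExt hf h
  have h2 : ContDiffAt ℝ ∞ (fun q => fderiv ℝ (ambientExt f) q (q * quatI)) q :=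
    (h1.fderiv_right (m := ∞) le_rfl).clm_apply (contDiffAt_id.mul contDiffAt_const)
  exact ContDiffAt.comp (g := fun w : ℍ[ℝ] × ℍ[ℝ] => jetOf w.1 w.2)
    (f := fun q => (ambientExt f q, fderiv ℝ (ambientExt f) q (q * quatI))) q
    contDiff_jetOf.contDiffAt (h1.prodMk h2)

theorem dist_jetOf_le {q a b : ℍ[ℝ]} {ε : ℝ} (hq : ‖q‖ = 1) (ha : ‖a‖ = 1) (haq : ‖a - q‖ ≤ ε)
    (hb : ‖b - q * quatI‖ ≤ ε) : dist (jetOf a b) (jetOf q (q * quatI)) ≤ 2 * ε := by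
  have e1 : ‖(a - q) * quatI‖ ≤ ε := by rwa [norm_mul_quatI]
  have e2 : ‖star a - star q‖ ≤ ε := by rwa [← star_sub, norm_star]
  have hqI : ‖q * quatI‖ = 1 := by rwa [norm_mul_quatI]
  have hsa : ‖star a‖ = 1 := by rwa [norm_star]
  refine max_le ?_ (max_le ?_ ?_)
  · rw [dist_eq_norm]
    change ‖hopfAmbient a - hopfAmbient q‖ ≤ _
    rw [hopfAmbient_eq_vecPart, hopfAmbient_eq_vecPart, ← map_sub]
    refine (norm_vecPart_le _).trans ?_
    rw [show a * quatI * star a - q * quatI * star q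
      = (a - q) * quatI * star a + q * quatI * (star a - star q) by noncomm_ring]
    refine (norm_add_le _ _).trans ?_
    rw [norm_mul, norm_mul (q * quatI), hsa, hqI]
    linarith
  · rw [Real.dist_eq]
    change |inner ℝ b (a * quatI) - inner ℝ (q * quatI) (q * quatI)| ≤ _
    rw [show inner ℝ b (a * quatI) - inner ℝ (q * quatI) (q * quatI)
      = inner ℝ (b - q * quatI) (a * quatI) + inner ℝ (q * quatI) ((a - q) * quatI) by
        rw [sub_mul, inner_sub_left, inner_sub_right]; ring]
    refine (abs_add_le _ _).trans ?_
    have h1 := abs_real_inner_le_norm (b - q * quatI) (a * quatI)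
    have h2 := abs_real_inner_le_norm (q * quatI) ((a - q) * quatI)
    rw [norm_mul_quatI a, ha] at h1
    rw [hqI] at h2
    linarith
  · rw [dist_eq_norm]
    change ‖vecPart (b * star a) - vecPart (q * quatI * star q)‖ ≤ _
    rw [← map_sub]
    refine (norm_vecPart_le _).trans ?_
    rw [show b * star a - q * quatI * star q
      = (b - q * quatI) * star a + q * quatI * (star a - star q) by noncomm_ring]
    refine (norm_add_le _ _).trans ?_
    rw [norm_mul, norm_mul (q * quatI), hsa, hqI]
    linarith

theorem jetOf_coe (q : S3) : jetOf q (q * quatI) = fiberJet (hopf q) := by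
  refine Prod.ext rfl (Prod.ext ?_ rfl)
  change inner ℝ ((q : ℍ[ℝ]) * quatI) (q * quatI) = 1
  rw [real_inner_self_eq_norm_sq, norm_mul_quatI, norm_coe_S3]; norm_num

theorem C1NearId.dist_jet_le {f : S3 → S3} {ε : ℝ} (h : C1NearId f ε)
    (hf : ContMDiff (𝓡 3) (𝓡 3) ∞ f) (q : S3) :
    dist (jet f q) (fiberJet (hopf q)) ≤ 2 * ε := by
  rw [← jetOf_coe, jet, ambientExt_coe]
  exact dist_jetOf_le (norm_coe_S3 q) (norm_coe_S3 _) (h.1 q).le (h.norm_fderiv_sub_le hf q)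

/-- The reason for the choice of jet data: the angular speed of the projected curve, times `‖Πa‖²`,
is affine in `x`, with coefficients given by the last two jet components. -/
theorem inner_fiberProj_jetOf (x : S2) (a b : ℍ[ℝ]) :
    inner ℝ (fiberProj x b) (fiberProj x a * quatI)
      = ((jetOf a b).2.1 + inner ℝ (jetOf a b).2.2 (x : E3)) / 2 := by
  rw [← fiberProj_mul_quatI, inner_fiberProj_left, fiberProj_fiberProj, ← inner_fiberProj_left]
  simp only [jetOf, inner_quaternion, inner_E3, vecPart_apply, fiberProj, imQ_apply, quatI]
  simp
  ring

end Nearness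

/-! ### Shooting vectors in terms of their end points -/

section Shooting

theorem inner_mul_quatI_mul_quatI (a b : ℍ[ℝ]) :
    inner ℝ (a * quatI) (b * quatI) = inner ℝ a b := by
  simp only [inner_quaternion, quatI]; simp; ring

theorem inner_mul_quatI_left (a b : ℍ[ℝ]) :
    inner ℝ (a * quatI) b = -inner ℝ a (b * quatI) := by
  simp only [inner_quaternion, quatI]; simp; ring

/-- The initial velocity at `q` of the minimizing geodesic of `S³` from `q` to `y`. -/
noncomputable def shootVec (q y : ℍ[ℝ]) : ℍ[ℝ] :=
  (inner ℝ q y * arcFactor (inner ℝ q y ^ 2)) • (y - inner ℝ q y • q)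

theorem contDiffAt_shootVec {q y : ℍ[ℝ]} (h : 0 < inner ℝ q y) :
    ContDiffAt ℝ ∞ (fun w : ℍ[ℝ] × ℍ[ℝ] => shootVec w.1 w.2) (q, y) := by
  have hi : ContDiffAt ℝ ∞ (fun w : ℍ[ℝ] × ℍ[ℝ] => inner ℝ w.1 w.2) (q, y) :=
    contDiffAt_fst.inner ℝ contDiffAt_snd
  have hN : ContDiffAt ℝ ∞ (fun w : ℍ[ℝ] × ℍ[ℝ] => arcFactor (inner ℝ w.1 w.2 ^ 2)) (q, y) :=
    ContDiffAt.comp (g := arcFactor) (f := fun w : ℍ[ℝ] × ℍ[ℝ] => inner ℝ w.1 w.2 ^ 2) (q, y)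
      (contDiffAt_arcFactor (pow_pos h 2)) (hi.pow 2)
  unfold shootVec
  exact (hi.mul hN).smul (contDiffAt_snd.sub (hi.smul contDiffAt_fst))

theorem cos_mul_arcFactor_mul_sinc {θ : ℝ} (h : θ ∈ Set.Ioo (-(Real.pi / 2)) (Real.pi / 2)) :
    Real.cos θ * arcFactor (Real.cos θ ^ 2) * Real.sinc θ = 1 := by
  rcases eq_or_ne θ 0 with rfl | h0
  · simp [arcFactor_one]
  · rw [Real.sinc_of_ne_zero h0]
    have := arcFactor_cos_sq h
    field_simp
    linarith

theorem norm_sub_inner_smul_sq {q y : ℍ[ℝ]} (hq : ‖q‖ = 1) (hy : ‖y‖ = 1) :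
    ‖y - inner ℝ q y • q‖ ^ 2 = 1 - inner ℝ q y ^ 2 := by
  rw [norm_sub_sq_real, norm_smul, mul_pow, inner_smul_right, hq, hy, real_inner_comm,
    Real.norm_eq_abs, sq_abs]
  ring

theorem norm_shootVec_sq {q y : ℍ[ℝ]} (hq : ‖q‖ = 1) (hy : ‖y‖ = 1) :
    ‖shootVec q y‖ ^ 2
      = inner ℝ q y ^ 2 * (1 - inner ℝ q y ^ 2) * arcFactor (inner ℝ q y ^ 2) ^ 2 := by
  rw [shootVec, norm_smul, mul_pow, norm_sub_inner_smul_sq hq hy, Real.norm_eq_abs, sq_abs]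
  ring

/-- Shooting vectors are determined by their end points. -/
theorem isShootingVector_iff {T : Set S3} {q : S3} {w : ℍ[ℝ]} :
    IsShootingVector T q w ↔ ∃ y ∈ T, inner ℝ ((q : ℍ[ℝ]) * quatI) (y : ℍ[ℝ]) = 0 ∧
      0 < inner ℝ (q : ℍ[ℝ]) (y : ℍ[ℝ]) ∧ w = shootVec q y := by
  have hqq : inner ℝ (q : ℍ[ℝ]) (q : ℍ[ℝ]) = 1 := by
    rw [real_inner_self_eq_norm_sq, norm_coe_S3]; norm_num
  have hqI : inner ℝ ((q : ℍ[ℝ]) * quatI) (q : ℍ[ℝ]) = 0 := by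
    rw [real_inner_comm]; exact inner_mul_quatI_self _
  constructor
  · rintro ⟨⟨h1, h2⟩, h3, y, hy, he⟩
    have hθ : ‖w‖ ∈ Set.Ioo (-(Real.pi / 2)) (Real.pi / 2) :=
      ⟨by linarith [norm_nonneg w, Real.pi_pos], h3⟩
    have hc : inner ℝ (q : ℍ[ℝ]) (y : ℍ[ℝ]) = Real.cos ‖w‖ := by
      rw [← he, expS3, inner_add_right, inner_smul_right, inner_smul_right, h1, hqq]; ring
    refine ⟨y, hy, ?_, ?_, ?_⟩
    · rw [← he, expS3, inner_add_right, inner_smul_right, inner_smul_right, h2, hqI]; ring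
    · rw [hc]; exact Real.cos_pos_of_mem_Ioo hθ
    · rw [shootVec, hc, ← he, expS3, add_sub_cancel_left, smul_smul,
        cos_mul_arcFactor_mul_sinc hθ, one_smul]
  · rintro ⟨y, hy, h1, h2, rfl⟩
    have hle : inner ℝ (q : ℍ[ℝ]) (y : ℍ[ℝ]) ≤ 1 := by
      have := real_inner_le_norm (q : ℍ[ℝ]) (y : ℍ[ℝ])
      rwa [norm_coe_S3, norm_coe_S3, one_mul] at this
    obtain ⟨θ, hθ⟩ : ∃ θ, θ = Real.arccos (inner ℝ (q : ℍ[ℝ]) (y : ℍ[ℝ])) := ⟨_, rfl⟩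
    have hcos : Real.cos θ = inner ℝ (q : ℍ[ℝ]) (y : ℍ[ℝ]) := by
      rw [hθ, Real.cos_arccos (by linarith) hle]
    have h0 : 0 ≤ θ := by rw [hθ]; exact Real.arccos_nonneg _
    have hlt : θ < Real.pi / 2 := by rw [hθ]; exact Real.arccos_lt_pi_div_two.2 h2
    have hmem : θ ∈ Set.Ioo (-(Real.pi / 2)) (Real.pi / 2) :=
      ⟨by linarith [Real.pi_pos], hlt⟩
    have hnorm : ‖shootVec (q : ℍ[ℝ]) y‖ = θ := by
      refine (sq_eq_sq₀ (norm_nonneg _) h0).1 ?_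
      rw [norm_shootVec_sq (norm_coe_S3 q) (norm_coe_S3 y), ← hcos]
      have h5 := arcFactor_cos_sq hmem
      have h6 : 1 - Real.cos θ ^ 2 = Real.sin θ ^ 2 := by linarith [Real.sin_sq_add_cos_sq θ]
      calc _ = (arcFactor (Real.cos θ ^ 2) * (Real.sin θ * Real.cos θ)) ^ 2 := by rw [h6]; ring
        _ = θ ^ 2 := by rw [h5]
    refine ⟨⟨?_, ?_⟩, by rw [hnorm]; exact hlt, y, hy, ?_⟩
    · rw [shootVec, inner_smul_right, inner_sub_right, inner_smul_right, hqq]; ring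
    · rw [shootVec, inner_smul_right, inner_sub_right, inner_smul_right, hqI, h1]; ring
    · rw [expS3, hnorm, shootVec, smul_smul, ← hcos]
      rw [show Real.sinc θ * (Real.cos θ * arcFactor (Real.cos θ ^ 2)) = 1 by
        rw [mul_comm]; exact cos_mul_arcFactor_mul_sinc hmem]
      rw [one_smul]; abel

end Shooting

/-! ### Closest points on a fiber -/

section FootPoint

/-- The point of the Hopf fiber over `x` that is closest to `y`. -/
noncomputable def footPoint (x : E3) (y : ℍ[ℝ]) : S3 := toS3 (fiberProj x y)

theorem fiberProj_ne_zero {x : S2} {y : S3} (h : 0 < cosHalfSq (hopfAmbient y) x) :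
    fiberProj x y ≠ 0 := by
  rw [← norm_fiberProj_sq] at h
  intro h0
  rw [h0] at h
  simp at h

theorem coe_footPoint {x : S2} {y : S3} (h : 0 < cosHalfSq (hopfAmbient y) x) :
    (footPoint x y : ℍ[ℝ]) = ‖fiberProj x y‖⁻¹ • fiberProj x y := by
  rw [footPoint, coe_toS3 (fiberProj_ne_zero h)]

theorem hopf_footPoint {x : S2} {y : S3} (h : 0 < cosHalfSq (hopfAmbient y) x) :
    hopf (footPoint x y) = x := by
  rw [← imQ_eq_iff_hopf, coe_footPoint h, mul_smul_comm, imQ_mul_fiberProj, smul_mul_assoc]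

theorem inner_footPoint {x : S2} {y : S3} (h : 0 < cosHalfSq (hopfAmbient y) x) :
    inner ℝ (footPoint x y : ℍ[ℝ]) (y : ℍ[ℝ]) = ‖fiberProj x y‖ := by
  have h1 : inner ℝ (fiberProj x y) (y : ℍ[ℝ]) = ‖fiberProj x y‖ ^ 2 := by
    rw [← real_inner_self_eq_norm_sq, inner_fiberProj_left x (y : ℍ[ℝ]) (fiberProj x y),
      fiberProj_fiberProj, real_inner_comm]
  rw [coe_footPoint h, inner_smul_left, h1]
  have := norm_ne_zero_iff.2 (fiberProj_ne_zero h)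
  simp
  field_simp

theorem inner_footPoint_pos {x : S2} {y : S3} (h : 0 < cosHalfSq (hopfAmbient y) x) :
    0 < inner ℝ (footPoint x y : ℍ[ℝ]) (y : ℍ[ℝ]) := by
  rw [inner_footPoint h]; exact norm_pos_iff.2 (fiberProj_ne_zero h)

theorem inner_footPoint_sq {x : S2} {y : S3} (h : 0 < cosHalfSq (hopfAmbient y) x) :
    inner ℝ (footPoint x y : ℍ[ℝ]) (y : ℍ[ℝ]) ^ 2 = cosHalfSq (hopfAmbient y) x := by
  rw [inner_footPoint h, norm_fiberProj_sq]

theorem inner_footPoint_mul_quatI {x : S2} {y : S3} (h : 0 < cosHalfSq (hopfAmbient y) x) :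
    inner ℝ ((footPoint x y : ℍ[ℝ]) * quatI) (y : ℍ[ℝ]) = 0 := by
  rw [coe_footPoint h, smul_mul_assoc, inner_smul_left, real_inner_comm,
    inner_fiberProj_mul_quatI, mul_zero]

theorem norm_shootVec_footPoint_sq {x : S2} {y : S3} (h : 0 < cosHalfSq (hopfAmbient y) x) :
    ‖shootVec (footPoint x y) y‖ ^ 2 = cosHalfSq (hopfAmbient y) x
      * (1 - cosHalfSq (hopfAmbient y) x) * arcFactor (cosHalfSq (hopfAmbient y) x) ^ 2 := by
  rw [norm_shootVec_sq (norm_coe_S3 _) (norm_coe_S3 _), inner_footPoint_sq h]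

theorem vecPart_fiberProj (x : E3) (y : S3) :
    vecPart (y * quatI * star (fiberProj x y) + fiberProj x y * quatI * star (y : ℍ[ℝ]))
      = hopfAmbient y + x := by
  have h := (mem_S3_iff y).1 y.2
  rw [vecPart_apply, hopfAmbient_eq, fiberProj, imQ_apply, quatI]
  ext i
  fin_cases i
  · simp
    linear_combination (x 0) * h
  · simp
    linear_combination (x 1) * h
  · simp
    linear_combination (x 2) * h

/-- Let `n` be the foot point and `c = ⟨n, y⟩`. As `p` is quadratic, its differential at `n` sends
`n` to `2x` and `y` to `c⁻¹ (p(y) + x)`. With `⟨p(y), x⟩ = 2c² - 1`, the image of `y - c n` is `c⁻¹`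
times the tangential part of `p(y)`. -/
theorem fderiv_hopfAmbient_shootVec {x : S2} {y : S3} (h : 0 < cosHalfSq (hopfAmbient y) x) :
    fderiv ℝ hopfAmbient (footPoint x y : ℍ[ℝ]) (shootVec (footPoint x y) y)
      = arcFactor (cosHalfSq (hopfAmbient y) x)
        • (hopfAmbient y - inner ℝ (hopfAmbient y) (x : E3) • (x : E3)) := by
  have hc := inner_footPoint_pos h
  have h1 : fderiv ℝ hopfAmbient (footPoint x y : ℍ[ℝ]) (y : ℍ[ℝ])
      = (inner ℝ (footPoint x y : ℍ[ℝ]) (y : ℍ[ℝ]))⁻¹ • (hopfAmbient y + x) := by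
    rw [fderiv_hopfAmbient_apply, ← vecPart_fiberProj x y, inner_footPoint h, ← map_smul,
      coe_footPoint h]
    congr 1
    have hst : star (‖fiberProj x y‖⁻¹ • fiberProj x y)
        = ‖fiberProj x y‖⁻¹ • star (fiberProj x y) := by simp
    rw [hst]
    simp only [smul_add, mul_smul_comm, smul_mul_assoc]
  have h2 : fderiv ℝ hopfAmbient (footPoint x y : ℍ[ℝ]) (footPoint x y : ℍ[ℝ])
      = (2 : ℝ) • (x : E3) := by
    rw [fderiv_hopfAmbient_apply, map_add, ← hopfAmbient_eq_vecPart, ← two_smul ℝ]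
    congr 1
    exact congrArg Subtype.val (hopf_footPoint h)
  rw [shootVec, map_smul, map_sub, map_smul, h1, h2, inner_footPoint_sq h]
  have h3 := inner_footPoint_sq h
  obtain ⟨c, hcdef⟩ : ∃ c, c = inner ℝ (footPoint x y : ℍ[ℝ]) (y : ℍ[ℝ]) := ⟨_, rfl⟩
  rw [← hcdef] at hc h3 ⊢
  have h4 : inner ℝ (hopfAmbient y) (x : E3) = 2 * c ^ 2 - 1 := by
    rw [h3, cosHalfSq]; ring
  rw [h4, ← h3]
  rw [mul_comm, mul_smul]
  congr 1
  rw [smul_sub, smul_smul, mul_inv_cancel₀ hc.ne', smul_smul, smul_smul]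
  module

theorem cosHalfSq_eq_dist (z x : S2) : cosHalfSq (z : E3) x = 1 - dist z x ^ 2 / 4 := by
  rw [Subtype.dist_eq, dist_eq_norm, norm_sub_sq_real, norm_coe_S2, norm_coe_S2, cosHalfSq]
  ring

theorem cosHalfSq_gt {z x : S2} (h : dist z x < 1 / 2) : 15 / 16 < cosHalfSq (z : E3) x := by
  rw [cosHalfSq_eq_dist]
  nlinarith [dist_nonneg (x := z) (y := x)]

theorem coe_hopf (q : S3) : (hopf q : E3) = hopfAmbient q := rfl

theorem cosHalfSq_hopf_gt {q : S3} {x : S2} (h : dist (hopf q) x < 1 / 2) :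
    15 / 16 < cosHalfSq (hopfAmbient q) x := by
  rw [← coe_hopf]; exact cosHalfSq_gt h

theorem cosHalfSq_hopf_pos {q : S3} {x : S2} (h : dist (hopf q) x < 1 / 2) :
    0 < cosHalfSq (hopfAmbient q) x := lt_trans (by norm_num) (cosHalfSq_hopf_gt h)

end FootPoint

/-! ### Existence, uniqueness and smoothness of the shooting field -/

section ShootingField

variable {f : S3 → S3} {ε : ℝ}

/-- For `f = id`, the functions of `t` that decide horizontality and the length bound are thus
multiples of sine and cosine; a nearby `f` changes each by at most `ε`. -/
theorem inner_rot_footPoint {u : S2} {q : S3} (h : 0 < cosHalfSq (hopfAmbient q) u) (t : ℝ) :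
    inner ℝ (rot (footPoint u q) t : ℍ[ℝ]) (q : ℍ[ℝ]) = ‖fiberProj u q‖ * Real.cos t ∧
    inner ℝ (rot (footPoint u q) t : ℍ[ℝ]) (q * quatI) = ‖fiberProj u q‖ * Real.sin t := by
  have e : (rot (footPoint u q) t : ℍ[ℝ]) = Real.cos t • (footPoint u q : ℍ[ℝ])
      + Real.sin t • ((footPoint u q : ℍ[ℝ]) * quatI) := by
    rw [coe_rot, expI_eq, mul_add, mul_smul_comm, mul_smul_comm, mul_one]
  have h1 := inner_footPoint h
  have h2 := inner_footPoint_mul_quatI h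
  have h3 : inner ℝ (footPoint u q : ℍ[ℝ]) ((q : ℍ[ℝ]) * quatI) = 0 := by
    rw [inner_mul_quatI_left] at h2; linarith
  rw [e]
  simp only [inner_add_left, inner_smul_left, h1, h2, h3, inner_mul_quatI_mul_quatI]
  simp
  constructor <;> ring

theorem abs_inner_sub_le {a b c : ℍ[ℝ]} (hc : ‖c‖ = 1) (h : ‖a - b‖ ≤ ε) :
    |inner ℝ a c - inner ℝ b c| ≤ ε := by
  rw [← inner_sub_left]
  refine (abs_real_inner_le_norm _ _).trans ?_
  rwa [hc, mul_one]

theorem half_le_cos {t : ℝ} (ht : |t| ≤ Real.pi / 3) : 1 / 2 ≤ Real.cos t := by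
  rw [← Real.cos_abs, ← Real.cos_pi_div_three]
  exact Real.cos_le_cos_of_nonneg_of_le_pi (abs_nonneg t) (by linarith [Real.pi_pos]) ht

theorem half_lt_cos {t : ℝ} (ht : |t| ≤ Real.pi) (h : 1 / 2 < Real.cos t) :
    |t| < Real.pi / 3 := by
  by_contra hcon
  have := Real.cos_le_cos_of_nonneg_of_le_pi (by positivity) ht (not_lt.1 hcon)
  rw [Real.cos_abs, Real.cos_pi_div_three] at this
  linarith

theorem norm_fiberProj_gt {u : S2} {q : S3} (hu : dist (hopf q) u < 1 / 2) :
    9 / 10 < ‖fiberProj u q‖ ∧ ‖fiberProj u q‖ ≤ 1 := by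
  have h1 : 15 / 16 < cosHalfSq (hopfAmbient q) u := cosHalfSq_hopf_gt hu
  have h3 : cosHalfSq (hopfAmbient q) u ≤ 1 := by
    rw [← coe_hopf, cosHalfSq_eq_dist]
    nlinarith [sq_nonneg (dist (hopf q) u)]
  rw [← norm_fiberProj_sq] at h1 h3
  constructor <;> nlinarith [norm_nonneg (fiberProj u q)]

/-- The equation for the parameter of the end point of the shooting vector. -/
noncomputable def shootEq (f : S3 → S3) (u : S2) (q : S3) (t : ℝ) : ℝ :=
  inner ℝ (f (rot (footPoint u q) t) : ℍ[ℝ]) (q * quatI)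

/-- The derivative is within `ε ≤ 1/10` of `‖Πq‖ cos t`, which is at least `0.9 · 0.5` on this
interval. -/
theorem C1NearId.shootEq_deriv_pos (h : C1NearId f ε) (hf : ContMDiff (𝓡 3) (𝓡 3) ∞ f)
    (hε : ε ≤ 1 / 10) {u : S2} {q : S3} (hu : dist (hopf q) u < 1 / 2) {t : ℝ}
    (ht : |t| ≤ Real.pi / 3) : ∃ d, 0 < d ∧ HasDerivAt (shootEq f u q) d t := by
  have hm : 0 < cosHalfSq (hopfAmbient q) u := cosHalfSq_hopf_pos hu
  have hd : HasDerivAt (shootEq f u q) _ t :=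
    (hasDerivAt_comp_rot hf (footPoint u q) t).inner ℝ
      (hasDerivAt_const t ((q : ℍ[ℝ]) * quatI))
  refine ⟨_, ?_, hd⟩
  have h1 := abs_inner_sub_le (c := (q : ℍ[ℝ]) * quatI) (by rw [norm_mul_quatI, norm_coe_S3])
    (h.norm_fderiv_sub_le hf (rot (footPoint u q) t))
  rw [inner_mul_quatI_mul_quatI, (inner_rot_footPoint hm t).1] at h1
  have h2 := half_le_cos ht
  have h3 := (norm_fiberProj_gt hu).1
  simp only [inner_zero_right, zero_add]
  have := (abs_le.1 h1).1
  nlinarith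

/-- Existence and uniqueness of the parameter of the end point of the shooting vector. -/
theorem C1NearId.exists_shootEq (h : C1NearId f ε) (hf : ContMDiff (𝓡 3) (𝓡 3) ∞ f)
    (hε : ε ≤ 1 / 10) {u : S2} {q : S3} (hu : dist (hopf q) u < 1 / 2) :
    ∃ T : ℝ, |T| < Real.pi / 3 ∧ shootEq f u q T = 0 ∧
      (∀ t, |t| < Real.pi / 3 → shootEq f u q t = 0 → t = T) ∧
      0 < inner ℝ (q : ℍ[ℝ]) (f (rot (footPoint u q) T) : ℍ[ℝ]) ∧
      ∀ y ∈ f '' fiber u, inner ℝ ((q : ℍ[ℝ]) * quatI) (y : ℍ[ℝ]) = 0 →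
        0 < inner ℝ (q : ℍ[ℝ]) (y : ℍ[ℝ]) → y = f (rot (footPoint u q) T) := by
  have hm : 0 < cosHalfSq (hopfAmbient q) u := cosHalfSq_hopf_pos hu
  obtain ⟨hk, hk1⟩ := norm_fiberProj_gt hu
  have hpi := Real.pi_pos
  have hg : ∀ t, |shootEq f u q t - ‖fiberProj u q‖ * Real.sin t| ≤ ε := fun t => by
    rw [← (inner_rot_footPoint hm t).2]
    exact abs_inner_sub_le (by rw [norm_mul_quatI, norm_coe_S3]) (h.1 _).le
  have ha : ∀ t, |inner ℝ (f (rot (footPoint u q) t) : ℍ[ℝ]) (q : ℍ[ℝ])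
      - ‖fiberProj u q‖ * Real.cos t| ≤ ε := fun t => by
    rw [← (inner_rot_footPoint hm t).1]
    exact abs_inner_sub_le (norm_coe_S3 q) (h.1 _).le
  have hmono : StrictMonoOn (shootEq f u q) (Set.Icc (-(Real.pi / 3)) (Real.pi / 3)) := by
    refine strictMonoOn_of_deriv_pos (convex_Icc _ _) (fun t ht => ?_) fun t ht => ?_
    · obtain ⟨d, -, hd⟩ := h.shootEq_deriv_pos hf hε hu (abs_le.2 ht)
      exact hd.continuousAt.continuousWithinAt
    · have ht' : t ∈ Set.Icc (-(Real.pi / 3)) (Real.pi / 3) := interior_subset ht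
      obtain ⟨d, hd0, hd⟩ := h.shootEq_deriv_pos hf hε hu (abs_le.2 ht')
      rwa [hd.deriv]
  -- At the endpoints `‖Πq‖ |sin t|` is at least `0.9 · 0.8`, so an error of `ε` cannot change the
  -- sign there.
  have hs3 : 8 / 10 ≤ Real.sin (Real.pi / 3) := by
    rw [Real.sin_pi_div_three]
    have : (1.6 : ℝ) ≤ √3 := Real.le_sqrt_of_sq_le (by norm_num)
    linarith
  have hle : -(Real.pi / 3) ≤ Real.pi / 3 := by linarith
  have hcont : ContinuousOn (shootEq f u q) (Set.Icc (-(Real.pi / 3)) (Real.pi / 3)) := by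
    intro t ht
    obtain ⟨d, -, hd⟩ := h.shootEq_deriv_pos hf hε hu (abs_le.2 ht)
    exact hd.continuousAt.continuousWithinAt
  have hpos : 0 < shootEq f u q (Real.pi / 3) := by
    have := (abs_le.1 (hg (Real.pi / 3))).1
    nlinarith
  have hneg : shootEq f u q (-(Real.pi / 3)) < 0 := by
    have := (abs_le.1 (hg (-(Real.pi / 3)))).2
    rw [Real.sin_neg] at this
    nlinarith
  obtain ⟨T, hT, hT0⟩ := intermediate_value_Icc hle hcont ⟨hneg.le, hpos.le⟩
  have hTlt : |T| < Real.pi / 3 := by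
    refine abs_lt.2 ⟨lt_of_le_of_ne hT.1 fun he => ?_, lt_of_le_of_ne hT.2 fun he => ?_⟩
    · rw [← he] at hT0; exact hneg.ne hT0
    · rw [he] at hT0; exact hpos.ne' hT0
  have huniq : ∀ t, |t| < Real.pi / 3 → shootEq f u q t = 0 → t = T := fun t ht ht0 =>
    hmono.injOn (abs_le.1 ht.le) hT (by rw [ht0, hT0])
  refine ⟨T, hTlt, hT0, huniq, ?_, ?_⟩
  · have h1 := (abs_le.1 (ha T)).1
    have h2 := half_le_cos hTlt.le
    rw [real_inner_comm]
    nlinarith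
  · rintro _ ⟨s, hs, rfl⟩ h1 h2
    obtain ⟨t₀, rfl⟩ := (hopf_eq_iff (footPoint u q) s).1 (by rw [hopf_footPoint hm]; exact hs)
    obtain ⟨t, ht, hrt⟩ : ∃ t, |t| ≤ Real.pi ∧ rot (footPoint u q) t₀ = rot (footPoint u q) t := by
      obtain ⟨n, hn, -⟩ := existsUnique_add_zsmul_mem_Ioc Real.two_pi_pos t₀ (-Real.pi)
      refine ⟨t₀ + n • (2 * Real.pi), abs_le.2 ⟨hn.1.le, by linarith [hn.2]⟩, ?_⟩
      apply Subtype.ext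
      rw [coe_rot, coe_rot, expI, expI, zsmul_eq_mul, Real.cos_add_int_mul_two_pi,
        Real.sin_add_int_mul_two_pi]
    rw [hrt] at h1 h2 ⊢
    rw [real_inner_comm] at h1 h2
    have h3 := abs_le.1 (ha t)
    have h4 := abs_le.1 (hg t)
    have h5 : shootEq f u q t = 0 := h1
    rw [h5] at h4
    have hsc := Real.sin_sq_add_cos_sq t
    -- Uniqueness on the whole fiber: division by `‖Πq‖ > 0.9` turns the error `ε` into less than
    -- `1/8`. So `|sin t| < 1/8` and `cos t > -1/8`, which leaves only `cos t` close to `1`, inside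
    -- the interval of monotonicity.
    have hcos : 1 / 2 < Real.cos t := by
      have h6 : -(1 / 8) < Real.cos t := by
        by_contra hcon
        nlinarith
      have h7 : Real.sin t < 1 / 8 := by
        by_contra hcon
        nlinarith
      have h8 : -(1 / 8) < Real.sin t := by
        by_contra hcon
        nlinarith
      by_contra hcon
      nlinarith
    rw [huniq t (half_lt_cos ht hcos) h5]

open Classical in
/-- The parameter of the end point of the shooting vector from `q` to the image of the fiber. -/
noncomputable def shootParam (f : S3 → S3) (u : S2) (q : S3) : ℝ :=
  if h : ∃ T : ℝ, |T| < Real.pi / 3 ∧ shootEq f u q T = 0 ∧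
      (∀ t, |t| < Real.pi / 3 → shootEq f u q t = 0 → t = T) ∧
      0 < inner ℝ (q : ℍ[ℝ]) (f (rot (footPoint u q) T) : ℍ[ℝ]) ∧
      ∀ y ∈ f '' fiber u, inner ℝ ((q : ℍ[ℝ]) * quatI) (y : ℍ[ℝ]) = 0 →
        0 < inner ℝ (q : ℍ[ℝ]) (y : ℍ[ℝ]) → y = f (rot (footPoint u q) T)
  then h.choose else 0

theorem C1NearId.shootParam_spec (h : C1NearId f ε) (hf : ContMDiff (𝓡 3) (𝓡 3) ∞ f)
    (hε : ε ≤ 1 / 10) {u : S2} {q : S3} (hu : dist (hopf q) u < 1 / 2) :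
    |shootParam f u q| < Real.pi / 3 ∧ shootEq f u q (shootParam f u q) = 0 ∧
      (∀ t, |t| < Real.pi / 3 → shootEq f u q t = 0 → t = shootParam f u q) ∧
      0 < inner ℝ (q : ℍ[ℝ]) (f (rot (footPoint u q) (shootParam f u q)) : ℍ[ℝ]) ∧
      ∀ y ∈ f '' fiber u, inner ℝ ((q : ℍ[ℝ]) * quatI) (y : ℍ[ℝ]) = 0 →
        0 < inner ℝ (q : ℍ[ℝ]) (y : ℍ[ℝ]) → y = f (rot (footPoint u q) (shootParam f u q)) := by
  have hex := h.exists_shootEq hf hε hu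
  rw [shootParam, dif_pos hex]
  exact hex.choose_spec

/-- The shooting field from the fibers near `fiber u` to the image of `fiber u` under `f`. -/
noncomputable def shootField (f : S3 → S3) (u : S2) (q : S3) : ℍ[ℝ] :=
  shootVec q (f (rot (footPoint u q) (shootParam f u q)))

theorem C1NearId.isShootingVector_iff_eq (h : C1NearId f ε) (hf : ContMDiff (𝓡 3) (𝓡 3) ∞ f)
    (hε : ε ≤ 1 / 10) {u : S2} {q : S3} (hu : dist (hopf q) u < 1 / 2) (w : ℍ[ℝ]) :
    IsShootingVector (f '' fiber u) q w ↔ w = shootField f u q := by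
  have hm : 0 < cosHalfSq (hopfAmbient q) u := cosHalfSq_hopf_pos hu
  obtain ⟨-, h2, -, h4, h5⟩ := h.shootParam_spec hf hε hu
  rw [isShootingVector_iff]
  constructor
  · rintro ⟨y, hy, h6, h7, rfl⟩
    rw [h5 y hy h6 h7, shootField]
  · rintro rfl
    refine ⟨_, ⟨rot (footPoint u q) (shootParam f u q), ?_, rfl⟩, ?_, h4, rfl⟩
    · change hopf _ = u
      rw [hopf_rot, hopf_footPoint hm]
    · rw [real_inner_comm]; exact h2

theorem isInvertible_of_apply_one_ne_zero {L : ℝ →L[ℝ] ℝ} (h : L 1 ≠ 0) : L.IsInvertible := by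
  refine ⟨ContinuousLinearEquiv.unitsEquivAut ℝ (Units.mk0 (L 1) h), ?_⟩
  ext
  simp

/-- The point of the image of the fiber with a given parameter. -/
noncomputable def shootEnd (f : S3 → S3) (w : (E3 × ℍ[ℝ]) × ℝ) : ℍ[ℝ] :=
  ambientExt f ((footPoint w.1.1 w.1.2 : ℍ[ℝ]) * expI w.2)

theorem shootEnd_coe (f : S3 → S3) (u : S2) (q : S3) (t : ℝ) :
    shootEnd f (((u : E3), (q : ℍ[ℝ])), t) = f (rot (footPoint u q) t) :=
  ambientExt_coe f (rot (footPoint u q) t)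

theorem contDiffAt_shootEnd (hf : ContMDiff (𝓡 3) (𝓡 3) ∞ f) {u : S2} {q : S3}
    (hm : 0 < cosHalfSq (hopfAmbient q) u) (T : ℝ) :
    ContDiffAt ℝ ∞ (shootEnd f) (((u : E3), (q : ℍ[ℝ])), T) := by
  have hfoot : ContDiffAt ℝ ∞ (fun w : E3 × ℍ[ℝ] => (footPoint w.1 w.2 : ℍ[ℝ]))
      ((u : E3), (q : ℍ[ℝ])) :=
    ContDiffAt.comp (g := fun q => (toS3 q : ℍ[ℝ])) (f := fun w : E3 × ℍ[ℝ] => fiberProj w.1 w.2)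
      ((u : E3), (q : ℍ[ℝ])) (contDiffAt_coe_toS3 (fiberProj_ne_zero hm))
      contDiff_fiberProj.contDiffAt
  have hprod : ContDiffAt ℝ ∞
      (fun w : (E3 × ℍ[ℝ]) × ℝ => (footPoint w.1.1 w.1.2 : ℍ[ℝ]) * expI w.2)
      (((u : E3), (q : ℍ[ℝ])), T) :=
    (ContDiffAt.comp (g := fun w : E3 × ℍ[ℝ] => (footPoint w.1 w.2 : ℍ[ℝ])) (f := Prod.fst)
      (((u : E3), (q : ℍ[ℝ])), T) hfoot contDiffAt_fst).mul
      (contDiff_expI.contDiffAt.comp _ contDiffAt_snd)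
  exact ContDiffAt.comp (g := ambientExt f)
    (f := fun w : (E3 × ℍ[ℝ]) × ℝ => (footPoint w.1.1 w.1.2 : ℍ[ℝ]) * expI w.2)
    (((u : E3), (q : ℍ[ℝ])), T)
    (contDiffAt_ambientExt hf (coe_S3_ne_zero (rot (footPoint u q) T))) hprod

/-- `shootParam` is chosen point by point. The implicit function theorem gives a smooth local
solution, and the open condition `|φ| < π/3` is what allows uniqueness to identify it with
`shootParam` at nearby points. -/
theorem C1NearId.exists_implicit_shootParam (h : C1NearId f ε)
    (hf : ContMDiff (𝓡 3) (𝓡 3) ∞ f) (hε : ε ≤ 1 / 10) {u : S2} {q : S3}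
    (hu : dist (hopf q) u < 1 / 2) :
    ∃ φ : E3 × ℍ[ℝ] → ℝ, ContDiffAt ℝ ∞ φ ((u : E3), (q : ℍ[ℝ])) ∧
      φ ((u : E3), (q : ℍ[ℝ])) = shootParam f u q ∧
      ∀ᶠ w in 𝓝 ((u : E3), (q : ℍ[ℝ])), |φ w| < Real.pi / 3 ∧
        inner ℝ (shootEnd f (w, φ w)) (w.2 * quatI) = 0 := by
  have hm : 0 < cosHalfSq (hopfAmbient q) u := cosHalfSq_hopf_pos hu
  obtain ⟨hT1, hT2, -, -, -⟩ := h.shootParam_spec hf hε hu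
  obtain ⟨T, hTdef⟩ : ∃ T, T = shootParam f u q := ⟨_, rfl⟩
  rw [← hTdef] at hT1 hT2 ⊢
  obtain ⟨G, hGdef⟩ : ∃ G : (E3 × ℍ[ℝ]) × ℝ → ℝ,
    G = fun w => inner ℝ (shootEnd f w) (w.1.2 * quatI) := ⟨_, rfl⟩
  have hG : ContDiffAt ℝ ∞ G (((u : E3), (q : ℍ[ℝ])), T) := by
    rw [hGdef]
    exact (contDiffAt_shootEnd hf hm T).inner ℝ (ContDiffAt.mul (by fun_prop) contDiffAt_const)
  have hGcoe : ∀ t : ℝ, G (((u : E3), (q : ℍ[ℝ])), t) = shootEq f u q t := fun t => by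
    simp only [hGdef, shootEnd_coe, shootEq]
  have hinv : ((fderiv ℝ G (((u : E3), (q : ℍ[ℝ])), T)).comp
      (.inr ℝ (E3 × ℍ[ℝ]) ℝ)).IsInvertible := by
    obtain ⟨d, hd0, hd⟩ := h.shootEq_deriv_pos hf hε hu hT1.le
    have h1 : HasFDerivAt (fun t => G (((u : E3), (q : ℍ[ℝ])), t)) _ T :=
      (hG.differentiableAt (by simp)).hasFDerivAt.comp T
        (hasFDerivAt_prodMk_right ((u : E3), (q : ℍ[ℝ])) T)
    simp only [hGcoe] at h1
    refine isInvertible_of_apply_one_ne_zero ?_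
    have h2 := h1.unique hd.hasFDerivAt
    rw [h2]
    simpa using hd0.ne'
  have hφ : ContDiffAt ℝ ∞ (hG.implicitFunction (by simp) hinv) ((u : E3), (q : ℍ[ℝ])) :=
    hG.contDiffAt_implicitFunction (by simp) hinv
  have hφ0 : hG.implicitFunction (by simp) hinv ((u : E3), (q : ℍ[ℝ])) = T :=
    hG.implicitFunction_apply_self (by simp) hinv
  have hφG := hG.eventually_apply_implicitFunction (by simp) hinv
  rw [hGcoe, hT2] at hφG
  refine ⟨hG.implicitFunction (by simp) hinv, hφ, hφ0, ?_⟩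
  have hlt : ∀ᶠ t in 𝓝 T, |t| < Real.pi / 3 :=
    continuous_abs.continuousAt.eventually (gt_mem_nhds hT1)
  rw [← hφ0] at hlt
  filter_upwards [hφ.continuousAt.eventually hlt, hφG] with w hw1 hw2
  refine ⟨hw1, ?_⟩
  exact (congrFun hGdef _).symm.trans hw2

theorem contMDiff_coe_S2 : ContMDiff (𝓡 2) 𝓘(ℝ, E3) ∞ (fun x : S2 => (x : E3)) :=
  have : Fact (Module.finrank ℝ E3 = 2 + 1) := ⟨finrank_euclideanSpace_fin⟩
  contMDiff_coe_sphere (n := 2)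

theorem continuous_hopf : Continuous hopf :=
  (contDiff_hopfAmbient.continuous.comp continuous_subtype_val).subtype_mk _

theorem isOpen_dist_hopf_lt (r : ℝ) : IsOpen {z : S2 × S3 | dist (hopf z.2) z.1 < r} :=
  isOpen_lt ((continuous_hopf.comp continuous_snd).dist continuous_fst) continuous_const

theorem C1NearId.contMDiffAt_shootField (h : C1NearId f ε) (hf : ContMDiff (𝓡 3) (𝓡 3) ∞ f)
    (hε : ε ≤ 1 / 10) {u₀ : S2} {q₀ : S3} (hu : dist (hopf q₀) u₀ < 1 / 2) :
    ContMDiffAt ((𝓡 2).prod (𝓡 3)) 𝓘(ℝ, ℍ[ℝ]) ∞ (fun z : S2 × S3 => shootField f z.1 z.2)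
      (u₀, q₀) := by
  have hm : 0 < cosHalfSq (hopfAmbient q₀) u₀ := cosHalfSq_hopf_pos hu
  obtain ⟨φ, hφ, hφ0, hev⟩ := h.exists_implicit_shootParam hf hε hu
  have hF : ContDiffAt ℝ ∞ (fun w : E3 × ℍ[ℝ] => shootEnd f (w, φ w))
      ((u₀ : E3), (q₀ : ℍ[ℝ])) :=
    ContDiffAt.comp (g := shootEnd f) (f := fun w => (w, φ w)) _ (contDiffAt_shootEnd hf hm _)
      (contDiffAt_id.prodMk hφ)
  have hamb : ContDiffAt ℝ ∞ (fun w : E3 × ℍ[ℝ] => shootVec w.2 (shootEnd f (w, φ w)))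
      ((u₀ : E3), (q₀ : ℍ[ℝ])) := by
    refine ContDiffAt.comp (g := fun w : ℍ[ℝ] × ℍ[ℝ] => shootVec w.1 w.2)
      (f := fun w : E3 × ℍ[ℝ] => (w.2, shootEnd f (w, φ w))) _ (contDiffAt_shootVec ?_)
      (contDiffAt_snd.prodMk hF)
    rw [hφ0, shootEnd_coe]
    exact (h.shootParam_spec hf hε hu).2.2.2.1
  have hcoe : ContMDiff ((𝓡 2).prod (𝓡 3)) 𝓘(ℝ, E3 × ℍ[ℝ]) ∞
      (fun z : S2 × S3 => ((z.1 : E3), (z.2 : ℍ[ℝ]))) :=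
    (contMDiff_coe_S2.comp contMDiff_fst).prodMk_space
      ((contMDiff_coe_sphere (n := 3)).comp contMDiff_snd)
  have hcomp := ContMDiffAt.comp (g := fun w : E3 × ℍ[ℝ] => shootVec w.2 (shootEnd f (w, φ w)))
    (u₀, q₀) hamb.contMDiffAt hcoe.contMDiffAt
  refine hcomp.congr_of_eventuallyEq ?_
  have hc := hcoe.continuous.continuousAt (x := (u₀, q₀))
  have hmem : (u₀, q₀) ∈ {z : S2 × S3 | dist (hopf z.2) z.1 < 1 / 2} := by exact hu
  have hdist := (isOpen_dist_hopf_lt (1 / 2)).mem_nhds hmem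
  have hev' : ∀ᶠ z : S2 × S3 in 𝓝 (u₀, q₀), |φ ((z.1 : E3), (z.2 : ℍ[ℝ]))| < Real.pi / 3 ∧
      inner ℝ (shootEnd f (((z.1 : E3), (z.2 : ℍ[ℝ])), φ ((z.1 : E3), (z.2 : ℍ[ℝ]))))
        ((z.2 : ℍ[ℝ]) * quatI) = 0 := Filter.Tendsto.eventually (f := fun z : S2 × S3 =>
          ((z.1 : E3), (z.2 : ℍ[ℝ]))) hc hev
  filter_upwards [hev', hdist] with z hz hz3
  have hz1 : |φ ((z.1 : E3), (z.2 : ℍ[ℝ]))| < Real.pi / 3 := hz.1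
  have hz2 : shootEq f z.1 z.2 (φ ((z.1 : E3), (z.2 : ℍ[ℝ]))) = 0 := by
    rw [shootEq, ← shootEnd_coe]; exact hz.2
  have hz4 := (h.shootParam_spec hf hε hz3).2.2.1 _ hz1 hz2
  change shootVec z.2 _ = shootVec z.2 (shootEnd f (((z.1 : E3), (z.2 : ℍ[ℝ])),
    φ ((z.1 : E3), (z.2 : ℍ[ℝ]))))
  rw [hz4, shootEnd_coe]

end ShootingField

/-! ### Angular lift of a curve in the plane of a fiber -/

section Lift

theorem expI_mul_quatI (t : ℝ) : expI t * quatI = quatI * expI t := by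
  ext <;> simp [expI, quatI]

/-- The product `n(t) e^{-iφ(t)}` has zero derivative. -/
theorem eq_mul_expI_of_hasDerivAt {n : ℝ → ℍ[ℝ]} {φ J : ℝ → ℝ}
    (hn : ∀ t, HasDerivAt n (J t • (n t * quatI)) t) (hφ : ∀ t, HasDerivAt φ (J t) t)
    (hφ0 : φ 0 = 0) (t : ℝ) : n t = n 0 * expI (φ t) := by
  have hd : ∀ t, HasDerivAt (fun t => n t * expI (-φ t)) 0 t := fun t => by
    have h1 : HasDerivAt (fun t => expI (-φ t)) ((-J t) • (expI (-φ t) * quatI)) t :=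
      HasDerivAt.scomp (g₁ := expI) t (hasDerivAt_expI (-φ t)) (hφ t).neg
    refine ((hn t).mul h1).congr_deriv ?_
    rw [expI_mul_quatI, smul_mul_assoc, mul_smul_comm, neg_smul, mul_assoc]
    abel
  have hconst := is_const_of_deriv_eq_zero (fun t => (hd t).differentiableAt)
    (fun t => (hd t).deriv) t 0
  simp only [hφ0, neg_zero, expI_zero, mul_one] at hconst
  rw [← hconst, mul_assoc, expI_mul_expI, neg_add_cancel, expI_zero, mul_one]

theorem hasDerivAt_normalize {q : ℝ → ℍ[ℝ]} {w : ℍ[ℝ]} {t : ℝ} (hq : HasDerivAt q w t)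
    (h0 : q t ≠ 0) :
    HasDerivAt (fun t => ‖q t‖⁻¹ • q t)
      ((‖q t‖⁻¹ ^ 3) • (‖q t‖ ^ 2 • w - inner ℝ w (q t) • q t)) t := by
  have hn0 : ‖q t‖ ≠ 0 := norm_ne_zero_iff.2 h0
  have h1 : HasDerivAt (fun t => ‖q t‖) (‖q t‖⁻¹ * inner ℝ w (q t)) t := by
    have h2 := hq.norm_sq.sqrt (by positivity)
    simp only [Real.sqrt_sq (norm_nonneg _)] at h2
    refine h2.congr_deriv ?_
    rw [real_inner_comm]
    field_simp
  have h3 := (h1.inv hn0).smul hq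
  refine h3.congr_deriv ?_
  rw [smul_sub, smul_smul, smul_smul, Pi.inv_apply, sub_eq_add_neg, ← neg_smul]
  congr 1
  · congr 1; field_simp
  · congr 1; field_simp

theorem hasDerivAt_fiberProj (x : E3) {y : ℝ → ℍ[ℝ]} {y' : ℍ[ℝ]} {t : ℝ}
    (h : HasDerivAt y y' t) : HasDerivAt (fun t => fiberProj x (y t)) (fiberProj x y') t :=
  (h.sub ((h.const_mul (imQ x)).mul_const quatI)).const_smul (1 / 2 : ℝ)

end Lift

/-! ### Pulling integrals over a fiber back to the source fiber -/

section ChangeOfVariables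

variable {f : S3 → S3} {ε : ℝ}

theorem jet_coe_fst (f : S3 → S3) (q : S3) : (jet f q).1 = hopf (f q) := by
  rw [jet, ambientExt_coe]; rfl

theorem C1NearId.dist_hopf_le (h : C1NearId f ε) (hf : ContMDiff (𝓡 3) (𝓡 3) ∞ f) (q : S3) :
    dist (hopf (f q)) (hopf q) ≤ 2 * ε := by
  have h1 : dist (jet f q).1 (hopf q : E3) ≤ 2 * ε :=
    (le_max_left _ _).trans (h.dist_jet_le hf q)
  rwa [jet_coe_fst] at h1

theorem C1NearId.dist_hopf_lt (h : C1NearId f ε) (hf : ContMDiff (𝓡 3) (𝓡 3) ∞ f)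
    (hε : ε ≤ 1 / 40) {u x : S2} (hx : dist x u < 1 / 4) {q : S3} (hq : hopf q = u) :
    dist (hopf (f q)) x < 1 / 2 := by
  have h1 := h.dist_hopf_le hf q
  have h2 := dist_triangle (hopf (f q)) (hopf q) x
  rw [hq] at h1 h2
  rw [dist_comm u x] at h2
  linarith

/-- For `f = id` the density is `1`. Crude bounds suffice: they serve to fix the winding number in
`C1NearId.arcLift_two_pi`. -/
theorem C1NearId.arcDensity_mem (h : C1NearId f ε) (hf : ContMDiff (𝓡 3) (𝓡 3) ∞ f)
    (hε : ε ≤ 1 / 40) {u x : S2} (hx : dist x u < 1 / 4) {q : S3} (hq : hopf q = u) :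
    arcDensity (jet f q) x ∈ Set.Icc (1 / 2 : ℝ) (3 / 2) := by
  have h1 := h.dist_jet_le hf q
  have hα : |(jet f q).2.1 - 1| ≤ 2 * ε :=
    ((le_max_left _ _).trans (le_max_right _ _)).trans h1
  have hβ : dist (jet f q).2.2 (hopf q : E3) ≤ 2 * ε :=
    ((le_max_right _ _).trans (le_max_right _ _)).trans h1
  have hi : |inner ℝ (jet f q).2.2 (x : E3) - inner ℝ (u : E3) (x : E3)| ≤ 2 * ε := by
    rw [← inner_sub_left]
    refine (abs_real_inner_le_norm _ _).trans ?_
    rw [norm_coe_S2, mul_one, ← dist_eq_norm, ← hq]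
    exact hβ
  have hux : inner ℝ (u : E3) (x : E3) = 1 - dist x u ^ 2 / 2 := by
    have := cosHalfSq_eq_dist u x
    rw [cosHalfSq, dist_comm] at this
    linarith
  have hm := cosHalfSq_hopf_gt (h.dist_hopf_lt hf hε hx hq)
  have hm1 : cosHalfSq (hopfAmbient (f q)) x ≤ 1 := by
    rw [← coe_hopf, cosHalfSq_eq_dist]
    nlinarith [sq_nonneg (dist (hopf (f q)) x)]
  rw [arcDensity, jet_coe_fst, coe_hopf]
  have hα' := abs_le.1 hα
  have hi' := abs_le.1 hi
  have hd := dist_nonneg (x := x) (y := u)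
  constructor
  · rw [le_div_iff₀ (by linarith)]
    nlinarith
  · rw [div_le_iff₀ (by linarith)]
    nlinarith

theorem arcDensity_jet (f : S3 → S3) {x : S2} {q : S3} :
    arcDensity (jet f q) x * ‖fiberProj x (f q)‖ ^ 2
      = inner ℝ (fiberProj x (fderiv ℝ (ambientExt f) (q : ℍ[ℝ]) (q * quatI)))
        (fiberProj x (f q) * quatI) ∨ fiberProj x (f q) = 0 := by
  by_cases h0 : fiberProj x (f q) = 0
  · exact Or.inr h0
  left
  have hn : 0 < ‖fiberProj x (f q)‖ ^ 2 := pow_pos (norm_pos_iff.2 h0) 2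
  rw [inner_fiberProj_jetOf, ← ambientExt_coe f q]
  change (_ : ℝ) = ((jet f q).2.1 + inner ℝ (jet f q).2.2 (x : E3)) / 2
  rw [ambientExt_coe]
  have hm := norm_fiberProj_sq x (f q)
  rw [arcDensity, jet_coe_fst, coe_hopf, ← hm]
  field_simp

theorem continuous_jet_rot (hf : ContMDiff (𝓡 3) (𝓡 3) ∞ f) (s : S3) :
    Continuous fun t => jet f (rot s t) :=
  continuous_iff_continuousAt.2 fun t =>
    ContinuousAt.comp (g := jet f) (f := fun t => (rot s t : ℍ[ℝ]))
      (contDiffAt_jet hf (coe_S3_ne_zero (rot s t))).continuousAt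
      (contDiff_coe_rot s).continuous.continuousAt

/-- The arc length along the fiber over `x` of the projection of the image of a fiber. -/
noncomputable def arcLift (f : S3 → S3) (x : S2) (s : S3) (t : ℝ) : ℝ :=
  ∫ τ in (0 : ℝ)..t, arcDensity (jet f (rot s τ)) x

theorem C1NearId.continuous_arcDensity (h : C1NearId f ε) (hf : ContMDiff (𝓡 3) (𝓡 3) ∞ f)
    (hε : ε ≤ 1 / 40) {x : S2} {s : S3} (hx : dist x (hopf s) < 1 / 4) :
    Continuous fun t => arcDensity (jet f (rot s t)) x :=
  continuous_iff_continuousAt.2 fun t => by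
    have hm := cosHalfSq_hopf_pos (h.dist_hopf_lt hf hε hx (hopf_rot s t))
    rw [← coe_hopf, ← jet_coe_fst] at hm
    exact ContinuousAt.comp (g := fun w : JetData × E3 => arcDensity w.1 w.2)
      (f := fun t => (jet f (rot s t), (x : E3))) (contDiffAt_arcDensity hm).continuousAt
      (((continuous_jet_rot hf s).prodMk continuous_const).continuousAt)

theorem C1NearId.hasDerivAt_arcLift (h : C1NearId f ε) (hf : ContMDiff (𝓡 3) (𝓡 3) ∞ f)
    (hε : ε ≤ 1 / 40) {x : S2} {s : S3} (hx : dist x (hopf s) < 1 / 4) (t : ℝ) :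
    HasDerivAt (arcLift f x s) (arcDensity (jet f (rot s t)) x) t :=
  intervalIntegral.integral_hasDerivAt_right
    ((h.continuous_arcDensity hf hε hx).intervalIntegrable _ _)
    ((h.continuous_arcDensity hf hε hx).stronglyMeasurableAtFilter _ _)
    (h.continuous_arcDensity hf hε hx).continuousAt

/-- The normalized projection `n` of the image curve stays in the plane of the fiber. Normalization
removes the component of its derivative along `n`, and what remains is `J n i` with `J` the angular
speed computed from the jet. -/
theorem C1NearId.footPoint_eq_rot (h : C1NearId f ε) (hf : ContMDiff (𝓡 3) (𝓡 3) ∞ f)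
    (hε : ε ≤ 1 / 40) {x : S2} {s : S3} (hx : dist x (hopf s) < 1 / 4) (t : ℝ) :
    footPoint x (f (rot s t)) = rot (footPoint x (f s)) (arcLift f x s t) := by
  have hpos : ∀ t, 0 < cosHalfSq (hopfAmbient (f (rot s t))) x := fun t =>
    cosHalfSq_hopf_pos (h.dist_hopf_lt hf hε hx (hopf_rot s t))
  apply Subtype.ext
  have key := eq_mul_expI_of_hasDerivAt
    (n := fun t => ‖fiberProj x (f (rot s t))‖⁻¹ • fiberProj x (f (rot s t)))
    (φ := arcLift f x s) (J := fun t => arcDensity (jet f (rot s t)) x) (fun t => ?_)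
    (h.hasDerivAt_arcLift hf hε hx) (by simp [arcLift]) t
  · rw [coe_rot, coe_footPoint (hpos t), key]
    simp only [rot_zero]
    have := hpos 0
    rw [rot_zero] at this
    rw [coe_footPoint this]
  · have h0 := fiberProj_ne_zero (hpos t)
    refine (hasDerivAt_normalize (hasDerivAt_fiberProj x (hasDerivAt_comp_rot hf s t))
      h0).congr_deriv ?_
    have h1 := (arcDensity_jet f (x := x) (q := rot s t)).resolve_right h0
    rw [norm_sq_smul_eq (imQ_mul_fiberProj x (f (rot s t))) (imQ_mul_fiberProj x _), ← h1,
      add_sub_cancel_left, smul_mul_assoc, smul_smul, smul_smul]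
    congr 1
    have := norm_ne_zero_iff.2 h0
    field_simp

/-- The curve of foot points closes up, so the total angle is a multiple of `2π`; the density bounds
confine it to `[π, 3π]`. -/
theorem C1NearId.arcLift_two_pi (h : C1NearId f ε) (hf : ContMDiff (𝓡 3) (𝓡 3) ∞ f)
    (hε : ε ≤ 1 / 40) {x : S2} {s : S3} (hx : dist x (hopf s) < 1 / 4) :
    arcLift f x s (2 * Real.pi) = 2 * Real.pi := by
  have hpi := Real.pi_pos
  have h1 := h.footPoint_eq_rot hf hε hx (2 * Real.pi)
  have h2 : rot s (2 * Real.pi) = s := by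
    have := rot_add_two_pi s 0
    rwa [zero_add, rot_zero] at this
  rw [h2] at h1
  have h3 := congrArg (fun q : S3 => (q : ℍ[ℝ])) h1
  simp only [coe_rot] at h3
  have h4 : expI (arcLift f x s (2 * Real.pi)) = 1 :=
    (mul_eq_left₀ (coe_S3_ne_zero _)).1 h3.symm
  have h5 : Real.cos (arcLift f x s (2 * Real.pi)) = 1 := congrArg (fun q : ℍ[ℝ] => q.re) h4
  obtain ⟨n, hn⟩ := (Real.cos_eq_one_iff _).1 h5
  have hc := h.continuous_arcDensity hf hε hx
  have hJ := fun t => h.arcDensity_mem hf hε hx (hopf_rot s t)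
  have hlo : (1 / 2) * (2 * Real.pi) ≤ arcLift f x s (2 * Real.pi) := by
    have := intervalIntegral.integral_mono_on (a := 0) (b := 2 * Real.pi) (μ := volume)
      (by positivity) (continuous_const.intervalIntegrable _ _) (hc.intervalIntegrable _ _)
      fun t _ => (hJ t).1
    rw [intervalIntegral.integral_const, smul_eq_mul] at this
    rw [arcLift]; linarith
  have hhi : arcLift f x s (2 * Real.pi) ≤ (3 / 2) * (2 * Real.pi) := by
    have := intervalIntegral.integral_mono_on (a := 0) (b := 2 * Real.pi) (μ := volume)
      (by positivity) (hc.intervalIntegrable _ _) (continuous_const.intervalIntegrable _ _)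
      fun t _ => (hJ t).2
    rw [intervalIntegral.integral_const, smul_eq_mul] at this
    rw [arcLift]; linarith
  rw [← hn] at hlo hhi
  have hn1 : n = 1 := by
    have h6 : (0 : ℝ) < n := by
      by_contra hcon
      nlinarith
    have h7 : (n : ℝ) < 2 := by
      by_contra hcon
      nlinarith
    have h6' : 0 < n := by exact_mod_cast h6
    have h7' : n < 2 := by exact_mod_cast h7
    omega
  rw [← hn, hn1]; simp


/-- Integrals along the fiber over `x`, computed along a nearby source fiber. -/
theorem C1NearId.fiberIntegral_eq (h : C1NearId f ε) (hf : ContMDiff (𝓡 3) (𝓡 3) ∞ f)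
    (hε : ε ≤ 1 / 40) {G : Type*} [NormedAddCommGroup G] [NormedSpace ℝ G] [CompleteSpace G]
    {g : S3 → G} {x : S2} {s : S3} (hx : dist x (hopf s) < 1 / 4)
    (hg : ∀ q, hopf q = x → ContinuousAt g q) :
    fiberIntegral g x = ∫ t in (0 : ℝ)..(2 * Real.pi),
      arcDensity (jet f (rot s t)) x • g (footPoint x (f (rot s t))) := by
  have hx0 : hopf (footPoint x (f s)) = x := by
    have := cosHalfSq_hopf_pos (h.dist_hopf_lt hf hε hx rfl)
    exact hopf_footPoint this
  have hgc : Continuous fun t => g (rot (footPoint x (f s)) t) :=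
    continuous_iff_continuousAt.2 fun t =>
      ContinuousAt.comp (g := g) (f := rot (footPoint x (f s)))
        (hg _ (by rw [hopf_rot, hx0])) (continuous_rot _).continuousAt
  have hcv := intervalIntegral.integral_deriv_smul_comp (a := 0) (b := 2 * Real.pi)
    (f := arcLift f x s) (g := fun t => g (rot (footPoint x (f s)) t))
    (fun t _ => h.hasDerivAt_arcLift hf hε hx t) (h.continuous_arcDensity hf hε hx).continuousOn hgc
  rw [h.arcLift_two_pi hf hε hx, show arcLift f x s 0 = 0 by simp [arcLift]] at hcv
  conv_lhs => rw [← hx0]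
  rw [fiberIntegral_hopf, ← hcv]
  refine intervalIntegral.integral_congr fun t _ => ?_
  simp only [Function.comp, h.footPoint_eq_rot hf hε hx t]

/-- The geodesic from the foot point to `f s` is horizontal and shorter than `π/2`, so uniqueness
makes it the shooting geodesic. At such points the implicit parameter is not needed. -/
theorem C1NearId.shootField_footPoint (h : C1NearId f ε) (hf : ContMDiff (𝓡 3) (𝓡 3) ∞ f)
    (hε : ε ≤ 1 / 40) {x : S2} {s : S3} (hx : dist x (hopf s) < 1 / 4) :
    shootField f (hopf s) (footPoint x (f s)) = shootVec (footPoint x (f s)) (f s) := by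
  have hpos := cosHalfSq_hopf_pos (h.dist_hopf_lt hf hε hx rfl)
  have hd : dist (hopf (footPoint x (f s))) (hopf s) < 1 / 2 := by
    rw [hopf_footPoint hpos]; linarith
  refine ((h.isShootingVector_iff_eq hf (by linarith) hd _).1 ?_).symm
  exact isShootingVector_iff.2 ⟨f s, ⟨s, rfl, rfl⟩, inner_footPoint_mul_quatI hpos,
    inner_footPoint_pos hpos, rfl⟩

theorem C1NearId.continuousAt_shootField (h : C1NearId f ε) (hf : ContMDiff (𝓡 3) (𝓡 3) ∞ f)
    (hε : ε ≤ 1 / 40) {u : S2} {q : S3} (hq : dist (hopf q) u < 1 / 4) :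
    ContinuousAt (shootField f u) q :=
  ContinuousAt.comp (g := fun z : S2 × S3 => shootField f z.1 z.2) (f := fun q => (u, q))
    (h.contMDiffAt_shootField hf (by linarith) (by linarith)).continuousAt (by fun_prop)

theorem C1NearId.energy_shootField (h : C1NearId f ε) (hf : ContMDiff (𝓡 3) (𝓡 3) ∞ f)
    (hε : ε ≤ 1 / 40) {x : S2} {s : S3} (hx : dist x (hopf s) < 1 / 4) :
    energy (shootField f (hopf s)) x = (1 / (2 * Real.pi)) •
      ∫ t in (0 : ℝ)..(2 * Real.pi), energyDensity (jet f (rot s t)) x := by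
  rw [energy, smul_eq_mul, h.fiberIntegral_eq hf hε hx]
  · congr 1
    refine intervalIntegral.integral_congr fun t _ => ?_
    have hpos := cosHalfSq_hopf_pos (h.dist_hopf_lt hf hε hx (hopf_rot s t))
    have h1 := h.shootField_footPoint hf hε (s := rot s t) (x := x) (by rwa [hopf_rot])
    rw [hopf_rot] at h1
    simp only [smul_eq_mul]
    -- The squared length has a factor `cosHalfSq` that cancels the denominator of the arc density.
    rw [h1, norm_shootVec_footPoint_sq hpos, arcDensity, energyDensity, jet_coe_fst, coe_hopf]
    field_simp
    ring
  · intro q hq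
    have := h.continuousAt_shootField hf hε (u := hopf s) (q := q) (by rwa [hq])
    exact continuousAt_const.mul (this.norm.pow 2)

theorem C1NearId.average_shootField (h : C1NearId f ε) (hf : ContMDiff (𝓡 3) (𝓡 3) ∞ f)
    (hε : ε ≤ 1 / 40) {x : S2} {s : S3} (hx : dist x (hopf s) < 1 / 4) :
    average (shootField f (hopf s)) x = (1 / (2 * Real.pi)) •
      ∫ t in (0 : ℝ)..(2 * Real.pi), averageDensity (jet f (rot s t)) x := by
  rw [average, h.fiberIntegral_eq hf hε hx]
  · congr 1
    refine intervalIntegral.integral_congr fun t _ => ?_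
    have hpos := cosHalfSq_hopf_pos (h.dist_hopf_lt hf hε hx (hopf_rot s t))
    have h1 := h.shootField_footPoint hf hε (s := rot s t) (x := x) (by rwa [hopf_rot])
    rw [hopf_rot] at h1
    rw [h1, fderiv_hopfAmbient_shootVec hpos, averageDensity, jet_coe_fst, coe_hopf, smul_smul,
      mul_comm]
  · intro q hq
    have h1 := h.continuousAt_shootField hf hε (u := hopf s) (q := q) (by rwa [hq])
    have e : (fun q : S3 => fderiv ℝ hopfAmbient (q : ℍ[ℝ]) (shootField f (hopf s) q))
        = fun q : S3 => vecPart (shootField f (hopf s) q * quatI * star (q : ℍ[ℝ])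
          + (q : ℍ[ℝ]) * quatI * star (shootField f (hopf s) q)) :=
      funext fun q => fderiv_hopfAmbient_apply _ _
    rw [e]
    refine vecPart.continuous.continuousAt.comp ?_
    have hc : ContinuousAt (fun q : S3 => (q : ℍ[ℝ])) q := continuous_subtype_val.continuousAt
    exact ((h1.mul continuousAt_const).mul (continuous_star.continuousAt.comp hc)).add
      ((hc.mul continuousAt_const).mul (continuous_star.continuousAt.comp h1))

end ChangeOfVariables

/-! ### Means over the source fiber -/

section FiberMean

theorem continuous_comp_jet_rot {B : Type} [NormedAddCommGroup B]
    {f : S3 → S3} (hf : ContMDiff (𝓡 3) (𝓡 3) ∞ f) {Θ : JetData × E3 → B}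
    {s : S3} {y : E3} (hΘ : ∀ t, ContinuousAt Θ (jet f (rot s t), y)) :
    Continuous fun t => Θ (jet f (rot s t), y) :=
  continuous_iff_continuousAt.2 fun t =>
    ContinuousAt.comp (g := Θ) (f := fun t => (jet f (rot s t), y)) (hΘ t)
      ((continuous_jet_rot hf s).prodMk continuous_const).continuousAt

variable {B : Type} [NormedAddCommGroup B] [NormedSpace ℝ B] {f : S3 → S3} {ε : ℝ}

/-- The mean over the Hopf fiber over `u` of a function of the jet data of `f`. -/
noncomputable def fiberMean (f : S3 → S3) (Θ : JetData × E3 → B) (u : S2) (y : E3) : B :=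
  (1 / (2 * Real.pi)) • fiberIntegral (fun q => Θ (jet f q, y)) u

theorem fiberMean_hopf (f : S3 → S3) (Θ : JetData × E3 → B) (s : S3) (y : E3) :
    fiberMean f Θ (hopf s) y = (1 / (2 * Real.pi)) •
      ∫ t in (0 : ℝ)..(2 * Real.pi), Θ (jet f (rot s t), y) := by
  rw [fiberMean, fiberIntegral_hopf]

theorem contDiffAt_comp_jet (hf : ContMDiff (𝓡 3) (𝓡 3) ∞ f) {Θ : JetData × E3 → B} {s : S3}
    {y : E3} {t : ℝ} (hΘ : ContDiffAt ℝ ∞ Θ (jet f (rot s t), y)) :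
    ContDiffAt ℝ ∞ (fun w : (ℍ[ℝ] × E3) × ℝ => Θ (jet f (w.1.1 * expI w.2), w.1.2))
      (((s : ℍ[ℝ]), y), t) := by
  have h1 : ContDiffAt ℝ ∞ (fun w : (ℍ[ℝ] × E3) × ℝ => w.1.1 * expI w.2) (((s : ℍ[ℝ]), y), t) :=
    ContDiffAt.mul (by fun_prop) (contDiff_expI.contDiffAt.comp _ contDiffAt_snd)
  have h2 : ContDiffAt ℝ ∞ (fun w : (ℍ[ℝ] × E3) × ℝ => jet f (w.1.1 * expI w.2))
      (((s : ℍ[ℝ]), y), t) :=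
    ContDiffAt.comp (g := jet f) (f := fun w : (ℍ[ℝ] × E3) × ℝ => w.1.1 * expI w.2) _
      (contDiffAt_jet hf (coe_S3_ne_zero (rot s t))) h1
  have h3 : ContDiffAt ℝ ∞ (fun w : (ℍ[ℝ] × E3) × ℝ => (jet f (w.1.1 * expI w.2), w.1.2))
      (((s : ℍ[ℝ]), y), t) := h2.prodMk (by fun_prop)
  exact ContDiffAt.comp (g := Θ)
    (f := fun w : (ℍ[ℝ] × E3) × ℝ => (jet f (w.1.1 * expI w.2), w.1.2)) _ hΘ h3

/-- Fiber means are smooth functions of the fiber and of the parameter. -/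
theorem exists_contDiffAt_fiberMean (hf : ContMDiff (𝓡 3) (𝓡 3) ∞ f) {Θ : JetData × E3 → B}
    {u₀ : S2} {y₀ : E3} (hΘ : ∀ s : S3, hopf s = u₀ → ContDiffAt ℝ ∞ Θ (jet f s, y₀)) :
    ∃ K : E3 × E3 → B, ContDiffAt ℝ ∞ K ((u₀ : E3), y₀) ∧
      ∀ᶠ u : S2 in 𝓝 u₀, ∀ y, K ((u : E3), y) = fiberMean f Θ u y := by
  obtain ⟨s₀, rfl⟩ := hopf_surjective u₀
  have hself : cosHalfSq (hopfAmbient s₀) (hopf s₀) = 1 := cosHalfSq_self (hopf s₀)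
  have hfp : fiberProj (hopf s₀) (s₀ : ℍ[ℝ]) = s₀ :=
    fiberProj_eq_self ((imQ_eq_iff_hopf (hopf s₀) s₀).2 rfl)
  have hfoot0 : footPoint (hopf s₀) (s₀ : ℍ[ℝ]) = s₀ := by rw [footPoint, hfp, toS3_coe]
  let A : ℍ[ℝ] × E3 → B := fun w => (1 / (2 * Real.pi)) •
    ∫ t in (0 : ℝ)..(2 * Real.pi), Θ (jet f (w.1 * expI t), w.2)
  have hA : ContDiffAt ℝ ∞ A ((s₀ : ℍ[ℝ]), y₀) :=
    (contDiffAt_intervalIntegral (Ξ := fun (w : ℍ[ℝ] × E3) t => Θ (jet f (w.1 * expI t), w.2))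
      fun t _ => contDiffAt_comp_jet hf (hΘ _ (hopf_rot s₀ t))).const_smul _
  have hfoot : ContDiffAt ℝ ∞ (fun w : E3 × E3 => (footPoint w.1 (s₀ : ℍ[ℝ]) : ℍ[ℝ]))
      ((hopf s₀ : E3), y₀) :=
    ContDiffAt.comp (g := fun q => (toS3 q : ℍ[ℝ]))
      (f := fun w : E3 × E3 => fiberProj w.1 (s₀ : ℍ[ℝ])) _
      (contDiffAt_coe_toS3 (by rw [hfp]; exact coe_S3_ne_zero s₀))
      (contDiff_fiberProj.comp (f := fun w : E3 × E3 => (w.1, (s₀ : ℍ[ℝ])))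
        (by fun_prop)).contDiffAt
  -- The base points used in `fiberIntegral` need not vary continuously, but the mean does not
  -- depend on them. The foot points of the fixed `s₀` give a smooth local section of the Hopf
  -- fibration.
  refine ⟨fun w => A ((footPoint w.1 (s₀ : ℍ[ℝ]) : ℍ[ℝ]), w.2), ?_, ?_⟩
  · refine ContDiffAt.comp (g := A)
      (f := fun w : E3 × E3 => ((footPoint w.1 (s₀ : ℍ[ℝ]) : ℍ[ℝ]), w.2)) _ ?_
      (hfoot.prodMk contDiffAt_snd)
    rw [hfoot0]
    exact hA
  · have hc : Continuous fun u : S2 => cosHalfSq (hopfAmbient s₀) u :=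
      contDiff_cosHalfSq.continuous.comp (continuous_const.prodMk continuous_subtype_val)
    have hpos : ∀ᶠ u : S2 in 𝓝 (hopf s₀), 0 < cosHalfSq (hopfAmbient s₀) u :=
      (isOpen_lt continuous_const hc).mem_nhds (by
        change 0 < cosHalfSq (hopfAmbient s₀) (hopf s₀)
        rw [hself]; exact one_pos)
    filter_upwards [hpos] with u hu y
    have := fiberMean_hopf f Θ (footPoint u s₀) y
    rw [hopf_footPoint hu] at this
    exact this.symm

theorem contDiffAt_fiberMean (hf : ContMDiff (𝓡 3) (𝓡 3) ∞ f) {Θ : JetData × E3 → B}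
    {u : S2} {y₀ : E3} (hΘ : ∀ s : S3, hopf s = u → ContDiffAt ℝ ∞ Θ (jet f s, y₀)) :
    ContDiffAt ℝ ∞ (fiberMean f Θ u) y₀ := by
  obtain ⟨K, hK, he⟩ := exists_contDiffAt_fiberMean hf hΘ
  have h1 : ContDiffAt ℝ ∞ (fun y => K ((u : E3), y)) y₀ :=
    ContDiffAt.comp (g := K) (f := fun y => ((u : E3), y)) y₀ hK (by fun_prop)
  refine h1.congr_of_eventuallyEq (Eventually.of_forall fun y => ?_)
  exact (he.self_of_nhds y).symm

theorem inner_fiberMean (hf : ContMDiff (𝓡 3) (𝓡 3) ∞ f) {Θ : JetData × E3 → E3}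
    {u : S2} {y w : E3} {c : ℝ} (hΘ : ∀ s : S3, hopf s = u → ContinuousAt Θ (jet f s, y))
    (h : ∀ s : S3, hopf s = u → inner ℝ (Θ (jet f s, y)) w = c) :
    inner ℝ (fiberMean f Θ u y) w = c := by
  obtain ⟨s, rfl⟩ := hopf_surjective u
  rw [fiberMean_hopf, inner_smul_left, real_inner_comm]
  have hc := continuous_comp_jet_rot hf (s := s) fun t => hΘ _ (hopf_rot s t)
  have := (innerSL ℝ w).intervalIntegral_comp_comm (hc.intervalIntegrable (μ := volume) 0 (2 * Real.pi))
  rw [innerSL_apply_apply] at this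
  rw [← this]
  have e : ∀ t, innerSL ℝ w (Θ (jet f (rot s t), y)) = c := fun t => by
    rw [innerSL_apply_apply, real_inner_comm]; exact h _ (hopf_rot s t)
  simp only [e, intervalIntegral.integral_const, smul_eq_mul]
  have := Real.two_pi_pos
  simp
  field_simp

end FiberMean

/-! ### Zeros of the mean vector fields, uniformly over the sphere -/

section UniformZeros

variable {f : S3 → S3} {ε : ℝ}

/-- The region in which the densities are smooth. -/
def RegularAt (w : JetData × E3) : Prop :=
  w.2 ≠ 0 ∧ 0 < cosHalfSq w.1.1 w.2 ∧ 0 < cosHalfSq w.1.1 (‖w.2‖⁻¹ • w.2)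

theorem eventually_regularAt (u : S2) : ∀ᶠ w in 𝓝 (fiberJet u, (u : E3)), RegularAt w := by
  have h1 : ∀ᶠ w : JetData × E3 in 𝓝 (fiberJet u, (u : E3)), w.2 ≠ 0 :=
    (isOpen_ne.preimage continuous_snd).mem_nhds (coe_S2_ne_zero u)
  have h2 : ∀ᶠ w : JetData × E3 in 𝓝 (fiberJet u, (u : E3)), 0 < cosHalfSq w.1.1 w.2 := by
    refine (isOpen_lt continuous_const contDiff_cosHalfSq_jet.continuous).mem_nhds ?_
    change 0 < cosHalfSq (u : E3) u
    rw [cosHalfSq_self]; exact one_pos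
  have h3 : ContinuousAt (fun w : JetData × E3 => cosHalfSq w.1.1 (‖w.2‖⁻¹ • w.2))
      (fiberJet u, (u : E3)) := by
    refine ContinuousAt.comp (g := fun w : JetData × E3 => cosHalfSq w.1.1 w.2)
      (f := fun w : JetData × E3 => (w.1, ‖w.2‖⁻¹ • w.2))
      contDiff_cosHalfSq_jet.continuous.continuousAt ?_
    exact continuousAt_fst.prodMk (ContinuousAt.comp (g := fun y : E3 => ‖y‖⁻¹ • y)
      (f := fun w : JetData × E3 => w.2) (contDiffAt_normalize (coe_S2_ne_zero u)).continuousAt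
      continuousAt_snd)
  have h4 : ∀ᶠ c : ℝ in 𝓝 (cosHalfSq (u : E3) (‖(u : E3)‖⁻¹ • (u : E3))), 0 < c := by
    refine lt_mem_nhds ?_
    rw [normalize_eq_self (norm_coe_S2 u), cosHalfSq_self]; exact one_pos
  filter_upwards [h1, h2, h3.eventually h4] with w hw1 hw2 hw3 using ⟨hw1, hw2, hw3⟩

/-- A vector field depending on jet data which, on the jet data of the Hopf fibers, vanishes at
the base point of the fiber with derivative the identity. -/
structure IsHopfField (Θ : JetData × E3 → E3) : Prop where
  contDiffAt : ∀ w, RegularAt w → ContDiffAt ℝ ∞ Θ w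
  zero : ∀ u : S2, Θ (fiberJet u, (u : E3)) = 0
  hasFDerivAt : ∀ u : S2, HasFDerivAt (fun y => Θ (fiberJet u, y))
    (ContinuousLinearMap.id ℝ E3) (u : E3)
  inner_self : ∀ w, RegularAt w → inner ℝ (Θ w) w.2 = (‖w.2‖ ^ 2 - 1) / 2 * ‖w.2‖ ^ 2

/-- The mean of a vector field over the fiber over `u` behaves like the identity near `u`. -/
structure HasGoodMean (f : S3 → S3) (Θ : JetData × E3 → E3) (r : ℝ) : Prop where
  regular : ∀ (u : S2) (s : S3), hopf s = u → ∀ y ∈ Metric.ball (u : E3) r, RegularAt (jet f s, y)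
  near : ∀ u : S2, NearIdentityOn (fiberMean f Θ u) (Metric.ball (u : E3) r)
  exists_zero : ∀ u : S2, ∃ y ∈ Metric.ball (u : E3) r, fiberMean f Θ u y = 0

/-- The radius `δ` depends only on `Θ`. The tolerance `η` depends also on `r`, because the mean at
the center `u` must be at most `r/4` for a zero to exist in the ball. -/
theorem IsHopfField.exists_hasGoodMean {Θ : JetData × E3 → E3} (hΘ : IsHopfField Θ) :
    ∃ δ : ℝ, 0 < δ ∧ ∀ r, 0 < r → r ≤ δ → ∃ η : ℝ, 0 < η ∧ ∀ (f : S3 → S3) (ε : ℝ), ε ≤ η →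
      C1NearId f ε → ContMDiff (𝓡 3) (𝓡 3) ∞ f → HasGoodMean f Θ r := by
  have hcont : Continuous fun u : S2 => (fiberJet u, (u : E3)) :=
    continuous_fiberJet.prodMk continuous_subtype_val
  obtain ⟨δ₁, hδ₁, h1⟩ := exists_uniform_near_identity (Θ := Θ) (k := fiberJet)
    (e := fun u : S2 => (u : E3)) continuous_fiberJet continuous_subtype_val
    (fun u => hΘ.contDiffAt _ (eventually_regularAt u).self_of_nhds) hΘ.hasFDerivAt
  obtain ⟨δ₂, hδ₂, h2⟩ := exists_dist_lt_of_eventually hcont eventually_regularAt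
  refine ⟨min δ₁ δ₂, lt_min hδ₁ hδ₂, fun r hr hrδ => ?_⟩
  obtain ⟨η, hη, h3⟩ := exists_dist_lt_of_eventually (P := fun w => ‖Θ w‖ < r / 4) hcont
    fun u => by
      refine (hΘ.contDiffAt _ (eventually_regularAt u).self_of_nhds).continuousAt.norm.eventually
        (gt_mem_nhds ?_)
      change ‖Θ (fiberJet u, (u : E3))‖ < r / 4
      rw [hΘ.zero u, norm_zero]; positivity
  -- Jets move by at most `2ε`, so a quarter leaves room for strict inequalities.
  refine ⟨min η (min δ₁ δ₂) / 4, by positivity, fun f ε hε hC hf => ?_⟩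
  have hjet : ∀ s : S3, dist (jet f s) (fiberJet (hopf s)) < min η (min δ₁ δ₂) := fun s => by
    have h4 := hC.dist_jet_le hf s
    have h5 : 0 < min η (min δ₁ δ₂) := by positivity
    linarith
  have hreg : ∀ (u : S2) (s : S3), hopf s = u → ∀ y ∈ Metric.ball (u : E3) r,
      RegularAt (jet f s, y) := by
    rintro _ s rfl y hy
    refine h2 (hopf s) _ (max_lt ?_ ?_)
    · exact (hjet s).trans_le ((min_le_right _ _).trans (min_le_right _ _))
    · exact (Metric.mem_ball.1 hy).trans_le (hrδ.trans (min_le_right _ _))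
  have hnear : ∀ u : S2, NearIdentityOn (fiberMean f Θ u) (Metric.ball (u : E3) r) := by
    intro u
    obtain ⟨s, rfl⟩ := hopf_surjective u
    have h4 := NearIdentityOn.average (H := fun t y => Θ (jet f (rot s t), y))
      (s := Metric.ball (hopf s : E3) r) (fun t y hy y' hy' => ?_) (fun y hy => ?_)
    · intro y hy y' hy'
      rw [fiberMean_hopf, fiberMean_hopf]
      exact h4 y hy y' hy'
    · have h5 := hjet (rot s t)
      rw [hopf_rot] at h5
      have hsub := Metric.ball_subset_ball (x := (hopf s : E3)) (hrδ.trans (min_le_left δ₁ δ₂))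
      exact h1 (hopf s) _ (h5.trans_le ((min_le_right _ _).trans (min_le_left _ _)))
        y (hsub hy) y' (hsub hy')
    · exact continuous_comp_jet_rot hf fun t =>
        (hΘ.contDiffAt _ (hreg _ _ (hopf_rot s t) y hy)).continuousAt
  refine ⟨hreg, hnear, fun u => (hnear u).exists_zero hr ?_⟩
  obtain ⟨s, rfl⟩ := hopf_surjective u
  rw [fiberMean_hopf]
  refine norm_average_le fun t => (h3 (hopf s) (jet f (rot s t), (hopf s : E3))
    (max_lt ?_ ?_)).le
  · have h5 := hjet (rot s t)
    rw [hopf_rot] at h5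
    exact h5.trans_le (min_le_left _ _)
  · simpa using hη

/-- The inner product of the field with `y` does not depend on the jet, hence equals that of the
mean; at a zero it forces `‖y‖ = 1`. -/
theorem HasGoodMean.norm_eq_one {Θ : JetData × E3 → E3} {r : ℝ} (h : HasGoodMean f Θ r)
    (hΘ : IsHopfField Θ) (hf : ContMDiff (𝓡 3) (𝓡 3) ∞ f) {u : S2} {y : E3}
    (hy : y ∈ Metric.ball (u : E3) r) (h0 : fiberMean f Θ u y = 0) : ‖y‖ = 1 := by
  have h1 := inner_fiberMean hf (Θ := Θ) (u := u) (y := y) (w := y)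
    (c := (‖y‖ ^ 2 - 1) / 2 * ‖y‖ ^ 2)
    (fun s hs => (hΘ.contDiffAt _ (h.regular u s hs y hy)).continuousAt)
    (fun s hs => hΘ.inner_self _ (h.regular u s hs y hy))
  obtain ⟨s, hs⟩ := hopf_surjective u
  have hy0 : 0 < ‖y‖ := norm_pos_iff.2 (h.regular u s hs y hy).1
  rw [h0, inner_zero_left] at h1
  have h2 : ‖y‖ ^ 2 - 1 = 0 := by
    rcases mul_eq_zero.1 h1.symm with h3 | h3
    · linarith
    · exact absurd h3 (pow_pos hy0 2).ne'
  nlinarith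

/-- The zeros of the mean vector fields form a smooth map of the sphere. -/
theorem HasGoodMean.exists_smooth_zero {Θ : JetData × E3 → E3} {r : ℝ} (h : HasGoodMean f Θ r)
    (hΘ : IsHopfField Θ) (hf : ContMDiff (𝓡 3) (𝓡 3) ∞ f) :
    ∃ σ : S2 → S2, ContMDiff (𝓡 2) (𝓡 2) ∞ σ ∧ ∀ u : S2, dist (σ u) u < r ∧
      fiberMean f Θ u (σ u) = 0 := by
  have hex : ∀ u : S2, ∃ v : S2, dist v u < r ∧ fiberMean f Θ u v = 0 := fun u => by
    obtain ⟨y, hy, h0⟩ := h.exists_zero u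
    exact ⟨⟨y, mem_sphere_zero_iff_norm.2 (h.norm_eq_one hΘ hf hy h0)⟩, hy, h0⟩
  choose σ hσ hσ0 using hex
  refine ⟨σ, ?_, fun u => ⟨hσ u, hσ0 u⟩⟩
  have hcoe : ContMDiff (𝓡 2) 𝓘(ℝ, E3) ∞ (fun u : S2 => (σ u : E3)) := by
    intro u₀
    have hmem : (σ u₀ : E3) ∈ Metric.ball (u₀ : E3) r := hσ u₀
    have hsm : ∀ s : S3, hopf s = u₀ → ContDiffAt ℝ ∞ Θ (jet f s, (σ u₀ : E3)) := fun s hs =>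
      hΘ.contDiffAt _ (h.regular u₀ s hs _ hmem)
    obtain ⟨K, hK, he⟩ := exists_contDiffAt_fiberMean hf hsm
    have hinv : ((fderiv ℝ K ((u₀ : E3), (σ u₀ : E3))).comp (.inr ℝ E3 E3)).IsInvertible := by
      have h1 : HasFDerivAt (fun y => K ((u₀ : E3), y)) _ (σ u₀ : E3) :=
        (hK.differentiableAt (by simp)).hasFDerivAt.comp (σ u₀ : E3)
          (hasFDerivAt_prodMk_right (u₀ : E3) (σ u₀ : E3))
      have h2 : (fun y => K ((u₀ : E3), y)) = fiberMean f Θ u₀ := funext he.self_of_nhds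
      rw [h2] at h1
      exact (h.near u₀).isInvertible (Metric.isOpen_ball.mem_nhds hmem) h1
    have hφ : ContDiffAt ℝ ∞ (hK.implicitFunction (by simp) hinv) (u₀ : E3) :=
      hK.contDiffAt_implicitFunction (by simp) hinv
    have hφ0 : hK.implicitFunction (by simp) hinv (u₀ : E3) = σ u₀ :=
      hK.implicitFunction_apply_self (by simp) hinv
    have hφK := hK.eventually_apply_implicitFunction (by simp) hinv
    obtain ⟨φ, hφdef⟩ : ∃ φ, φ = hK.implicitFunction (by simp) hinv := ⟨_, rfl⟩
    rw [← hφdef] at hφ hφ0 hφK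
    rw [he.self_of_nhds, hσ0] at hφK
    have hφd : ∀ᶠ y in 𝓝 (u₀ : E3), dist (φ y) y < r := by
      refine (hφ.continuousAt.dist continuousAt_id).eventually (gt_mem_nhds ?_)
      rw [hφ0]; exact hσ u₀
    have hc : ContinuousAt (fun u : S2 => (u : E3)) u₀ := continuous_subtype_val.continuousAt
    have hφs : ContMDiffAt (𝓡 2) 𝓘(ℝ, E3) ∞ (fun u : S2 => φ (u : E3)) u₀ :=
      ContMDiffAt.comp (g := φ) u₀ hφ.contMDiffAt contMDiff_coe_S2.contMDiffAt
    refine hφs.congr_of_eventuallyEq ?_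
    filter_upwards [he, hc.eventually hφK, hc.eventually hφd] with u hu1 hu2 hu3
    -- Injectivity on the ball identifies the pointwise chosen zero with the smooth implicit
    -- solution.
    refine (h.near u).injOn (hσ u) hu3 ?_
    rw [hσ0 u, ← hu1]
    exact hu2.symm
  have : Fact (Module.finrank ℝ E3 = 2 + 1) := ⟨finrank_euclideanSpace_fin⟩
  exact ContMDiff.codRestrict_sphere (n := 2) hcoe fun u => (σ u).2

theorem inner_averageField (w : JetData × E3) :
    inner ℝ (averageField w) w.2 = (‖w.2‖ ^ 2 - 1) / 2 * ‖w.2‖ ^ 2 := by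
  rw [averageField, inner_add_left, inner_smul_left, inner_smul_left, inner_sub_left,
    inner_smul_left, inner_smul_left, real_inner_self_eq_norm_sq]
  simp
  right
  ring

/-- Euler's relation for a function that is constant on rays. -/
theorem inner_gradient_normalize {g : E3 → ℝ} {y : E3} (hy : y ≠ 0)
    (hg : DifferentiableAt ℝ (fun y : E3 => g (‖y‖⁻¹ • y)) y) :
    inner ℝ (gradient (fun y : E3 => g (‖y‖⁻¹ • y)) y) y = 0 := by
  rw [inner_gradient]
  have h1 : HasDerivAt (fun t : ℝ => t • y) y 1 := by
    simpa using (hasDerivAt_id (1 : ℝ)).smul_const y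
  have hg' : HasFDerivAt (fun y : E3 => g (‖y‖⁻¹ • y))
      (fderiv ℝ (fun y : E3 => g (‖y‖⁻¹ • y)) y) ((1 : ℝ) • y) := by
    rw [one_smul]; exact hg.hasFDerivAt
  have h2 := hg'.comp_hasDerivAt (1 : ℝ) h1
  have h3 : HasDerivAt (fun _ : ℝ => g (‖y‖⁻¹ • y)) 0 1 := hasDerivAt_const _ _
  refine h2.unique (h3.congr_of_eventuallyEq ?_)
  filter_upwards [lt_mem_nhds (zero_lt_one' ℝ)] with t ht
  have hn := norm_ne_zero_iff.2 hy
  simp only [Function.comp, norm_smul, Real.norm_of_nonneg ht.le, smul_smul]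
  congr 2
  field_simp

theorem isHopfField_averageField : IsHopfField averageField where
  contDiffAt := fun _ hw => contDiffAt_averageField hw.2.1
  zero := averageField_fiberJet_self
  hasFDerivAt := hasFDerivAt_averageField
  inner_self := fun w _ => inner_averageField w

theorem isHopfField_energyField : IsHopfField energyField where
  contDiffAt := fun _ hw => contDiffAt_energyField hw.1 hw.2.2
  zero := energyField_fiberJet_self
  hasFDerivAt := hasFDerivAt_energyField
  inner_self := fun w hw => by
    have hd : DifferentiableAt ℝ (fun y : E3 => energyDensity w.1 (‖y‖⁻¹ • y)) w.2 := by
      have h1 := contDiffAt_normalized_energyDensity hw.1 hw.2.2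
      exact (ContDiffAt.comp (g := fun w : JetData × E3 => energyDensity w.1 (‖w.2‖⁻¹ • w.2))
        (f := fun y => (w.1, y)) w.2 h1 (by fun_prop)).differentiableAt (by simp)
    rw [energyField, inner_add_left, inner_smul_left, inner_gradient_normalize hw.1 hd,
      inner_smul_left, real_inner_self_eq_norm_sq]
    simp

end UniformZeros

/-! ### The Riemannian Hessian as a Euclidean one -/

section Hessian

theorem radialExt_of_ne_zero {G : Type*} [Zero G] (g : S2 → G) {y : E3} (h : y ≠ 0) :
    ∃ x : S2, (x : E3) = ‖y‖⁻¹ • y ∧ radialExt g y = g x := by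
  refine ⟨⟨‖y‖⁻¹ • y, ?_⟩, rfl, ?_⟩
  · rw [mem_sphere_zero_iff_norm, norm_smul, norm_inv, norm_norm,
      inv_mul_cancel₀ (norm_ne_zero_iff.2 h)]
  · rw [radialExt, dif_pos h]

/-- Extending the gradient along rays inserts the differential of `y ↦ y / ‖y‖`, which fixes the
tangent vector `U`, and the projection in `covDeriv` is invisible to the tangent vector `W`. -/
theorem sphereHess_eq {φ : S2 → ℝ} {x : S2} {G : E3 → ℝ} (hG : ContDiffAt ℝ ∞ G x)
    (h : radialExt φ =ᶠ[𝓝 (x : E3)] G) {U W : E3} (hU : inner ℝ (x : E3) U = 0)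
    (hW : inner ℝ (x : E3) W = 0) :
    sphereHess φ x U W = inner ℝ (fderiv ℝ (gradient G) (x : E3) U) W := by
  have hN : ContinuousAt (fun y : E3 => ‖y‖⁻¹ • y) (x : E3) :=
    (contDiffAt_normalize (coe_S2_ne_zero x)).continuousAt
  have hgr : ∀ᶠ y in 𝓝 (x : E3), gradient (radialExt φ) y = gradient G y :=
    h.eventually_nhds.mono fun y hy => by
      rw [gradient_eq_riesz, gradient_eq_riesz, Filter.EventuallyEq.fderiv_eq (𝕜 := ℝ) hy]
  have hgr' : ∀ᶠ y in 𝓝 (‖(x : E3)‖⁻¹ • (x : E3)), gradient (radialExt φ) y = gradient G y := by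
    rwa [normalize_eq_self (norm_coe_S2 x)]
  have hext : radialExt (sphereGrad φ) =ᶠ[𝓝 (x : E3)] fun y => gradient G (‖y‖⁻¹ • y) := by
    filter_upwards [hN.eventually hgr', isOpen_ne.mem_nhds (coe_S2_ne_zero x)] with y hy hy0
    obtain ⟨v, hv, he⟩ := radialExt_of_ne_zero (sphereGrad φ) hy0
    rw [he, sphereGrad, hv]
    exact hy
  have hd : HasFDerivAt (gradient G) (fderiv ℝ (gradient G) (x : E3))
      (‖(x : E3)‖⁻¹ • (x : E3)) := by
    rw [normalize_eq_self (norm_coe_S2 x)]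
    exact ((contDiffAt_gradient hG).differentiableAt (by simp)).hasFDerivAt
  have hcomp := HasFDerivAt.comp (g := gradient G) (f := fun y : E3 => ‖y‖⁻¹ • y) (x : E3) hd
    (hasFDerivAt_normalize (norm_coe_S2 x))
  have hfd : fderiv ℝ (radialExt (sphereGrad φ)) (x : E3) U
      = fderiv ℝ (gradient G) (x : E3) U := by
    rw [hext.fderiv_eq]
    have h2 := congrArg (fun L : E3 →L[ℝ] E3 => L U) hcomp.fderiv
    refine h2.trans ?_
    simp [hU]
  rw [sphereHess, covDeriv, hfd, inner_sub_left, inner_smul_left, hW, mul_zero, sub_zero]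

theorem inner_fderiv_gradient_symm {G : E3 → ℝ} {x : E3} (hG : ContDiffAt ℝ ∞ G x) (U W : E3) :
    inner ℝ (fderiv ℝ (gradient G) x U) W = inner ℝ (fderiv ℝ (gradient G) x W) U := by
  have h1 : DifferentiableAt ℝ (fderiv ℝ G) x :=
    (hG.fderiv_right (m := ∞) le_rfl).differentiableAt (by simp)
  have h2 : HasFDerivAt (gradient G) ((riesz E3).comp (fderiv ℝ (fderiv ℝ G) x)) x :=
    (riesz E3).hasFDerivAt.comp x h1.hasFDerivAt
  rw [h2.fderiv]
  change inner ℝ (riesz E3 _) W = inner ℝ (riesz E3 _) U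
  rw [inner_riesz, inner_riesz]
  refine hG.isSymmSndFDerivAt ?_ U W
  rw [minSmoothness_of_isRCLikeNormedField]
  exact WithTop.coe_le_coe.2 le_top

end Hessian

/-! ### Hessian, smoothness and minimum of the energy; balanced fibers -/

section Energy

variable {f : S3 → S3} {ε : ℝ}

/-- The energy density, extended to be constant on rays. -/
noncomputable def rayEnergyDensity (w : JetData × E3) : ℝ := energyDensity w.1 (‖w.2‖⁻¹ • w.2)

theorem contDiffAt_rayEnergyDensity {w : JetData × E3} (h : RegularAt w) :
    ContDiffAt ℝ ∞ rayEnergyDensity w := contDiffAt_normalized_energyDensity h.1 h.2.2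

theorem hasFDerivAt_snd_of_contDiffAt {D E B : Type} [NormedAddCommGroup D] [NormedSpace ℝ D]
    [NormedAddCommGroup E] [NormedSpace ℝ E] [NormedAddCommGroup B] [NormedSpace ℝ B]
    {F : D × E → B} {z : D × E} (h : ContDiffAt ℝ ∞ F z) :
    HasFDerivAt (fun y => F (z.1, y)) ((fderiv ℝ F z).comp (.inr ℝ D E)) z.2 :=
  (h.differentiableAt (by simp)).hasFDerivAt.comp (f := fun y : E => (z.1, y)) z.2
    (hasFDerivAt_prodMk_right z.1 z.2)

/-- The gradient commutes with the mean, and the radial term does not involve the jet. So the mean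
field is itself a gradient, whose derivative contains the Hessian of the energy. -/
theorem fiberMean_energyField (hf : ContMDiff (𝓡 3) (𝓡 3) ∞ f) {u : S2} {y : E3}
    (hreg : ∀ s : S3, hopf s = u → RegularAt (jet f s, y)) :
    fiberMean f energyField u y = (4 : ℝ) • gradient (fiberMean f rayEnergyDensity u) y
      + ((‖y‖ ^ 2 - 1) / 2) • y := by
  obtain ⟨s, rfl⟩ := hopf_surjective u
  have hsm : ∀ t, ContDiffAt ℝ ∞ rayEnergyDensity (jet f (rot s t), y) := fun t =>
    contDiffAt_rayEnergyDensity (hreg _ (hopf_rot s t))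
  have hD : Continuous fun t => fderiv ℝ (fun y => rayEnergyDensity (jet f (rot s t), y)) y := by
    have h1 : Continuous fun t =>
        (fderiv ℝ rayEnergyDensity (jet f (rot s t), y)).comp (.inr ℝ JetData E3) :=
      continuous_comp_jet_rot hf
        (Θ := fun w => (fderiv ℝ rayEnergyDensity w).comp (.inr ℝ JetData E3)) fun t =>
        (((hsm t).fderiv_right (m := ∞) le_rfl).continuousAt).clm_comp continuousAt_const
    refine h1.congr fun t => ?_
    exact (hasFDerivAt_snd_of_contDiffAt (hsm t)).fderiv.symm
  have hder : HasFDerivAt (fiberMean f rayEnergyDensity (hopf s)) ((1 / (2 * Real.pi)) •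
      ∫ t in (0 : ℝ)..(2 * Real.pi), fderiv ℝ (fun y => rayEnergyDensity (jet f (rot s t), y)) y)
      y := by
    have h1 := hasFDerivAt_intervalIntegral
      (Ξ := fun y t => rayEnergyDensity (jet f (rot s t), y)) (x₀ := y) (a := 0)
      (b := 2 * Real.pi) fun t _ => by
        have h2 := contDiffAt_comp_jet hf (hsm t)
        have h3 : ContDiffAt ℝ ∞ (fun w : E3 × ℝ => (((s : ℍ[ℝ]), w.1), w.2)) (y, t) := by fun_prop
        exact (ContDiffAt.comp (y, t) (f := fun w : E3 × ℝ => (((s : ℍ[ℝ]), w.1), w.2)) h2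
          h3).of_le (by exact_mod_cast le_top)
    refine (h1.const_smul (1 / (2 * Real.pi))).congr_of_eventuallyEq
      (Eventually.of_forall fun y => ?_)
    exact fiberMean_hopf f rayEnergyDensity s y
  have hgrad : gradient (fiberMean f rayEnergyDensity (hopf s)) y = (1 / (2 * Real.pi)) •
      ∫ t in (0 : ℝ)..(2 * Real.pi), gradient (fun y => rayEnergyDensity (jet f (rot s t), y)) y := by
    rw [gradient_eq_riesz, hder.fderiv, map_smul, ← ContinuousLinearMap.intervalIntegral_comp_comm
      (riesz E3) (hD.intervalIntegrable _ _)]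
    rfl
  have hgc : Continuous fun t => gradient (fun y => rayEnergyDensity (jet f (rot s t), y)) y :=
    (riesz E3).continuous.comp hD
  rw [hgrad, fiberMean_hopf]
  change (1 / (2 * Real.pi)) • (∫ t in (0 : ℝ)..(2 * Real.pi),
    ((4 : ℝ) • gradient (fun y => rayEnergyDensity (jet f (rot s t), y)) y
      + ((‖y‖ ^ 2 - 1) / 2) • y)) = _
  rw [intervalIntegral.integral_add
    (f := fun t => (4 : ℝ) • gradient (fun y => rayEnergyDensity (jet f (rot s t), y)) y)
    (g := fun _ => ((‖y‖ ^ 2 - 1) / 2) • y) ((hgc.const_smul (4 : ℝ)).intervalIntegrable _ _)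
    (continuous_const.intervalIntegrable _ _), intervalIntegral.integral_smul,
    intervalIntegral.integral_const, smul_add, smul_comm, sub_zero, smul_smul (1 / (2 * Real.pi)),
    one_div_mul_cancel Real.two_pi_pos.ne', one_smul]

theorem C1NearId.energy_eq_fiberMean (h : C1NearId f ε) (hf : ContMDiff (𝓡 3) (𝓡 3) ∞ f)
    (hε : ε ≤ 1 / 40) {u x : S2} (hx : dist x u < 1 / 4) :
    energy (shootField f u) x = fiberMean f rayEnergyDensity u x := by
  obtain ⟨s, rfl⟩ := hopf_surjective u
  rw [h.energy_shootField hf hε hx, fiberMean_hopf]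
  simp only [rayEnergyDensity, normalize_eq_self (norm_coe_S2 x)]

/-- Both sides are constant on rays, so agreement on the sphere near `x` suffices. -/
theorem C1NearId.radialExt_energy (h : C1NearId f ε) (hf : ContMDiff (𝓡 3) (𝓡 3) ∞ f)
    (hε : ε ≤ 1 / 40) {u x : S2} (hx : dist x u < 1 / 4) :
    radialExt (energy (shootField f u)) =ᶠ[𝓝 (x : E3)] fiberMean f rayEnergyDensity u := by
  have hN : ContinuousAt (fun y : E3 => ‖y‖⁻¹ • y) (x : E3) :=
    (contDiffAt_normalize (coe_S2_ne_zero x)).continuousAt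
  have hev : ∀ᶠ y in 𝓝 (‖(x : E3)‖⁻¹ • (x : E3)), y ∈ Metric.ball (u : E3) (1 / 4) := by
    rw [normalize_eq_self (norm_coe_S2 x)]
    exact Metric.isOpen_ball.mem_nhds hx
  filter_upwards [hN.eventually hev, isOpen_ne.mem_nhds (coe_S2_ne_zero x)] with y hy hy0
  obtain ⟨v, hv, he⟩ := radialExt_of_ne_zero (energy (shootField f u)) hy0
  have hvu : dist v u < 1 / 4 := by
    rw [Subtype.dist_eq, hv]; exact hy
  rw [he, h.energy_eq_fiberMean hf hε hvu]
  obtain ⟨s, rfl⟩ := hopf_surjective u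
  rw [fiberMean_hopf, fiberMean_hopf]
  simp only [rayEnergyDensity, normalize_eq_self (norm_coe_S2 v), ← hv]

/-- At a unit vector `x` the radial term has derivative `⟨x, U⟩ x`, which vanishes for tangent `U`.
The near-identity bound therefore reads `4 Hess(U, U) ≥ ‖U‖² / 2`. -/
theorem C1NearId.hessPosDef_energy (h : C1NearId f ε) (hf : ContMDiff (𝓡 3) (𝓡 3) ∞ f)
    (hε : ε ≤ 1 / 40) {r : ℝ} (hr : r ≤ 1 / 4) (hgood : HasGoodMean f energyField r) {u x : S2}
    (hx : dist x u < r) : HessPosDef (energy (shootField f u)) x := by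
  have hmem : (x : E3) ∈ Metric.ball (u : E3) r := hx
  have hnhds : Metric.ball (u : E3) r ∈ 𝓝 (x : E3) := Metric.isOpen_ball.mem_nhds hmem
  have hG : ContDiffAt ℝ ∞ (fiberMean f rayEnergyDensity u) (x : E3) :=
    contDiffAt_fiberMean hf fun s hs =>
      contDiffAt_rayEnergyDensity (hgood.regular u s hs _ hmem)
  have hext := h.radialExt_energy hf hε (hx.trans_le hr)
  refine ⟨fun U W hU hW => ?_, fun U hU hU0 => ?_⟩
  · rw [sphereHess_eq hG hext hU hW, sphereHess_eq hG hext hW hU]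
    exact inner_fderiv_gradient_symm hG U W
  · rw [sphereHess_eq hG hext hU hU]
    have hgd : HasFDerivAt (gradient (fiberMean f rayEnergyDensity u)) _ (x : E3) :=
      ((contDiffAt_gradient hG).differentiableAt (by simp)).hasFDerivAt
    have hn : HasFDerivAt (fun y : E3 => ‖y‖ ^ 2) (2 • innerSL ℝ (x : E3)) (x : E3) :=
      (hasStrictFDerivAt_norm_sq (x : E3)).hasFDerivAt
    have hsum := (hgd.const_smul (4 : ℝ)).add
      (((hn.sub_const 1).mul_const (2⁻¹ : ℝ)).smul (hasFDerivAt_id (𝕜 := ℝ) (x : E3)))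
    have hfield : fiberMean f energyField u =ᶠ[𝓝 (x : E3)] fun y =>
        (4 : ℝ) • gradient (fiberMean f rayEnergyDensity u) y + ((‖y‖ ^ 2 - 1) / 2) • y := by
      filter_upwards [hnhds] with y hy
      exact fiberMean_energyField hf fun s hs => hgood.regular u s hs y hy
    have hH := hsum.congr_of_eventuallyEq hfield
    have key := (hgood.near u).half_le_inner_fderiv hnhds hH U
    have hU' : inner ℝ (x : E3) U = 0 := hU
    simp [inner_smul_left, hU'] at key
    have hUpos : 0 < ‖U‖ ^ 2 := pow_pos (norm_pos_iff.2 hU0) 2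
    linarith

theorem C1NearId.contMDiffOn_energy (h : C1NearId f ε) (hf : ContMDiff (𝓡 3) (𝓡 3) ∞ f)
    (hε : ε ≤ 1 / 40) {r : ℝ} (hr : r ≤ 1 / 4) (hgood : HasGoodMean f energyField r) :
    ContMDiffOn ((𝓡 2).prod (𝓡 2)) 𝓘(ℝ, ℝ) ∞
      (fun z : S2 × S2 => energy (shootField f z.1) z.2) {z | dist z.2 z.1 < r} := by
  rintro ⟨u₀, x₀⟩ hz
  have hx : dist x₀ u₀ < r := hz
  have hmem : (x₀ : E3) ∈ Metric.ball (u₀ : E3) r := hx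
  obtain ⟨K, hK, he⟩ := exists_contDiffAt_fiberMean hf (Θ := rayEnergyDensity) (u₀ := u₀)
    (y₀ := (x₀ : E3)) fun s hs => contDiffAt_rayEnergyDensity (hgood.regular u₀ s hs _ hmem)
  have hcoe : ContMDiff ((𝓡 2).prod (𝓡 2)) 𝓘(ℝ, E3 × E3) ∞
      (fun z : S2 × S2 => ((z.1 : E3), (z.2 : E3))) :=
    (contMDiff_coe_S2.comp contMDiff_fst).prodMk_space (contMDiff_coe_S2.comp contMDiff_snd)
  have hcomp : ContMDiffAt ((𝓡 2).prod (𝓡 2)) 𝓘(ℝ, ℝ) ∞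
      (fun z : S2 × S2 => K ((z.1 : E3), (z.2 : E3))) (u₀, x₀) :=
    ContMDiffAt.comp (g := K) (u₀, x₀) hK.contMDiffAt hcoe.contMDiffAt
  have hopen : IsOpen {z : S2 × S2 | dist z.2 z.1 < r} :=
    isOpen_lt (continuous_snd.dist continuous_fst) continuous_const
  refine (hcomp.congr_of_eventuallyEq ?_).contMDiffWithinAt
  have hfst : ContinuousAt (fun z : S2 × S2 => z.1) (u₀, x₀) := continuousAt_fst
  filter_upwards [hopen.mem_nhds hz, hfst.eventually he] with z hz1 hz2
  have hz3 : dist z.2 z.1 < 1 / 4 := lt_of_lt_of_le hz1 hr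
  rw [h.energy_eq_fiberMean hf hε hz3, hz2]

/-- The mean field has the potential `4 E + (‖y‖² - 1)² / 8`, where `E` is extended along rays.
Comparison runs along chords, inside the convex ball but off the sphere; at the end points the
correction vanishes. -/
theorem C1NearId.energy_lt (h : C1NearId f ε) (hf : ContMDiff (𝓡 3) (𝓡 3) ∞ f)
    (hε : ε ≤ 1 / 40) {r : ℝ} (hr : r ≤ 1 / 4) (hgood : HasGoodMean f energyField r)
    {u x v : S2} (hv : dist v u < r) (hv0 : fiberMean f energyField u v = 0) (hx : dist x u < r)
    (hne : x ≠ v) : energy (shootField f u) v < energy (shootField f u) x := by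
  have hψ : ∀ y ∈ Metric.ball (u : E3) r, HasFDerivAt
      (fun y => 4 * fiberMean f rayEnergyDensity u y + (‖y‖ ^ 2 - 1) ^ 2 / 8)
      (innerSL ℝ (fiberMean f energyField u y)) y := fun y hy => by
    have hG : ContDiffAt ℝ ∞ (fiberMean f rayEnergyDensity u) y :=
      contDiffAt_fiberMean hf fun s hs =>
        contDiffAt_rayEnergyDensity (hgood.regular u s hs _ hy)
    have hn : HasFDerivAt (fun y : E3 => ‖y‖ ^ 2) (2 • innerSL ℝ y) y :=
      (hasStrictFDerivAt_norm_sq y).hasFDerivAt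
    have hsum := ((hG.differentiableAt (by simp)).hasFDerivAt.const_mul 4).add
      (((hn.sub_const 1).pow 2).mul_const (8⁻¹ : ℝ))
    refine hsum.congr_fderiv ?_
    ext w
    rw [fiberMean_energyField hf fun s hs => hgood.regular u s hs y hy]
    simp
    ring
  have key := (hgood.near u).lt_of_hasFDerivAt (convex_ball _ _) hψ (y₀ := (v : E3))
    (y := (x : E3)) hv hx hv0 fun he => hne (Subtype.ext he)
  rw [h.energy_eq_fiberMean hf hε (hv.trans_le hr), h.energy_eq_fiberMean hf hε (hx.trans_le hr)]
  simp only [norm_coe_S2] at key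
  linarith

/-- On the unit sphere the radial term vanishes and `averageField` is the negative of
`averageDensity`. -/
theorem C1NearId.isBalancedOn_iff (h : C1NearId f ε) (hf : ContMDiff (𝓡 3) (𝓡 3) ∞ f)
    (hε : ε ≤ 1 / 40) {u x : S2} (hx : dist x u < 1 / 4) :
    IsBalancedOn (shootField f u) x ↔ fiberMean f averageField u x = 0 := by
  obtain ⟨s, rfl⟩ := hopf_surjective u
  have e : ∀ p, averageField (p, (x : E3)) = -averageDensity p x := fun p => by
    simp only [averageField, averageDensity, norm_coe_S2]
    simp
  rw [IsBalancedOn, h.average_shootField hf hε hx, fiberMean_hopf]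
  simp only [e, intervalIntegral.integral_neg, smul_neg, neg_eq_zero]

end Energy

end HopfHunt

/-! ### The theorem -/

theorem mainTheorem6 :
    ∃ r₀ : ℝ, 0 < r₀ ∧ ∀ r : ℝ, 0 < r → r ≤ r₀ → ∃ ε : ℝ, 0 < ε ∧
      ∀ f : Diffeomorph (𝓡 3) (𝓡 3) S3 S3 ∞, C1NearId f ε →
        ∃ V : S2 → S3 → ℍ[ℝ],
          -- `V u` is the unique shooting field from the fibers near `fiber u` to `f (fiber u)`
          (∀ (u : S2) (q : S3), dist (hopf q) u < r →
            IsShootingVector (f '' fiber u) q (V u q) ∧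
              ∀ w : ℍ[ℝ], IsShootingVector (f '' fiber u) q w → w = V u q) ∧
          ContMDiffOn ((𝓡 2).prod (𝓡 3)) 𝓘(ℝ, ℍ[ℝ]) ∞ (fun z : S2 × S3 => V z.1 z.2)
            {z | dist (hopf z.2) z.1 < r} ∧
          -- the energy is smooth in both variables, with positive definite Hessian
          ContMDiffOn ((𝓡 2).prod (𝓡 2)) 𝓘(ℝ, ℝ) ∞ (fun z : S2 × S2 => energy (V z.1) z.2)
            {z | dist z.2 z.1 < r} ∧
          (∀ u x : S2, dist x u < r → HessPosDef (energy (V u)) x) ∧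
          -- the unique minimum point, smooth in the source fiber
          (∃ m : S2 → S2, ContMDiff (𝓡 2) (𝓡 2) ∞ m ∧
            ∀ u : S2, dist (m u) u < r ∧
              ∀ x : S2, dist x u < r → x ≠ m u → energy (V u) (m u) < energy (V u) x) ∧
          -- the unique balanced fiber, smooth in the source fiber
          ∃ b : S2 → S2, ContMDiff (𝓡 2) (𝓡 2) ∞ b ∧
            ∀ u : S2, dist (b u) u < r ∧
              ∀ x : S2, dist x u < r → (IsBalancedOn (V u) x ↔ x = b u) := by
  obtain ⟨δ₁, hδ₁, h1⟩ := isHopfField_energyField.exists_hasGoodMean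
  obtain ⟨δ₂, hδ₂, h2⟩ := isHopfField_averageField.exists_hasGoodMean
  -- Within chord distance `1/4` the change of variables applies; `δ₁` and `δ₂` bound the radii on
  -- which the two mean fields are close to the identity.
  refine ⟨min (1 / 4) (min δ₁ δ₂), by positivity, fun r hr hrle => ?_⟩
  have hr4 : r ≤ 1 / 4 := hrle.trans (min_le_left _ _)
  obtain ⟨η₁, hη₁, g1⟩ := h1 r hr (hrle.trans ((min_le_right _ _).trans (min_le_left _ _)))
  obtain ⟨η₂, hη₂, g2⟩ := h2 r hr (hrle.trans ((min_le_right _ _).trans (min_le_right _ _)))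
  -- With `ε ≤ 1/40`, points of the image of `F_u` project to within `1/4 + 2ε < 1/2` of each `x` in
  -- the ball, where foot points exist and the density lies in `[1/2, 3/2]`.
  refine ⟨min (1 / 40) (min η₁ η₂), by positivity, fun F hC => ?_⟩
  have hf : ContMDiff (𝓡 3) (𝓡 3) ∞ F := F.contMDiff
  have hε : min (1 / 40) (min η₁ η₂) ≤ 1 / 40 := min_le_left _ _
  have hE := g1 F _ ((min_le_right _ _).trans (min_le_left _ _)) hC hf
  have hA := g2 F _ ((min_le_right _ _).trans (min_le_right _ _)) hC hf
  refine ⟨shootField F, fun u q hq => ?_, fun z hz => ?_, hC.contMDiffOn_energy hf hε hr4 hE,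
    fun u x hx => hC.hessPosDef_energy hf hε hr4 hE hx, ?_, ?_⟩
  · have hiff := hC.isShootingVector_iff_eq hf (hε.trans (by norm_num)) (u := u) (q := q)
      (hq.trans_le (hr4.trans (by norm_num)))
    exact ⟨(hiff _).2 rfl, fun w hw => (hiff w).1 hw⟩
  · have hz' : dist (hopf z.2) z.1 < 1 / 2 := lt_of_lt_of_le hz (hr4.trans (by norm_num))
    exact (hC.contMDiffAt_shootField hf (hε.trans (by norm_num)) hz').contMDiffWithinAt
  · obtain ⟨m, hm, hm0⟩ := hE.exists_smooth_zero isHopfField_energyField hf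
    exact ⟨m, hm, fun u => ⟨(hm0 u).1, fun x hx hne =>
      hC.energy_lt hf hε hr4 hE (hm0 u).1 (hm0 u).2 hx hne⟩⟩
  · obtain ⟨b, hb, hb0⟩ := hA.exists_smooth_zero isHopfField_averageField hf
    refine ⟨b, hb, fun u => ⟨(hb0 u).1, fun x hx => ?_⟩⟩
    rw [hC.isBalancedOn_iff hf hε (hx.trans_le hr4)]
    constructor
    · intro hx0
      exact Subtype.ext ((hA.near u).injOn hx (hb0 u).1 (hx0.trans (hb0 u).2.symm))
    · rintro rfl
      exact (hb0 u).2
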